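/- **Theorem.** There is an absolute constant $C$ such that for every $n\ge 3$ and every convex $n$-gon $P$ given by its vertices $p_0,\dots,p_{n-1}\in\mathbb R^2$ in counter-clockwise cyclic order (any three of them, in this order, form a nondegenerate counter-clockwise triangle), the algorithm LARGEST described below halts on the input $(p_0,\dots,p_{n-1})$ and returns three vertex indices $i,j,k$ such that the triangle $p_ip_jp_k$ has the maximal area among all triangles inscribed in $P$ (all triangles with vertices in the polygon $\operatorname{conv}\{p_0,\dots,p_{n-1}\}$). It halts after at most $Cn$ iterations of its loops, and it performs at most $Cn$ elementary operations (unit-cost exact arithmetic operations and comparisons on real numbers and on integers, array accesses, and loop jumps). So a maximum-area inscribed triangle is found in linear time. *Conventions.* Vertex indices are integers understood modulo $n$; $v\wedge w=v_1w_2-v_2w_1$. A quotient with denominator $0$ is undefined. In both procedures, whenever the current values are $i_b,s_b,i_c,s_c$, we write $b=(1-s_b)p_{i_b}+s_bp_{i_b+1}$, $c=(1-s_c)p_{i_c}+s_cp_{i_c+1}$, $v=p_{i_b+1}-p_{i_b}$, $w=p_{i_c+1}-p_{i_c}$. *Procedure* ANCHORED$(u)$, for a direction $u$. Let $i_a$ and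 $i_c$ be the first indices in $\{0,\dots,n-1\}$ at which $u\cdot p_i$ is minimal and maximal, respectively; put $a=p_{i_a}$, $i_b=i_c-1$, $s_b=1$, $s_c=0$. Repeat: 1. If $s_b=0$, replace $(i_b,s_b)$ by $(i_b-1,1)$. If $s_c=1$, replace $(i_c,s_c)$ by $(i_c+1,0)$. Compute $b,c,v,w$. 2. If $u\cdot v=0$, replace $(i_b,s_b)$ by $(i_b-1,1)$ and start the next iteration. Otherwise, if $u\cdot w=0$, replace $(i_c,s_c)$ by $(i_c+1,0)$ and start the next iteration. Otherwise, if $v\wedge w\le 0$, leave the loop. 3. Put $$t_q=\frac{u_1[(b_2-c_2)v_1w_1+(c_1-a_1)v_2w_1+(a_1-b_1)v_1w_2]-u_2[(b_1-c_1)v_2w_2+(c_2-a_2)v_1w_2+(a_2-b_2)v_2w_1]}{2\,(v\wedge w)},$$ $t_b=-t_q/(u\cdot v)$, $t_c=t_q/(u\cdot w)$. If $t_b\le0$ or $t_c\le0$, leave the loop. If $t_b<s_b$ and $t_c<1-s_c$, replace $s_b$ by $s_b-t_b$ and $s_c$ by $s_c+t_c$ and leave the loop. Otherwise, if $(1-s_c)t_b<s_bt_c$,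 replace $s_b$ by $s_b-(1-s_c)t_b/t_c$ and $(i_c,s_c)$ by $(i_c+1,0)$. Otherwise, replace $s_c$ by $s_c+s_bt_c/t_b$ and $(i_b,s_b)$ by $(i_b-1,1)$. On leaving the loop, return $i_a,i_b,s_b,i_c,s_c$. *Algorithm* LARGEST. Obtain $i_a,i_b,s_b,i_c,s_c$ from ANCHORED$((1,0))$. Put $i_a^{0}=i_a$ and $A_{\max}=0$. While $i_a\le i_a^{0}+n$, do the following: 1. If $s_b=1$, replace $(i_b,s_b)$ by $(i_b+1,0)$. If $s_c=1$, replace $(i_c,s_c)$ by $(i_c+1,0)$. Compute $b,c,v,w$, $a=p_{i_a}$ and $e=p_{i_a+1}-p_{i_a}$. 2. If $\operatorname{area}(abc)>A_{\max}$ and $s_b=s_c=0$, put $A_{\max}=\operatorname{area}(abc)$ and record $(i_a,i_b,i_c)$. 3. If $e\wedge(c-b)=0$, replace $i_a$ by $i_a+1$ and recompute $a=p_{i_a}$, $e=p_{i_a+1}-p_{i_a}$. 4. Compute $$Q=(c_2-b_2)[(b_2-c_2)v_1w_1-(a_1-c_1)v_2w_1+(a_1-b_1)v_1w_2]+(c_1-b_1)[(b_1-c_1)v_2w_2-(a_2-c_2)v_1w_2+(a_2-b_2)v_2w_1].$$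 * If $Q>0$, add to $s_b$ the smallest positive value among those of $$1-s_b,\qquad \frac{e\wedge(c-b)}{e\wedge v},\qquad \frac{N}{(v\wedge w)\,\bigl(v\wedge(a+b-2c)\bigr)}$$ that are defined. * If $Q<0$, add to $s_c$ the smallest positive value among those of $$1-s_c,\qquad \frac{e\wedge(b-c)}{e\wedge w},\qquad \frac{-N}{(v\wedge w)\,\bigl(w\wedge(a+c-2b)\bigr)}$$ that are defined. Here $$N=v_1w_1(b_2-c_2)^2+v_2w_2(b_1-c_1)^2+v_1w_2[(a_1-b_1)b_2+(c_1-b_1)a_2+(2b_1-a_1-c_1)c_2]+v_2w_1[(b_1-c_1)a_2-(c_1-a_1)c_2+(2c_1-a_1-b_1)b_2].$$ * If $Q=0$, put $\alpha=2(v\wedge w)$, $\beta=v\wedge(2c-a-b)$, $\gamma=w\wedge(2b-a-c)$ and consider the pairs $$\Bigl(1-s_b,\ \tfrac{\beta(1-s_b)}{\gamma-\alpha(1-s_b)}\Bigr),\qquad \Bigl(\tfrac{\gamma(1-s_c)}{\beta+\alpha(1-s_c)},\ 1-s_c\Bigr),\qquad (t_{b,3},t_{c,3}),$$ where $$t_{b,3}=\frac{v_1w_1e_2(b_2-c_2)+v_2w_2e_1(b_1-c_1)+v_1w_2(e_1(b_2-a_2)-e_2(2b_1-a_1-c_1))+v_2w_1(e_2(b_1-a_1)-e_1(2b_2-a_2-c_2))}{2(v\wedge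 w)(e_2v_1-e_1v_2)},$$ $$t_{c,3}=\frac{v_1w_1e_2(b_2-c_2)+v_2w_2e_1(b_1-c_1)+v_2w_1(-e_1(c_2-a_2)+e_2(2c_1-a_1-b_1))+v_1w_2(-e_2(c_1-a_1)+e_1(2c_2-a_2-b_2))}{2(v\wedge w)(e_2w_1-e_1w_2)}.$$ Among the pairs with both entries defined and nonnegative take the one, $(t_b,t_c)$, with the smallest first entry (the first such pair in the given order in case of a tie), and replace $s_b$ by $s_b+t_b$ and $s_c$ by $s_c+t_c$ (if there were no such pair, nothing would be changed). When the loop is left, return the recorded indices (modulo $n$). -/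

import Mathlib

noncomputable section

namespace MaxTriangle

/-! ### Geometry -/

/-- Twice the signed area of the triangle `x y z`. -/
def orient (x y z : ℝ × ℝ) : ℝ :=
  (y.1 - x.1) * (z.2 - x.2) - (y.2 - x.2) * (z.1 - x.1)

/-- The area of the triangle `x y z`. -/
def triArea (x y z : ℝ × ℝ) : ℝ := |orient x y z| / 2

/-- `P 0, …, P (n - 1)` are the vertices, in counter-clockwise cyclic order, of a convex `n`-gon:
every three of them, taken in that order, form a (nondegenerate) counter-clockwise triangle. -/
def IsConvexNGon {n : ℕ} (P : Fin n → ℝ × ℝ) : Prop :=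
  3 ≤ n ∧ ∀ i j k : Fin n, i < j → j < k → 0 < orient (P i) (P j) (P k)

/-- The triangle with vertices `P i, P j, P k` has maximal area among all the triangles contained
in the polygon (the convex hull of the points `P m`). -/
def IsLargestInscribed {n : ℕ} (P : Fin n → ℝ × ℝ) (i j k : Fin n) : Prop :=
  ∀ x ∈ convexHull ℝ (Set.range P), ∀ y ∈ convexHull ℝ (Set.range P),
    ∀ z ∈ convexHull ℝ (Set.range P), triArea x y z ≤ triArea (P i) (P j) (P k)

/-! ### Computations with a count of the elementary operations (unit-cost real RAM) -/

/-- A computed value together with the number of elementary operations spent on it. Elementary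
operations are arithmetic operations and comparisons of real numbers (exact) and of integers, and
accesses to the input array. -/
structure Timed (α : Type) where
  val : α
  ops : ℕ

namespace Timed

instance : Monad Timed where
  pure x := ⟨x, 0⟩
  bind x f := ⟨(f x.val).val, x.ops + (f x.val).ops⟩

/-- The content of a register; reading it is free of charge. -/
def reg {α : Type} (x : α) : Timed α := ⟨x, 0⟩

instance {α : Type} {k : ℕ} [OfNat α k] : OfNat (Timed α) k := ⟨reg (OfNat.ofNat k)⟩
instance {α : Type} [Add α] : Add (Timed α) := ⟨fun x y => ⟨x.val + y.val, x.ops + y.ops + 1⟩⟩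
instance {α : Type} [Sub α] : Sub (Timed α) := ⟨fun x y => ⟨x.val - y.val, x.ops + y.ops + 1⟩⟩
instance {α : Type} [Mul α] : Mul (Timed α) := ⟨fun x y => ⟨x.val * y.val, x.ops + y.ops + 1⟩⟩
instance {α : Type} [Div α] : Div (Timed α) := ⟨fun x y => ⟨x.val / y.val, x.ops + y.ops + 1⟩⟩
instance {α : Type} [Neg α] : Neg (Timed α) := ⟨fun x => ⟨-x.val, x.ops + 1⟩⟩

/-- The absolute value. -/
def absolute (x : Timed ℝ) : Timed ℝ := ⟨|x.val|, x.ops + 1⟩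

open Classical in
/-- The comparison `x < y`. -/
def lt {α : Type} [LT α] (x y : Timed α) : Timed Bool :=
  ⟨decide (x.val < y.val), x.ops + y.ops + 1⟩

open Classical in
/-- The comparison `x ≤ y`. -/
def le {α : Type} [LE α] (x y : Timed α) : Timed Bool :=
  ⟨decide (x.val ≤ y.val), x.ops + y.ops + 1⟩

open Classical in
/-- The comparison `x = y`. -/
def eq {α : Type} (x y : Timed α) : Timed Bool :=
  ⟨decide (x.val = y.val), x.ops + y.ops + 1⟩

/-- Division, with an undefined result (`none`) when the denominator is `0`. -/
def divide (x y : Timed ℝ) : Timed (Option ℝ) := do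
  let num ← x
  let den ← y
  if (← eq (reg den) 0) then pure none
  else do
    let q ← reg num / reg den
    pure (some q)

end Timed

open Timed

/-- `Loop body s r k t`: the loop that keeps executing `body`, starting from the state `s`, is left
with the result `r` during its `k`-th iteration, after `t` elementary operations. An execution of
`body` yields either a new state (`Sum.inl`) or, when the loop is left, its result (`Sum.inr`);
each iteration is charged the operations of `body` and one more for the jump. -/
inductive Loop {σ τ : Type} (body : σ → Timed (σ ⊕ τ)) : σ → τ → ℕ → ℕ → Prop
  | leave (s : σ) (r : τ) : (body s).val = Sum.inr r → Loop body s r 1 ((body s).ops + 1)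
  | again (s s' : σ) (r : τ) (k t : ℕ) : (body s).val = Sum.inl s' → Loop body s' r k t →
      Loop body s r (k + 1) ((body s).ops + 1 + t)

/-- A loop has at most one outcome. -/
theorem Loop.unique {σ τ : Type} {body : σ → Timed (σ ⊕ τ)} {s : σ} {r r' : τ} {k k' t t' : ℕ}
    (h : Loop body s r k t) (h' : Loop body s r' k' t') : r = r' ∧ k = k' ∧ t = t' := by
  induction h generalizing r' k' t' with
  | leave s r e =>
    cases h' with
    | leave _ _ e' => rw [e] at e'; simp_all
    | again _ _ _ _ _ e' _ => rw [e] at e'; simp at e'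
  | again s s₁ r k t e _ ih =>
    cases h' with
    | leave _ _ e' => rw [e] at e'; simp at e'
    | again _ s₂ _ k₂ t₂ e' h₂ =>
      rw [e] at e'
      obtain rfl := Sum.inl.inj e'
      obtain ⟨h₁, h₂, h₃⟩ := ih h₂
      simp [h₁, h₂, h₃]

/-! ### Points and vectors -/

/-- Points and vectors of the plane. -/
abbrev Pt := ℝ × ℝ

/-- First coordinate. -/
def Pt.x (p : Pt) : Timed ℝ := reg p.1

/-- Second coordinate. -/
def Pt.y (p : Pt) : Timed ℝ := reg p.2

/-- The vector `q - p`. -/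
def vec (p q : Pt) : Timed Pt := do
  let d₁ ← Pt.x q - Pt.x p
  let d₂ ← Pt.y q - Pt.y p
  pure (d₁, d₂)

/-- The point `(1 - s) p + s q`. -/
def between (p q : Pt) (s : ℝ) : Timed Pt := do
  let m₁ ← Pt.x p * (1 - reg s) + Pt.x q * reg s
  let m₂ ← Pt.y p * (1 - reg s) + Pt.y q * reg s
  pure (m₁, m₂)

/-- The inner product. -/
def dot (v w : Pt) : Timed ℝ := v.x * w.x + v.y * w.y

/-- The wedge product. -/
def wedge (v w : Pt) : Timed ℝ := v.x * w.y - v.y * w.x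

/-- The area of a triangle, as computed by the algorithm. -/
def area (a b c : Pt) : Timed ℝ := do
  let v ← vec a b
  let w ← vec a c
  absolute (wedge v w) / 2

section Algorithm

variable {n : ℕ} [NeZero n]

/-- Vertex indices are integers that are understood modulo `n`. -/
def index (n : ℕ) [NeZero n] (i : ℤ) : Fin n :=
  ⟨(i % (n : ℤ)).toNat, by
    have hn : (n : ℤ) ≠ 0 := by exact_mod_cast NeZero.ne n
    have h₀ := Int.emod_nonneg i hn
    have h₁ := Int.emod_lt_of_pos i (by omega : (0 : ℤ) < n)
    omega⟩

/-- Reading the vertex with index `i`: one reduction modulo `n` and one access to the array. -/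
def vertex (P : Fin n → Pt) (i : ℤ) : Timed Pt := ⟨P (index n i), 2⟩

/-- The first index at which `f` is smallest, found by a linear scan; one operation per index is
charged for the counter. -/
def argmin (f : Fin n → Timed ℝ) : Timed (Fin n) :=
  (List.finRange n).foldlM (fun best i => do
    let _ ← (⟨(), 1⟩ : Timed Unit)
    if (← lt (f i) (f best)) then pure i else pure best) 0

/-- The first index at which `f` is largest, found by a linear scan. -/
def argmax (f : Fin n → Timed ℝ) : Timed (Fin n) :=
  (List.finRange n).foldlM (fun best i => do
    let _ ← (⟨(), 1⟩ : Timed Unit)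
    if (← lt (f best) (f i)) then pure i else pure best) 0

/-! ### Formulas used by the algorithm -/

def calculateQ (a b v c w : Pt) : Timed ℝ :=
  (c.y - b.y) * ((b.y - c.y) * v.x * w.x - (a.x - c.x) * v.y * w.x + (a.x - b.x) * v.x * w.y)
    + (c.x - b.x) * ((b.x - c.x) * v.y * w.y - (a.y - c.y) * v.x * w.y + (a.y - b.y) * v.y * w.x)

def calculateTb4 (a b v c w : Pt) : Timed (Option ℝ) :=
  divide
    (v.x * w.x * (b.y - c.y) * (b.y - c.y) + v.y * w.y * (b.x - c.x) * (b.x - c.x)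
      + v.x * w.y * ((a.x - b.x) * b.y + (c.x - b.x) * a.y + (2 * b.x - a.x - c.x) * c.y)
      + v.y * w.x * ((b.x - c.x) * a.y - (c.x - a.x) * c.y + (2 * c.x - a.x - b.x) * b.y))
    ((v.x * w.y - v.y * w.x) * (v.x * (a.y + b.y - 2 * c.y) - v.y * (a.x + b.x - 2 * c.x)))

def calculateTc4 (a b v c w : Pt) : Timed (Option ℝ) :=
  divide
    (-(v.x * w.x * (b.y - c.y) * (b.y - c.y) + v.y * w.y * (b.x - c.x) * (b.x - c.x)
      + v.x * w.y * ((a.x - b.x) * b.y + (c.x - b.x) * a.y + (2 * b.x - a.x - c.x) * c.y)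
      + v.y * w.x * ((b.x - c.x) * a.y - (c.x - a.x) * c.y + (2 * c.x - a.x - b.x) * b.y)))
    ((v.x * w.y - v.y * w.x) * (w.x * (a.y + c.y - 2 * b.y) - w.y * (a.x + c.x - 2 * b.x)))

def calculateAlpha (v w : Pt) : Timed ℝ :=
  2 * (v.x * w.y - w.x * v.y)

def calculateBeta (a b v c : Pt) : Timed ℝ :=
  v.x * (2 * c.y - a.y - b.y) - v.y * (2 * c.x - b.x - a.x)

def calculateGamma (a b c w : Pt) : Timed ℝ :=
  w.x * (2 * b.y - a.y - c.y) - w.y * (2 * b.x - c.x - a.x)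

def calculateTb3 (a e b v c w : Pt) : Timed (Option ℝ) :=
  divide
    (v.x * w.x * e.y * (b.y - c.y) + v.y * w.y * e.x * (b.x - c.x)
      + v.x * w.y * (e.x * (b.y - a.y) - e.y * (2 * b.x - a.x - c.x))
      + v.y * w.x * (e.y * (b.x - a.x) - e.x * (2 * b.y - a.y - c.y)))
    (2 * (v.x * w.y - w.x * v.y) * (e.y * v.x - e.x * v.y))

def calculateTc3 (a e b v c w : Pt) : Timed (Option ℝ) :=
  divide
    (v.x * w.x * e.y * (b.y - c.y) + v.y * w.y * e.x * (b.x - c.x)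
      + v.y * w.x * (-(e.x * (c.y - a.y)) + e.y * (2 * c.x - a.x - b.x))
      + v.x * w.y * (-(e.y * (c.x - a.x)) + e.x * (2 * c.y - a.y - b.y)))
    (2 * (v.x * w.y - w.x * v.y) * (e.y * w.x - e.x * w.y))

def calculateTq (a b v c w u : Pt) : Timed ℝ :=
  (u.x * ((b.y - c.y) * v.x * w.x + (c.x - a.x) * v.y * w.x + (a.x - b.x) * v.x * w.y)
    - u.y * ((b.x - c.x) * v.y * w.y + (c.y - a.y) * v.x * w.y + (a.y - b.y) * v.y * w.x))
    / (2 * (v.x * w.y - v.y * w.x))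

/-! ### Selecting the next stopping event -/

/-- The smaller of the recorded value and the candidate `t`, where a candidate counts only if it is
defined and positive. -/
def updatePositive (best t : Option ℝ) : Timed (Option ℝ) :=
  match t with
  | none => pure best
  | some t => do
    if (← lt 0 (reg t)) then
      match best with
      | none => pure (some t)
      | some m => do if (← lt (reg t) (reg m)) then pure (some t) else pure (some m)
    else pure best

/-- The smallest positive value among the three candidates. -/
def smallestPositive (t₁ t₂ t₃ : Option ℝ) : Timed (Option ℝ) := do
  let m ← updatePositive none t₁
  let m ← updatePositive m t₂
  updatePositive m t₃

/-- The recorded pair or the candidate pair `(tb, tc)`, whichever has the smaller first entry, where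
a candidate counts only if both its entries are defined and nonnegative. -/
def updatePair (best : Option (ℝ × ℝ)) (tb tc : Option ℝ) : Timed (Option (ℝ × ℝ)) :=
  match tb, tc with
  | some tb, some tc => do
    if (← le 0 (reg tb)) && (← le 0 (reg tc)) then
      match best with
      | none => pure (some (tb, tc))
      | some m => do if (← lt (reg tb) (reg m.1)) then pure (some (tb, tc)) else pure (some m)
    else pure best
  | _, _ => pure best

/-! ### The algorithm -/

/-- A pair of points moving on the boundary of the polygon, `b` being the point
`(1 - sb) p_ib + sb p_(ib+1)` and `c` the point `(1 - sc) p_ic + sc p_(ic+1)`. -/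
structure Chord where
  ib : ℤ
  sb : ℝ
  ic : ℤ
  sc : ℝ

/-- One iteration of the loop of the procedure that finds a triangle anchored to `u`, with the vertex
of index `ia` opposite to the side normal to `u`. -/
def anchoredStep (P : Fin n → Pt) (u : Pt) (ia : ℤ) (s : Chord) : Timed (Chord ⊕ Chord) := do
  let (ib, sb) ← (do
    if (← eq (reg s.sb) 0) then do let i ← reg s.ib - 1; pure (i, 1)
    else pure (s.ib, s.sb) : Timed (ℤ × ℝ))
  let (ic, sc) ← (do
    if (← eq (reg s.sc) 1) then do let i ← reg s.ic + 1; pure (i, 0)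
    else pure (s.ic, s.sc) : Timed (ℤ × ℝ))
  let ib' ← reg ib + 1
  let ic' ← reg ic + 1
  let a ← vertex P ia
  let pb ← vertex P ib
  let pb' ← vertex P ib'
  let pc ← vertex P ic
  let pc' ← vertex P ic'
  let b ← between pb pb' sb
  let c ← between pc pc' sc
  let eb ← vec pb pb'
  let ec ← vec pc pc'
  if (← eq (dot u eb) 0) then do
    let i ← reg ib - 1
    pure (Sum.inl ⟨i, 1, ic, sc⟩)
  else if (← eq (dot u ec) 0) then
    pure (Sum.inl ⟨ib, sb, ic', 0⟩)
  else if (← le (wedge eb ec) 0) then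
    pure (Sum.inr ⟨ib, sb, ic, sc⟩)
  else do
    let tq ← calculateTq a b eb c ec u
    let tb ← -(reg tq) / dot u eb
    let tc ← reg tq / dot u ec
    if (← le (reg tb) 0) || (← le (reg tc) 0) then
      pure (Sum.inr ⟨ib, sb, ic, sc⟩)
    else if (← lt (reg tb) (reg sb)) && (← lt (reg tc) (1 - reg sc)) then do
      let sb' ← reg sb - reg tb
      let sc' ← reg sc + reg tc
      pure (Sum.inr ⟨ib, sb', ic, sc'⟩)
    else if (← lt ((1 - reg sc) * reg tb) (reg sb * reg tc)) then do
      let sb' ← reg sb - (1 - reg sc) * reg tb / reg tc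
      pure (Sum.inl ⟨ib, sb', ic', 0⟩)
    else do
      let sc' ← reg sc + reg sb * reg tc / reg tb
      let i ← reg ib - 1
      pure (Sum.inl ⟨i, 1, ic, sc'⟩)

/-- The initialization of the procedure that finds a triangle anchored to `u`. -/
def anchoredInit (P : Fin n → Pt) (u : Pt) : Timed (ℤ × Chord) := do
  let ia ← argmin (n := n) (fun i => do let p ← vertex P (i.val : ℤ); dot u p)
  let ic ← argmax (n := n) (fun i => do let p ← vertex P (i.val : ℤ); dot u p)
  let ib ← reg (ic.val : ℤ) - 1
  pure ((ia.val : ℤ), ⟨ib, 1, (ic.val : ℤ), 0⟩)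

/-- The state of the main loop: the current triangle, the largest recorded area, and the vertex
indices recorded with it (`none` as long as nothing has been recorded). -/
structure State (n : ℕ) where
  ia : ℤ
  chord : Chord
  areaMax : ℝ
  best : Option (Fin n × Fin n × Fin n)

/-- Where the chord of a triangle moves in one iteration of the main loop, given the values of
the triangle and of the tangents. -/
def advance (a ea b eb c ec : Pt) (s : Chord) : Timed Chord := do
  let bc ← vec b c
  let cb ← vec c b
  let q ← calculateQ a b eb c ec
  if (← lt 0 (reg q)) then do
    let tb₁ ← 1 - reg s.sb
    let tb₃ ← divide (wedge ea bc) (wedge ea eb)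
    let tb₄ ← calculateTb4 a b eb c ec
    match (← smallestPositive (some tb₁) tb₃ tb₄) with
    | some tb => do
      let sb ← reg s.sb + reg tb
      pure ⟨s.ib, sb, s.ic, s.sc⟩
    | none => pure s
  else if (← lt (reg q) 0) then do
    let tc₂ ← 1 - reg s.sc
    let tc₃ ← divide (wedge ea cb) (wedge ea ec)
    let tc₄ ← calculateTc4 a b eb c ec
    match (← smallestPositive (some tc₂) tc₃ tc₄) with
    | some tc => do
      let sc ← reg s.sc + reg tc
      pure ⟨s.ib, s.sb, s.ic, sc⟩
    | none => pure s
  else do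
    let α ← calculateAlpha eb ec
    let β ← calculateBeta a b eb c
    let γ ← calculateGamma a b c ec
    let tb₁ ← 1 - reg s.sb
    let tc₁ ← divide (reg β * reg tb₁) (reg γ - reg α * reg tb₁)
    let tc₂ ← 1 - reg s.sc
    let tb₂ ← divide (reg γ * reg tc₂) (reg β + reg α * reg tc₂)
    let tb₃ ← calculateTb3 a ea b eb c ec
    let tc₃ ← calculateTc3 a ea b eb c ec
    let m ← updatePair none (some tb₁) tc₁
    let m ← updatePair m tb₂ (some tc₂)
    match (← updatePair m tb₃ tc₃) with
    | some t => do
      let sb ← reg s.sb + reg t.1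
      let sc ← reg s.sc + reg t.2
      pure ⟨s.ib, sb, s.ic, sc⟩
    | none => pure s

/-- One iteration of the main loop. The loop is left when the index `ia` exceeds its initial value
`ia₀` by more than `n`; its result is the recorded triple of vertex indices. -/
def mainStep (P : Fin n → Pt) (ia₀ : ℤ) (s : State n) :
    Timed (State n ⊕ Option (Fin n × Fin n × Fin n)) := do
  if (← le (reg s.ia) (reg ia₀ + reg (n : ℤ))) then do
    let (ib, sb) ← (do
      if (← eq (reg s.chord.sb) 1) then do let i ← reg s.chord.ib + 1; pure (i, 0)
      else pure (s.chord.ib, s.chord.sb) : Timed (ℤ × ℝ))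
    let (ic, sc) ← (do
      if (← eq (reg s.chord.sc) 1) then do let i ← reg s.chord.ic + 1; pure (i, 0)
      else pure (s.chord.ic, s.chord.sc) : Timed (ℤ × ℝ))
    let ia' ← reg s.ia + 1
    let ib' ← reg ib + 1
    let ic' ← reg ic + 1
    let a ← vertex P s.ia
    let pa' ← vertex P ia'
    let pb ← vertex P ib
    let pb' ← vertex P ib'
    let pc ← vertex P ic
    let pc' ← vertex P ic'
    let b ← between pb pb' sb
    let c ← between pc pc' sc
    let ea ← vec a pa'
    let eb ← vec pb pb'
    let ec ← vec pc pc'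
    let abc ← area a b c
    let (areaMax, best) ← (do
      if (← lt (reg s.areaMax) (reg abc)) && (← eq (reg sb) 0) && (← eq (reg sc) 0) then
        -- three reductions modulo `n`
        (⟨(abc, some (index n s.ia, index n ib, index n ic)), 3⟩)
      else pure (s.areaMax, s.best) : Timed (ℝ × Option (Fin n × Fin n × Fin n)))
    let bc ← vec b c
    -- `a` advances when the next edge at `a` is parallel to `c - b`
    let (ia, a, ea) ← (do
      if (← eq (wedge ea bc) 0) then do
        let i' ← reg ia' + 1
        let pa'' ← vertex P i'
        let ea' ← vec pa' pa''
        pure (ia', pa', ea')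
      else pure (s.ia, a, ea) : Timed (ℤ × Pt × Pt))
    let chord ← advance a ea b eb c ec ⟨ib, sb, ic, sc⟩
    pure (Sum.inl ⟨ia, chord, areaMax, best⟩)
  else pure (Sum.inr s.best)

/-- The run of the whole algorithm on the input `P` halts with the output `out`, after `iters`
iterations of its two loops together and `time` elementary operations: a triangle anchored to the
direction `(1, 0)` is found first and is then moved around the polygon by the main loop. -/
def LargestInscribedTriangle (P : Fin n → Pt) (out : Option (Fin n × Fin n × Fin n))
    (iters time : ℕ) : Prop :=
  let init := anchoredInit P (1, 0)
  let ia₀ := init.val.1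
  ∃ (chord : Chord) (k₁ t₁ k₂ t₂ : ℕ),
    Loop (anchoredStep P (1, 0) ia₀) init.val.2 chord k₁ t₁ ∧
    Loop (mainStep P ia₀) ⟨ia₀, chord, 0, none⟩ out k₂ t₂ ∧
    iters = k₁ + k₂ ∧ time = init.ops + t₁ + t₂

end Algorithm

end MaxTriangle

end

noncomputable section

namespace MaxTriangle

open Timed

/-! ### Wedge products -/

/-! Fix an apex `a` and a chord `d = c - b` in front of it, with tangents `v` at `b` and `w` at `c`.
Put `S = d ∧ (a - b)`, `p = v ∧ d`, `q = d ∧ w`. When the chord is translated away from `a` with its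
ends on the tangent lines, the area changes at a rate proportional to `p q - (v ∧ w) S`, which is
minus the `balance`. A chord is balanced if neither direction of translation gains to first order.
Since the polygon lies inside the supporting lines at `b` and `c`, this local condition is global
and strict: by `eq_of_balance`, no other parallel chord carries a triangle that is at least as
large. Hence a balanced chord with apex `m` that is parallel to the side `i j` of a maximal triangle
`m i j` is that side (`IsMaximal.eq_of_parallel`).

The main loop carries a balanced chord around the polygon. The sign of the balance for the current
pair of edges decides what moves: `b` if it is negative, `c` if it is positive, both along the
hyperbola on which it vanishes if it is zero. The movement ends at the first event: an end reaches a
vertex, the balance becomes zero, or the chord becomes parallel to the edge at the apex. All chords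
in between are balanced (`BalancedChord.advanceSpec`). At a parallel event the apex slides along a
line parallel to the chord, so area and balance do not change (`BalancedChord.next_apex`).

Maximality of `m i j` puts the direction of the side `i j` between those of the chord when the apex
arrives at `m` and when it leaves `m`. By continuity some balanced chord with apex `m` is parallel
to the side, hence equal to it. During a movement some end is interior to an edge, so this chord can
occur only at the start of an iteration, and there the algorithm records it (`MainInv.next`).

The number of iterations is linear because each one raises a potential built from the three indices
and the vanishing of the balance. The first balanced chord comes from a vertical sweep starting at
the rightmost vertex, with the leftmost vertex as apex (`AnchoredInv.spec`). -/

/-- The wedge product of two vectors of the plane. -/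
def cross (v w : Pt) : ℝ := v.1 * w.2 - v.2 * w.1

theorem cross_add_right (u v w : Pt) : cross u (v + w) = cross u v + cross u w := by
  simp only [cross, Prod.fst_add, Prod.snd_add]; ring

theorem cross_sub_right (u v w : Pt) : cross u (v - w) = cross u v - cross u w := by
  simp only [cross, Prod.fst_sub, Prod.snd_sub]; ring

theorem cross_add_left (u v w : Pt) : cross (u + v) w = cross u w + cross v w := by
  simp only [cross, Prod.fst_add, Prod.snd_add]; ring

theorem cross_sub_left (u v w : Pt) : cross (u - v) w = cross u w - cross v w := by
  simp only [cross, Prod.fst_sub, Prod.snd_sub]; ring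

theorem cross_smul_left (r : ℝ) (v w : Pt) : cross (r • v) w = r * cross v w := by
  simp only [cross, Prod.smul_fst, Prod.smul_snd, smul_eq_mul]; ring

theorem cross_smul_right (r : ℝ) (v w : Pt) : cross v (r • w) = r * cross v w := by
  simp only [cross, Prod.smul_fst, Prod.smul_snd, smul_eq_mul]; ring

theorem cross_self (v : Pt) : cross v v = 0 := by
  simp only [cross]; ring

theorem cross_swap (v w : Pt) : cross v w = -cross w v := by
  simp only [cross]; ring

/-- Reversing the second vector of a wedge product exchanges the factors. -/
theorem cross_sub_swap (x y w : Pt) : cross (x - y) w = cross w (y - x) := by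
  simp only [cross, Prod.fst_sub, Prod.snd_sub]; ring

theorem cross_zero_right (v : Pt) : cross v 0 = 0 := by simp [cross]

theorem orient_eq_cross (x y z : Pt) : orient x y z = cross (y - x) (z - x) := by
  simp only [orient, cross, Prod.fst_sub, Prod.snd_sub]

theorem orient_rotate (x y z : Pt) : orient y z x = orient x y z := by
  simp only [orient]; ring

theorem orient_swap (x y z : Pt) : orient x z y = -orient x y z := by
  simp only [orient]; ring

theorem orient_eq_cross_base (a b c : Pt) : orient a b c = cross (c - b) (a - b) := by
  simp only [orient, cross, Prod.fst_sub, Prod.snd_sub]; ring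

/-- The Grassmann–Plücker relation. -/
theorem cross_plucker (u v w y : Pt) :
    cross u v * cross w y + cross v w * cross u y + cross w u * cross v y = 0 := by
  simp only [cross]; ring

/-- Two vectors with vanishing wedge product are proportional. -/
theorem exists_smul_of_cross_eq_zero {v d : Pt} (hd : d ≠ 0) (h : cross v d = 0) :
    ∃ r : ℝ, v = r • d := by
  simp only [cross] at h
  by_cases h1 : d.1 = 0
  · have h2 : d.2 ≠ 0 := fun h2 => hd (Prod.ext h1 h2)
    refine ⟨v.2 / d.2, Prod.ext ?_ ?_⟩
    · rw [h1] at h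
      simp only [mul_zero, sub_zero, mul_eq_zero, h2, or_false] at h
      simp [h, h1]
    · simp [h2]
  · refine ⟨v.1 / d.1, Prod.ext ?_ ?_⟩
    · simp [h1]
    · simp only [Prod.smul_snd, smul_eq_mul]
      field_simp
      linarith

theorem ne_zero_of_cross_ne_zero_left {v w : Pt} (h : cross v w ≠ 0) : v ≠ 0 := by
  rintro rfl; simp [cross] at h

/-! ### The balance of a chord -/

/-- For a triangle `a b c` and tangents `v` at `b` and `w` at `c`, the rate at which the area
decreases, up to a positive factor, when the chord `b c` moves away from `a` parallel to itself. -/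
def balance (a b c v w : Pt) : ℝ :=
  cross v w * cross (c - b) (a - b) + cross (c - b) w * cross (c - b) v

theorem balance_congr_apex {a a' b c : Pt} (h : cross (c - b) (a - b) = cross (c - b) (a' - b))
    (v w : Pt) : balance a b c v w = balance a' b c v w := by
  simp only [balance, h]

/-- This identity and its mirror image compare the signs of the balance for two tangents at the same
end. They serve when an end of the chord sits at a vertex, where two edges compete. -/
theorem balance_turn_left (a b c v v' w : Pt) :
    cross (c - b) v * balance a b c v' w = cross (c - b) v' * balance a b c v w
      - cross v v' * (cross (c - b) w * cross (c - b) (a - b)) := by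
  simp only [balance, cross, Prod.fst_sub, Prod.snd_sub]; ring

theorem balance_turn_right (a b c v w w' : Pt) :
    cross (c - b) w * balance a b c v w' = cross (c - b) w' * balance a b c v w
      - cross w w' * (cross v (c - b) * cross (c - b) (a - b)) := by
  simp only [balance, cross, Prod.fst_sub, Prod.snd_sub]; ring

/-- The coefficient `β` of the algorithm. -/
def coeffBeta (a b v c : Pt) : ℝ := cross v (c - a) + cross v (c - b)

/-- The coefficient `γ` of the algorithm. -/
def coeffGamma (a b c w : Pt) : ℝ := cross w (b - a) + cross w (b - c)

/-- The balance is bilinear in the two displacements. Starting from balance zero it stays zero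
exactly on a hyperbola (when `v ∧ w ≠ 0`), the curve followed in the case `Q = 0`. -/
theorem balance_move (a b c v w : Pt) (t r : ℝ) :
    balance a (b + t • v) (c + r • w) v w = balance a b c v w
      + cross v w * (coeffBeta a b v c * t - coeffGamma a b c w * r + 2 * cross v w * t * r) := by
  simp only [balance, coeffBeta, coeffGamma, cross, Prod.fst_sub, Prod.snd_sub, Prod.fst_add,
    Prod.snd_add, Prod.smul_fst, Prod.smul_snd, smul_eq_mul]
  ring

theorem balance_move_left (a b c v w : Pt) (t : ℝ) :
    balance a (b + t • v) c v w = balance a b c v w + cross v w * (coeffBeta a b v c * t) := by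
  simp only [balance, coeffBeta, cross, Prod.fst_sub, Prod.snd_sub, Prod.fst_add,
    Prod.snd_add, Prod.smul_fst, Prod.smul_snd, smul_eq_mul]
  ring

theorem balance_move_right (a b c v w : Pt) (r : ℝ) :
    balance a b (c + r • w) v w = balance a b c v w - cross v w * (coeffGamma a b c w * r) := by
  simp only [balance, coeffGamma, cross, Prod.fst_sub, Prod.snd_sub, Prod.fst_add,
    Prod.snd_add, Prod.smul_fst, Prod.smul_snd, smul_eq_mul]
  ring

/-- The signs of `β` and `γ` are read off from these products: the wedge factors are nonnegative by
support inequalities, and the sign of the balance is known. -/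
theorem coeffBeta_mul (a b c v w : Pt) :
    coeffBeta a b v c * cross (c - b) w
      = cross v (c - b) * cross w (a - c) - balance a b c v w := by
  simp only [balance, coeffBeta, cross, Prod.fst_sub, Prod.snd_sub]; ring

theorem coeffGamma_mul (a b c v w : Pt) :
    coeffGamma a b c w * cross v (c - b)
      = cross (c - b) w * cross v (a - b) - balance a b c v w := by
  simp only [balance, coeffGamma, cross, Prod.fst_sub, Prod.snd_sub]; ring

/-- If the supporting line with direction `v` at `b` is parallel to the chord `b c`, then it has
the same orientation. -/
theorem exists_pos_smul_of_cross_eq_zero {v d s : Pt} (hv : v ≠ 0) (h : cross v d = 0)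
    (hs : 0 ≤ cross v s) (hd : 0 < cross d s) : ∃ r : ℝ, 0 < r ∧ v = r • d := by
  obtain ⟨r, rfl⟩ := exists_smul_of_cross_eq_zero (ne_zero_of_cross_ne_zero_left hd.ne') h
  refine ⟨r, ?_, rfl⟩
  rw [cross_smul_left] at hs
  rcases lt_trichotomy r 0 with hr | hr | hr
  · nlinarith
  · simp [hr] at hv
  · exact hr

/-- A balanced chord `b c` cuts off the largest triangle with apex `a` among all the parallel
chords of a convex set that is bounded by the supporting lines at `b` and `c`, and it is the only
chord that does so. -/
theorem eq_of_balance {a b c vm vp wm wp x y : Pt} {k : ℝ}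
    (hS : 0 < cross (c - b) (a - b)) (hwp : 0 < cross (c - b) wp) (hvm : 0 < cross vm (c - b))
    (hvp0 : vp ≠ 0) (hwm0 : wm ≠ 0)
    (hvp : 0 ≤ cross vp (c - b)) (hwm : 0 ≤ cross (c - b) wm)
    (hm : balance a b c vm wp ≤ 0) (hp : 0 ≤ balance a b c vp wm)
    (hvpa : 0 ≤ cross vp (a - b)) (hwma : 0 ≤ cross wm (a - c))
    (hvmx : 0 ≤ cross vm (x - b)) (hvpx : 0 ≤ cross vp (x - b))
    (hwmy : 0 ≤ cross wm (y - c)) (hwpy : 0 ≤ cross wp (y - c))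
    (hk : 0 < k) (hxy : y - x = k • (c - b))
    (hle : cross (c - b) (a - b) ≤ cross (y - x) (a - x)) : x = b ∧ y = c := by
  have hyx : y = x + k • (c - b) := by rw [← hxy]; abel
  subst hyx
  clear hxy
  obtain ⟨z, rfl⟩ : ∃ z, x = b + z := ⟨x - b, by abel⟩
  obtain ⟨d, rfl⟩ : ∃ d, c = b + d := ⟨c - b, by abel⟩
  have e1 : b + d - b = d := by abel
  have e2 : b + z - b = z := by abel
  have e3 : b + z + k • d - (b + d) = z + (k - 1) • d := by rw [sub_smul, one_smul]; abel
  have e4 : b + z + k • d - (b + z) = k • d := by abel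
  have e5 : a - (b + z) = (a - b) - z := by abel
  have e6 : a - (b + d) = (a - b) - d := by abel
  simp only [balance, e1, e2, e3, e4, e5, e6] at *
  clear e1 e2 e3 e4 e5 e6
  generalize a - b = s at *
  simp only [cross_sub_right, cross_smul_left, cross_smul_right, cross_add_right] at *
  -- With `h = d ∧ z`, the Plücker relation gives `p q (k - 1) ≤ (v ∧ w) h`, and the sign condition
  -- on the balance turns this into `(k - 1) S ≤ h`. The area hypothesis `S ≤ k (S - h)` then forces
  -- `(k - 1) h ≤ 0`, which is impossible for either sign of `h`.
  have key : ∀ v w : Pt, 0 < cross v d → 0 < cross d w → 0 ≤ cross v z →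
      0 ≤ cross w z + (k - 1) * cross w d →
      (cross v w * cross d s + cross d w * cross d v) * cross d z ≤ 0 →
      cross d z ≠ 0 → False := by
    intro v w hv hw hvz hwz hb hne
    have h1 := cross_plucker v w d z
    rw [cross_swap w d] at h1 hwz
    rw [cross_swap d v] at h1 hb
    have hpq := mul_pos hv hw
    have hA : cross v d * cross d w * (k - 1) ≤ cross v w * cross d z := by nlinarith
    have hB : cross v d * cross d w * ((k - 1) * cross d s)
        ≤ cross v d * cross d w * cross d z := by nlinarith
    have hC := le_of_mul_le_mul_left hB hpq
    have hD : (k - 1) * (cross d s - cross d z) ≥ cross d z := by nlinarith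
    rcases lt_or_gt_of_ne hne with h | h
    · have h2 : k - 1 < 0 := by
        by_contra h3
        nlinarith
      nlinarith
    · have h3 : cross d s - cross d z > 0 := by
        by_contra h4
        nlinarith
      have h2 : 0 < k - 1 := by
        by_contra h4
        nlinarith
      nlinarith
  -- The sign tells on which side the parallel chord lies. Beyond the chord (negative) the pair
  -- `vp`, `wm` applies; neither tangent is parallel to the chord there, since it would then support
  -- the polygon. On the side of the apex (positive) the pair `vm`, `wp` applies. On the chord's own
  -- line the supports `vm`, `wp` leave no room for a longer chord.
  rcases lt_trichotomy (cross d z) 0 with h | h | h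
  · exfalso
    have hvp' : 0 < cross vp d := by
      refine lt_of_le_of_ne hvp fun h0 => ?_
      obtain ⟨r, hr, rfl⟩ := exists_pos_smul_of_cross_eq_zero hvp0 h0.symm hvpa hS
      rw [cross_smul_left] at hvpx
      nlinarith
    have hwm' : 0 < cross d wm := by
      refine lt_of_le_of_ne hwm fun h0 => ?_
      have h0' : cross wm d = 0 := by rw [cross_swap, ← h0, neg_zero]
      rw [h0', sub_zero] at hwma
      obtain ⟨r, hr, rfl⟩ := exists_pos_smul_of_cross_eq_zero hwm0 h0' hwma hS
      rw [cross_smul_left, h0'] at hwmy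
      nlinarith
    exact key vp wm hvp' hwm' hvpx hwmy (by nlinarith) h.ne
  · have hd : d ≠ 0 := ne_zero_of_cross_ne_zero_left hS.ne'
    obtain ⟨l, rfl⟩ := exists_smul_of_cross_eq_zero (v := z) hd (by rw [cross_swap, h, neg_zero])
    rw [cross_smul_right] at hvmx hwpy
    rw [cross_swap] at hwpy
    have hl : 0 ≤ l := by
      by_contra hl
      nlinarith
    have hk1 : 1 ≤ k := by
      by_contra hk1
      nlinarith
    have hl' : l + (k - 1) ≤ 0 := by
      by_contra hl'
      nlinarith
    have hl0 : l = 0 := by linarith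
    have hk0 : k = 1 := by linarith
    subst hl0 hk0
    simp
  · exact (key vm wp hvm hwp hvmx hwpy (by nlinarith) h.ne').elim

/-! ### Vertices and edges with cyclic indices, and support inequalities -/

section Polygon

variable {n : ℕ} [NeZero n] {P : Fin n → Pt}

/-- The vertex with index `i`. -/
def vert (P : Fin n → Pt) (i : ℤ) : Pt := P (index n i)

/-- The edge from the vertex with index `i` to the next one. -/
def edge (P : Fin n → Pt) (i : ℤ) : Pt := vert P (i + 1) - vert P i

/-- The point of the edge with index `i` that divides it in the ratio `s : 1 - s`. -/
def edgePt (P : Fin n → Pt) (i : ℤ) (s : ℝ) : Pt := vert P i + s • edge P i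


theorem index_eq_of_emod_eq {i j : ℤ} (h : i % n = j % n) : index n i = index n j := by
  simp only [index, h]

theorem vert_add_mul (P : Fin n → Pt) (i k : ℤ) : vert P (i + k * n) = vert P i := by
  unfold vert
  rw [index_eq_of_emod_eq]
  simp

theorem vert_add_period (P : Fin n → Pt) (i : ℤ) : vert P (i + n) = vert P i := by
  have := vert_add_mul P i 1
  rwa [one_mul] at this

theorem edge_add_mul (P : Fin n → Pt) (i k : ℤ) : edge P (i + k * n) = edge P i := by
  unfold edge
  rw [show i + k * n + 1 = i + 1 + k * n by ring, vert_add_mul, vert_add_mul]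

theorem vert_natCast (P : Fin n → Pt) (i : Fin n) : vert P (i.val : ℤ) = P i := by
  unfold vert
  congr 1
  apply Fin.ext
  simp only [index]
  rw [Int.emod_eq_of_lt (by positivity) (by exact_mod_cast i.isLt)]
  simp

theorem edgePt_zero (P : Fin n → Pt) (i : ℤ) : edgePt P i 0 = vert P i := by simp [edgePt]

theorem edgePt_one (P : Fin n → Pt) (i : ℤ) : edgePt P i 1 = vert P (i + 1) := by
  simp [edgePt, edge]

theorem edgePt_add (P : Fin n → Pt) (i : ℤ) (s t : ℝ) :
    edgePt P i (s + t) = edgePt P i s + t • edge P i := by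
  simp only [edgePt, add_smul]; abel

/-- The residues of `i, j, k` are in increasing order up to a rotation; the cases record which of
`j` and `k` have wrapped around relative to `i`. -/
theorem orient_vert_pos (hP : IsConvexNGon P) {i j k : ℤ} (hij : i < j) (hjk : j < k)
    (hki : k < i + n) : 0 < orient (vert P i) (vert P j) (vert P k) := by
  have hn : (0 : ℤ) < n := by have := hP.1; omega
  have key : ∀ x y z : ℤ, x % n < y % n → y % n < z % n →
      0 < orient (vert P x) (vert P y) (vert P z) := by
    intro x y z hxy hyz
    have h1 := Int.emod_nonneg x hn.ne'
    apply hP.2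
    · simp only [index, Fin.mk_lt_mk]; omega
    · simp only [index, Fin.mk_lt_mk]; omega
  have hi := Int.emod_add_mul_ediv i n
  have hi0 := Int.emod_nonneg i hn.ne'
  have hi1 := Int.emod_lt_of_pos i hn
  have hmod : ∀ x : ℤ, i < x → x < i + n →
      (x % n = i % n + (x - i) ∧ i % n + (x - i) < n) ∨
      (x % n = i % n + (x - i) - n ∧ n ≤ i % n + (x - i)) := by
    intro x hx hx'
    rcases lt_or_ge (i % n + (x - i)) n with h | h
    · left
      refine ⟨?_, h⟩
      have : x % n = (i % n + (x - i)) % n := by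
        rw [Int.emod_add_emod]; congr 1; ring
      rw [this, Int.emod_eq_of_lt (by omega) h]
    · right
      refine ⟨?_, h⟩
      have : x % n = (i % n + (x - i) - n) % n := by
        rw [Int.sub_emod_right, Int.emod_add_emod]; congr 1; ring
      rw [this, Int.emod_eq_of_lt (by omega) (by omega)]
  rcases hmod j hij (by omega) with ⟨hj, hj'⟩ | ⟨hj, hj'⟩ <;>
    rcases hmod k (by omega) hki with ⟨hk, hk'⟩ | ⟨hk, hk'⟩
  · exact key _ _ _ (by omega) (by omega)
  · rw [← orient_rotate, ← orient_rotate]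
    exact key _ _ _ (by omega) (by omega)
  · omega
  · rw [← orient_rotate]
    exact key _ _ _ (by omega) (by omega)

/-- The edge from `i` supports the polygon, and meets it only in its two end points. -/
theorem cross_edge_vert_pos (hP : IsConvexNGon P) {i j : ℤ} (h1 : i + 1 < j) (h2 : j < i + n) :
    0 < cross (edge P i) (vert P j - vert P i) := by
  have := orient_vert_pos hP (by omega : i < i + 1) h1 h2
  rwa [orient_eq_cross] at this

theorem exists_mem_period (hP : IsConvexNGon P) (i j : ℤ) :
    ∃ k : ℤ, i ≤ k ∧ k < i + n ∧ vert P j = vert P k := by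
  have hn : (0 : ℤ) < n := by have := hP.1; omega
  refine ⟨i + (j - i) % n, ?_, ?_, ?_⟩
  · have := Int.emod_nonneg (j - i) hn.ne'; omega
  · have := Int.emod_lt_of_pos (j - i) hn; omega
  · unfold vert
    rw [index_eq_of_emod_eq]
    rw [Int.add_emod_emod]; congr 1; ring

theorem cross_edge_vert_nonneg (hP : IsConvexNGon P) (i j : ℤ) :
    0 ≤ cross (edge P i) (vert P j - vert P i) := by
  obtain ⟨k, h1, h2, h3⟩ := exists_mem_period hP i j
  rw [h3]
  rcases eq_or_lt_of_le h1 with rfl | h1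
  · simp [cross]
  rcases eq_or_lt_of_le (show i + 1 ≤ k by omega) with rfl | h1
  · rw [← edge, cross_self]
  · exact (cross_edge_vert_pos hP h1 h2).le

theorem cross_edge_vert_eq_zero (hP : IsConvexNGon P) {i j : ℤ}
    (h : cross (edge P i) (vert P j - vert P i) = 0) :
    vert P j = vert P i ∨ vert P j = vert P (i + 1) := by
  obtain ⟨k, h1, h2, h3⟩ := exists_mem_period hP i j
  rw [h3] at h ⊢
  rcases eq_or_lt_of_le h1 with rfl | h1
  · exact Or.inl rfl
  rcases eq_or_lt_of_le (show i + 1 ≤ k by omega) with rfl | h1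
  · exact Or.inr rfl
  · exact absurd h (cross_edge_vert_pos hP h1 h2).ne'

theorem cross_edge_edge_pos (hP : IsConvexNGon P) (i : ℤ) :
    0 < cross (edge P i) (edge P (i + 1)) := by
  have h3 := hP.1
  have h := cross_edge_vert_pos hP (i := i) (j := i + 1 + 1) (by omega) (by omega)
  rw [show vert P (i + 1 + 1) - vert P i = edge P (i + 1) + edge P i by simp [edge],
    cross_add_right, cross_self, add_zero] at h
  exact h

theorem cross_edge_pred_pos (hP : IsConvexNGon P) (i : ℤ) :
    0 < cross (edge P (i - 1)) (edge P i) := by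
  have := cross_edge_edge_pos hP (i - 1)
  rwa [sub_add_cancel] at this

theorem edge_ne_zero (hP : IsConvexNGon P) (i : ℤ) : edge P i ≠ 0 :=
  ne_zero_of_cross_ne_zero_left (cross_edge_edge_pos hP i).ne'

/-- The point `x` lies on the inner side of all edges. -/
def Inside (P : Fin n → Pt) (x : Pt) : Prop := ∀ i : ℤ, 0 ≤ cross (edge P i) (x - vert P i)

theorem inside_vert (hP : IsConvexNGon P) (j : ℤ) : Inside P (vert P j) :=
  fun i => cross_edge_vert_nonneg hP i j

theorem edgePt_eq (P : Fin n → Pt) (i : ℤ) (s : ℝ) :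
    edgePt P i s = (1 - s) • vert P i + s • vert P (i + 1) := by
  simp only [edgePt, edge, smul_sub, sub_smul, one_smul]; abel

theorem cross_edge_edgePt (P : Fin n → Pt) (i j : ℤ) (s : ℝ) :
    cross (edge P i) (edgePt P j s - vert P i) =
      (1 - s) * cross (edge P i) (vert P j - vert P i)
        + s * cross (edge P i) (vert P (j + 1) - vert P i) := by
  rw [edgePt_eq]
  simp only [cross, Prod.fst_sub, Prod.snd_sub, Prod.fst_add,
    Prod.snd_add, Prod.smul_fst, Prod.smul_snd, smul_eq_mul]
  ring

theorem inside_edgePt (hP : IsConvexNGon P) (j : ℤ) {s : ℝ} (h0 : 0 ≤ s) (h1 : s ≤ 1) :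
    Inside P (edgePt P j s) := by
  intro i
  rw [cross_edge_edgePt]
  have h2 := cross_edge_vert_nonneg hP i j
  have h3 := cross_edge_vert_nonneg hP i (j + 1)
  have : 0 ≤ 1 - s := by linarith
  positivity

/-- A point of the edge from `i` can replace the vertex `i` in the support inequality. -/
theorem cross_edge_sub (P : Fin n → Pt) (i : ℤ) (s : ℝ) (x : Pt) :
    cross (edge P i) (x - edgePt P i s) = cross (edge P i) (x - vert P i) := by
  simp only [edgePt, cross, Prod.fst_sub, Prod.snd_sub, Prod.fst_add,
    Prod.snd_add, Prod.smul_fst, Prod.smul_snd, smul_eq_mul]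
  ring

theorem cross_edge_sub_pred (P : Fin n → Pt) (i : ℤ) (x : Pt) :
    cross (edge P (i - 1)) (x - vert P i) = cross (edge P (i - 1)) (x - vert P (i - 1)) := by
  have := cross_edge_sub P (i - 1) 1 x
  rwa [edgePt_one, sub_add_cancel] at this

theorem Inside.edgePt_nonneg {x : Pt} (hx : Inside P x) (i : ℤ) (s : ℝ) :
    0 ≤ cross (edge P i) (x - edgePt P i s) := by
  rw [cross_edge_sub]; exact hx i

/-- The tangent before the point of the edge from `i` with parameter `s`. -/
def tangentBefore (P : Fin n → Pt) (i : ℤ) (s : ℝ) : Pt :=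
  if s = 0 then edge P (i - 1) else edge P i

theorem Inside.tangentBefore_nonneg {x : Pt} (hx : Inside P x) (i : ℤ) (s : ℝ) :
    0 ≤ cross (tangentBefore P i s) (x - edgePt P i s) := by
  unfold tangentBefore
  split_ifs with h
  · rw [h, edgePt_zero, cross_edge_sub_pred]; exact hx _
  · exact hx.edgePt_nonneg i s

theorem tangentBefore_ne_zero (hP : IsConvexNGon P) (i : ℤ) (s : ℝ) :
    tangentBefore P i s ≠ 0 := by
  unfold tangentBefore
  split_ifs <;> exact edge_ne_zero hP _

/-- The line of an edge contains no vertices besides the two ends of the edge. This is what rules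
out a side of a maximal triangle in the middle of a movement. -/
theorem edgePt_ne_vert (hP : IsConvexNGon P) (i j : ℤ) {s : ℝ} (h0 : 0 < s) (h1 : s < 1) :
    edgePt P i s ≠ vert P j := by
  intro h
  have h2 : cross (edge P i) (vert P j - vert P i) = 0 := by
    rw [← h, edgePt]; simp [cross_smul_right, cross_self]
  have he := edge_ne_zero hP i
  rcases cross_edge_vert_eq_zero hP h2 with h3 | h3 <;> rw [h3] at h
  · rw [edgePt, add_eq_left, smul_eq_zero] at h
    rcases h with h | h
    · linarith
    · exact he h
  · have h4 : (s - 1) • edge P i = 0 := by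
      rw [sub_smul, one_smul, sub_eq_zero]
      nth_rw 2 [edge]
      rw [← h, edgePt, add_sub_cancel_left]
    rw [smul_eq_zero] at h4
    rcases h4 with h | h
    · linarith
    · exact he h

/-! ### Balanced chords -/

/-- The chord of the polygon from the point with parameter `sb` on the edge `ib` to the point with
parameter `sc` on the edge `ic` lies in front of the vertex `A`, and its triangle with apex `A`
cannot be enlarged by moving the chord parallel to itself. Both parameters are less than `1`. -/
structure BalancedChord (P : Fin n → Pt) (A ib : ℤ) (sb : ℝ) (ic : ℤ) (sc : ℝ) : Prop where
  le_ib : A ≤ ib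
  ib_lt_ic : ib < ic
  ic_lt : ic < A + n
  sb_nonneg : 0 ≤ sb
  sb_lt : sb < 1
  sc_nonneg : 0 ≤ sc
  sc_lt : sc < 1
  area_pos : 0 < cross (edgePt P ic sc - edgePt P ib sb) (vert P A - edgePt P ib sb)
  edge_nonneg : 0 ≤ cross (edge P A) (edgePt P ic sc - edgePt P ib sb)
  inward : balance (vert P A) (edgePt P ib sb) (edgePt P ic sc) (tangentBefore P ib sb)
    (edge P ic) ≤ 0
  outward : 0 ≤ balance (vert P A) (edgePt P ib sb) (edgePt P ic sc) (edge P ib)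
    (tangentBefore P ic sc)

/-- A variant of `BalancedChord` in which the parameters may be `1`. -/
structure ClosedChord (P : Fin n → Pt) (A ib : ℤ) (sb : ℝ) (ic : ℤ) (sc : ℝ) : Prop where
  le_ib : A ≤ ib
  ib_lt_ic : ib < ic
  ic_lt : ic < A + n
  sb_nonneg : 0 ≤ sb
  sb_le : sb ≤ 1
  sc_nonneg : 0 ≤ sc
  sc_le : sc ≤ 1
  area_pos : 0 < cross (edgePt P ic sc - edgePt P ib sb) (vert P A - edgePt P ib sb)
  edge_nonneg : 0 ≤ cross (edge P A) (edgePt P ic sc - edgePt P ib sb)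
  left_pos : 0 < cross (edge P ib) (edgePt P ic sc - edgePt P ib sb)
  right_pos : 0 < cross (edgePt P ic sc - edgePt P ib sb) (edge P ic)
  inward : balance (vert P A) (edgePt P ib sb) (edgePt P ic sc) (tangentBefore P ib sb)
    (edge P ic) ≤ 0
  outward : 0 ≤ balance (vert P A) (edgePt P ib sb) (edgePt P ic sc) (edge P ib)
    (tangentBefore P ic sc)

/-- A position on the boundary whose parameter is `1` is moved to the next edge. -/
def normEdge (i : ℤ) (s : ℝ) : ℤ := if s = 1 then i + 1 else i

/-- The parameter that goes with `normEdge`. -/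
def normParam (s : ℝ) : ℝ := if s = 1 then 0 else s

theorem edgePt_norm (P : Fin n → Pt) (i : ℤ) (s : ℝ) :
    edgePt P (normEdge i s) (normParam s) = edgePt P i s := by
  unfold normEdge normParam
  split_ifs with h
  · rw [h, edgePt_one, edgePt_zero]
  · rfl

theorem tangentBefore_norm (P : Fin n → Pt) (i : ℤ) (s : ℝ) :
    tangentBefore P (normEdge i s) (normParam s) = tangentBefore P i s := by
  unfold normEdge normParam
  split_ifs with h
  · simp [tangentBefore, h]
  · rfl

theorem normParam_nonneg {s : ℝ} (h : 0 ≤ s) : 0 ≤ normParam s := by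
  unfold normParam; split_ifs <;> simp [h]

theorem normParam_lt {s : ℝ} (h : s ≤ 1) : normParam s < 1 := by
  unfold normParam
  split_ifs with h1
  · exact one_pos
  · exact lt_of_le_of_ne h h1

theorem le_normEdge (i : ℤ) (s : ℝ) : i ≤ normEdge i s := by
  unfold normEdge; split_ifs <;> omega

theorem cross_edge_norm_edgePt_nonneg (hP : IsConvexNGon P) (i j : ℤ) (s : ℝ) {t : ℝ}
    (h0 : 0 ≤ t) (h1 : t ≤ 1) :
    0 ≤ cross (edge P (normEdge i s)) (edgePt P j t - edgePt P i s) := by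
  rw [← edgePt_norm P i s]
  exact (inside_edgePt hP j h0 h1).edgePt_nonneg _ _

/-- Passing to the next edge leaves the point and its backward tangent unchanged. Only the forward
tangent turns, to the left by convexity, and the turn identities show that this keeps the sign of
the balance. The strict inequalities on the indices survive because `b` at the vertex `ic` would
contradict `right_pos`, and `c` at the apex would give area zero. -/
theorem ClosedChord.balanced (hP : IsConvexNGon P) {A ib ic : ℤ} {sb sc : ℝ}
    (h : ClosedChord P A ib sb ic sc) :
    BalancedChord P A (normEdge ib sb) (normParam sb) (normEdge ic sc) (normParam sc) where
  le_ib := h.le_ib.trans (le_normEdge _ _)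
  ib_lt_ic := by
    have h1 := h.ib_lt_ic
    have h2 := h.right_pos
    unfold normEdge
    split_ifs with hb hc hc
    · omega
    · rcases eq_or_lt_of_le (show ib + 1 ≤ ic by omega) with h3 | h3
      · exfalso
        rw [hb, edgePt_one, h3, edgePt, add_sub_cancel_left, cross_smul_left, cross_self,
          mul_zero] at h2
        exact lt_irrefl _ h2
      · exact h3
    · omega
    · exact h1
  ic_lt := by
    have h1 := h.ic_lt
    unfold normEdge
    split_ifs with hc
    · rcases eq_or_lt_of_le (show ic + 1 ≤ A + n by omega) with h3 | h3
      · exfalso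
        have h4 := h.area_pos
        rw [hc, edgePt_one, h3, vert_add_period, cross_self] at h4
        exact lt_irrefl _ h4
      · exact h3
    · exact h1
  sb_nonneg := normParam_nonneg h.sb_nonneg
  sb_lt := normParam_lt h.sb_le
  sc_nonneg := normParam_nonneg h.sc_nonneg
  sc_lt := normParam_lt h.sc_le
  area_pos := by simpa only [edgePt_norm] using h.area_pos
  edge_nonneg := by simpa only [edgePt_norm] using h.edge_nonneg
  inward := by
    simp only [edgePt_norm, tangentBefore_norm]
    by_cases hc : sc = 1
    · have h1 := balance_turn_right (vert P A) (edgePt P ib sb) (edgePt P ic sc)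
        (tangentBefore P ib sb) (edge P ic) (edge P (ic + 1))
      have h2 := cross_edge_norm_edgePt_nonneg hP ic ib sc h.sb_nonneg h.sb_le
      have h3 := (inside_edgePt hP ic h.sc_nonneg h.sc_le).tangentBefore_nonneg ib sb
      rw [← cross_sub_swap] at h2
      have h4 := cross_edge_edge_pos hP ic
      have h5 := h.area_pos
      have h6 := h.right_pos
      have h7 := h.inward
      simp only [normEdge, hc, if_true] at h2 ⊢
      rw [hc] at h1 h3 h5 h6 h7
      have h8 := mul_nonneg h4.le (mul_nonneg h3 h5.le)
      by_contra h9
      nlinarith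
    · simpa only [normEdge, hc, if_false] using h.inward
  outward := by
    simp only [edgePt_norm, tangentBefore_norm]
    by_cases hb : sb = 1
    · have h1 := balance_turn_left (vert P A) (edgePt P ib sb) (edgePt P ic sc)
        (edge P ib) (edge P (ib + 1)) (tangentBefore P ic sc)
      have h2 := cross_edge_norm_edgePt_nonneg hP ib ic sb h.sc_nonneg h.sc_le
      have h3 := (inside_edgePt hP ib h.sb_nonneg h.sb_le).tangentBefore_nonneg ic sc
      rw [← cross_sub_swap] at h3
      have h4 := cross_edge_edge_pos hP ib
      have h5 := h.area_pos
      have h6 := h.left_pos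
      have h7 := h.outward
      simp only [normEdge, hb, if_true] at h2 ⊢
      rw [hb] at h1 h3 h5 h6 h7
      have h8 : 0 ≤ cross (edge P ib) (edge P (ib + 1)) *
          (cross (edgePt P ic sc - edgePt P ib 1) (tangentBefore P ic sc) *
          cross (edgePt P ic sc - edgePt P ib 1) (vert P A - edgePt P ib 1)) :=
        mul_nonneg h4.le (mul_nonneg h3 h5.le)
      rw [cross_swap _ (edge P ib), cross_swap _ (edge P (ib + 1))] at h1
      by_contra h9
      nlinarith
    · simpa only [normEdge, hb, if_false] using h.outward

/-- The point `b` is off the line of the edge `ic`. The critical case is `ic + 1 = ib + n`, where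
`ib = A` and `sb = 0` would make `b` the apex. -/
theorem BalancedChord.right_pos (hP : IsConvexNGon P) {A ib ic : ℤ} {sb sc : ℝ}
    (h : BalancedChord P A ib sb ic sc) :
    0 < cross (edgePt P ic sc - edgePt P ib sb) (edge P ic) := by
  have h3 := hP.1
  have e : cross (edgePt P ic sc - edgePt P ib sb) (edge P ic) =
      cross (edge P ic) (edgePt P ib sb - vert P ic) := by
    rw [← cross_edge_sub P ic sc, cross_sub_swap]
  obtain ⟨h1, h2, h4, h5, h6⟩ : _ ∧ _ ∧ _ ∧ _ ∧ _ :=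
    ⟨h.le_ib, h.ib_lt_ic, h.ic_lt, h.sb_nonneg, h.sb_lt⟩
  rw [e, cross_edge_edgePt]
  have hib' := cross_edge_vert_nonneg hP ic (ib + 1)
  rcases eq_or_lt_of_le (show ic + 1 ≤ ib + n by omega) with h7 | h7
  · have h8 : vert P (ib + 1) = vert P (ic + 2) := by
      rw [← vert_add_period P (ib + 1)]; congr 1; omega
    have h9 := cross_edge_vert_pos hP (i := ic) (j := ic + 2) (by omega) (by omega)
    have h10 : vert P ib = vert P (ic + 1) := by
      rw [← vert_add_period P ib]; congr 1; omega
    have h11 : cross (edge P ic) (vert P ib - vert P ic) = 0 := by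
      rw [h10, ← edge, cross_self]
    rw [h8, h11, mul_zero, zero_add]
    refine mul_pos (lt_of_le_of_ne h5 fun h0 => ?_) h9
    have h12 := h.area_pos
    rw [← h0, edgePt_zero, show ib = A by omega, sub_self, cross_zero_right] at h12
    exact lt_irrefl _ h12
  · have h8 := cross_edge_vert_pos hP (i := ic) (j := ib + n) (by omega) (by omega)
    rw [vert_add_period] at h8
    have : 0 < 1 - sb := by linarith
    positivity

/-- If the tangent before `b` were parallel to the chord, the product of the two chord wedges in the
balance would vanish and the rest would be positive, against `inward`. -/
theorem BalancedChord.left_before_pos (hP : IsConvexNGon P) {A ib ic : ℤ} {sb sc : ℝ}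
    (h : BalancedChord P A ib sb ic sc) :
    0 < cross (tangentBefore P ib sb) (edgePt P ic sc - edgePt P ib sb) := by
  have h1 := (inside_edgePt hP ic h.sc_nonneg h.sc_lt.le).tangentBefore_nonneg ib sb
  refine lt_of_le_of_ne h1 fun h0 => ?_
  have h2 := (inside_vert hP A).tangentBefore_nonneg ib sb
  obtain ⟨r, hr, hv⟩ := exists_pos_smul_of_cross_eq_zero (tangentBefore_ne_zero hP ib sb) h0.symm
    h2 h.area_pos
  have h3 := h.inward
  have h4 := h.right_pos hP
  have h5 := h.area_pos
  rw [hv, balance, cross_smul_left, cross_smul_right, cross_self] at h3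
  have := mul_pos (mul_pos hr h4) h5
  linarith

/-- A balanced chord gives the largest area among the parallel chords. -/
theorem BalancedChord.eq_of_le (hP : IsConvexNGon P) {A ib ic : ℤ} {sb sc : ℝ}
    (h : BalancedChord P A ib sb ic sc) {x y : Pt} (hx : Inside P x) (hy : Inside P y) {k : ℝ}
    (hk : 0 < k) (hxy : y - x = k • (edgePt P ic sc - edgePt P ib sb))
    (hle : cross (edgePt P ic sc - edgePt P ib sb) (vert P A - edgePt P ib sb)
      ≤ cross (y - x) (vert P A - x)) : x = edgePt P ib sb ∧ y = edgePt P ic sc := by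
  have hb := inside_edgePt hP ib h.sb_nonneg h.sb_lt.le
  have hc := inside_edgePt hP ic h.sc_nonneg h.sc_lt.le
  have ha := inside_vert hP A
  refine eq_of_balance h.area_pos (h.right_pos hP) (h.left_before_pos hP) (edge_ne_zero hP ib)
    (tangentBefore_ne_zero hP ic sc) (hc.edgePt_nonneg ib sb) ?_ h.inward h.outward
    (ha.edgePt_nonneg ib sb) (ha.tangentBefore_nonneg ic sc) (hx.tangentBefore_nonneg ib sb)
    (hx.edgePt_nonneg ib sb) (hy.tangentBefore_nonneg ic sc) (hy.edgePt_nonneg ic sc) hk hxy hle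
  have := hb.tangentBefore_nonneg ic sc
  rwa [← cross_sub_swap] at this

end Polygon

/-! ### Motions of a balanced chord along a fixed pair of edges -/

theorem balance_eq (a b c v w : Pt) : balance a b c v w =
    cross v w * cross (c - b) (a - b) - cross (c - b) w * cross v (c - b) := by
  rw [balance, cross_swap _ v]; ring

theorem cross_sub_base (a b c : Pt) : cross (c - b) (a - b) = cross (c - b) (a - c) := by
  simp only [cross, Prod.fst_sub, Prod.snd_sub]; ring

section Polygon

variable {n : ℕ} [NeZero n] {P : Fin n → Pt} {A ib ic : ℤ} {sb sc : ℝ}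

theorem BalancedChord.coeffGamma_nonneg (hP : IsConvexNGon P)
    (h : BalancedChord P A ib sb ic sc) :
    0 ≤ coeffGamma (vert P A) (edgePt P ib sb) (edgePt P ic sc) (edge P ic) := by
  have h1 := coeffGamma_mul (vert P A) (edgePt P ib sb) (edgePt P ic sc) (tangentBefore P ib sb)
    (edge P ic)
  have h2 := h.left_before_pos hP
  have h3 := h.right_pos hP
  have h4 := (inside_vert hP A).tangentBefore_nonneg ib sb
  have h5 := h.inward
  have h6 := mul_nonneg h3.le h4
  by_contra h7
  nlinarith

theorem BalancedChord.left_nonneg (hP : IsConvexNGon P) (h : BalancedChord P A ib sb ic sc) :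
    0 ≤ cross (edge P ib) (edgePt P ic sc - edgePt P ib sb) :=
  (inside_edgePt hP ic h.sc_nonneg h.sc_lt.le).edgePt_nonneg ib sb

/-- The edge at `b` may be parallel to the chord, for instance when `c` is the vertex `ib + 1`. In
that case the balance is positive, so the hypothesis `hF` excludes it. -/
theorem BalancedChord.left_pos (hP : IsConvexNGon P) (h : BalancedChord P A ib sb ic sc)
    (hF : balance (vert P A) (edgePt P ib sb) (edgePt P ic sc) (edge P ib) (edge P ic) ≤ 0) :
    0 < cross (edge P ib) (edgePt P ic sc - edgePt P ib sb) := by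
  refine lt_of_le_of_ne (h.left_nonneg hP) fun h0 => ?_
  obtain ⟨r, hr, hv⟩ := exists_pos_smul_of_cross_eq_zero (edge_ne_zero hP ib) h0.symm
    ((inside_vert hP A).edgePt_nonneg ib sb) h.area_pos
  have h4 := h.right_pos hP
  have h5 := h.area_pos
  rw [hv, balance_eq, cross_smul_left, cross_smul_left, cross_self] at hF
  have := mul_pos (mul_pos hr h4) h5
  linarith

theorem BalancedChord.coeffBeta_mul_ge (hP : IsConvexNGon P)
    (h : BalancedChord P A ib sb ic sc) :
    -balance (vert P A) (edgePt P ib sb) (edgePt P ic sc) (edge P ib) (edge P ic) ≤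
    coeffBeta (vert P A) (edgePt P ib sb) (edge P ib) (edgePt P ic sc)
      * cross (edgePt P ic sc - edgePt P ib sb) (edge P ic) := by
  have h1 := coeffBeta_mul (vert P A) (edgePt P ib sb) (edgePt P ic sc) (edge P ib)
    (edge P ic)
  have h2 := mul_nonneg (h.left_nonneg hP) ((inside_vert hP A).edgePt_nonneg ic sc)
  linarith

theorem BalancedChord.coeffBeta_nonneg (hP : IsConvexNGon P)
    (h : BalancedChord P A ib sb ic sc)
    (hF : balance (vert P A) (edgePt P ib sb) (edgePt P ic sc) (edge P ib) (edge P ic) ≤ 0) :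
    0 ≤ coeffBeta (vert P A) (edgePt P ib sb) (edge P ib) (edgePt P ic sc) := by
  have h1 := h.coeffBeta_mul_ge hP
  have h2 := h.right_pos hP
  by_contra h3
  nlinarith

theorem BalancedChord.coeffBeta_pos (hP : IsConvexNGon P)
    (h : BalancedChord P A ib sb ic sc)
    (hF : balance (vert P A) (edgePt P ib sb) (edgePt P ic sc) (edge P ib) (edge P ic) < 0) :
    0 < coeffBeta (vert P A) (edgePt P ib sb) (edge P ib) (edgePt P ic sc) := by
  have h1 := h.coeffBeta_mul_ge hP
  have h2 := h.right_pos hP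
  by_contra h3
  nlinarith

/-- Moving `b` forward raises the balance for the tangent before `c`, because `β > 0`; so `outward`
persists and forces the area to stay positive. After the move `b` is past the start of its edge,
hence `inward` is just `hF'`. -/
theorem BalancedChord.move_left (hP : IsConvexNGon P) (h : BalancedChord P A ib sb ic sc)
    (hF : balance (vert P A) (edgePt P ib sb) (edgePt P ic sc) (edge P ib) (edge P ic) < 0)
    {t : ℝ} (ht : 0 < t) (ht1 : sb + t ≤ 1)
    (hF' : balance (vert P A) (edgePt P ib (sb + t)) (edgePt P ic sc) (edge P ib) (edge P ic) ≤ 0)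
    (he : 0 ≤ cross (edge P A) (edgePt P ic sc - edgePt P ib (sb + t))) :
    ClosedChord P A ib (sb + t) ic sc := by
  have hsb := h.sb_nonneg
  have hb' : Inside P (edgePt P ib (sb + t)) := inside_edgePt hP ib (by linarith) ht1
  have hp := h.left_pos hP hF.le
  have hβ := h.coeffBeta_pos hP hF
  have hS := h.area_pos
  have hS2 := hS
  rw [cross_sub_base] at hS2
  have hp' : cross (edge P ib) (edgePt P ic sc - edgePt P ib (sb + t)) =
      cross (edge P ib) (edgePt P ic sc - edgePt P ib sb) := by
    rw [cross_edge_sub, cross_edge_sub]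
  have hdm' := hb'.tangentBefore_nonneg ic sc
  rw [← cross_sub_swap] at hdm'
  have hdm := (inside_edgePt hP ib h.sb_nonneg h.sb_lt.le).tangentBefore_nonneg ic sc
  -- If the tangent before `c` is parallel to the chord, it is a positive multiple of it; otherwise
  -- `outward` bounds this wedge product times the area below by a positive product.
  have hm : 0 < cross (edge P ib) (tangentBefore P ic sc) := by
    have hout := h.outward
    rw [balance_eq] at hout
    rcases eq_or_lt_of_le hdm with h0 | h0
    · rw [← cross_sub_swap, cross_swap, eq_comm, neg_eq_zero] at h0
      obtain ⟨r, hr, hv⟩ := exists_pos_smul_of_cross_eq_zero (tangentBefore_ne_zero hP ic sc) h0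
        ((inside_vert hP A).tangentBefore_nonneg ic sc) hS2
      rw [hv, cross_smul_right]
      exact mul_pos hr hp
    · rw [← cross_sub_swap] at h0
      have := mul_pos h0 hp
      by_contra h1
      nlinarith
  have hout' : 0 < balance (vert P A) (edgePt P ib (sb + t)) (edgePt P ic sc) (edge P ib)
      (tangentBefore P ic sc) := by
    rw [edgePt_add, balance_move_left]
    have := mul_pos hm (mul_pos hβ ht)
    have := h.outward
    linarith
  have hS' : 0 < cross (edgePt P ic sc - edgePt P ib (sb + t))
      (vert P A - edgePt P ib (sb + t)) := by
    have h1 := hout'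
    rw [balance_eq, hp'] at h1
    have h2 := mul_nonneg hdm' hp.le
    by_contra h3
    nlinarith
  have hr := h.right_pos hP
  refine ⟨h.le_ib, h.ib_lt_ic, h.ic_lt, by linarith, ht1, h.sc_nonneg, h.sc_lt.le, hS', he,
    hp'.symm ▸ hp, ?_, ?_, hout'.le⟩
  · have h1 := hb'.edgePt_nonneg ic sc
    rw [← cross_sub_swap] at h1
    refine lt_of_le_of_ne h1 fun h0 => ?_
    have h2 := hF'
    rw [balance_eq, ← h0] at h2
    have h3 : cross (edge P ib) (edge P ic) > 0 := by
      rw [edgePt_add, ← sub_sub, cross_sub_left, cross_smul_left] at h0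
      by_contra h4
      nlinarith
    have := mul_pos h3 hS'
    linarith
  · rwa [tangentBefore, if_neg (by linarith)]

/-- Here positivity of the balance forces `v ∧ w > 0`, so moving `c` forward increases `v ∧ d` while
`d ∧ w` stays fixed, and `hF'` again forces positive area. -/
theorem BalancedChord.move_right (hP : IsConvexNGon P) (h : BalancedChord P A ib sb ic sc)
    (hF : 0 < balance (vert P A) (edgePt P ib sb) (edgePt P ic sc) (edge P ib) (edge P ic))
    {r : ℝ} (hr : 0 < r) (hr1 : sc + r ≤ 1)
    (hF' : 0 ≤ balance (vert P A) (edgePt P ib sb) (edgePt P ic (sc + r)) (edge P ib) (edge P ic))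
    (he : 0 ≤ cross (edge P A) (edgePt P ic (sc + r) - edgePt P ib sb)) :
    ClosedChord P A ib sb ic (sc + r) := by
  have hsc := h.sc_nonneg
  have hc' : Inside P (edgePt P ic (sc + r)) := inside_edgePt hP ic (by linarith) hr1
  have hp := h.left_nonneg hP
  have hq := h.right_pos hP
  have hγ := h.coeffGamma_nonneg hP
  have hS := h.area_pos
  have hα : 0 < cross (edge P ib) (edge P ic) := by
    rw [balance_eq] at hF
    have := mul_nonneg hq.le hp
    by_contra h1
    nlinarith
  have hq' : cross (edgePt P ic (sc + r) - edgePt P ib sb) (edge P ic) =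
      cross (edgePt P ic sc - edgePt P ib sb) (edge P ic) := by
    rw [edgePt_add]
    simp only [cross_sub_left, cross_add_left, cross_smul_left, cross_self]
    ring
  have hp' : 0 < cross (edge P ib) (edgePt P ic (sc + r) - edgePt P ib sb) := by
    rw [edgePt_add, add_sub_right_comm, cross_add_right, cross_smul_right]
    have := mul_pos hr hα
    linarith
  have hS' : 0 < cross (edgePt P ic (sc + r) - edgePt P ib sb)
      (vert P A - edgePt P ib sb) := by
    have h1 := hF'
    rw [balance_eq, hq'] at h1
    have h2 := mul_pos hq hp'
    by_contra h3
    nlinarith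
  refine ⟨h.le_ib, h.ib_lt_ic, h.ic_lt, h.sb_nonneg, h.sb_lt.le, by linarith, hr1, hS', he,
    hp', hq'.symm ▸ hq, ?_, ?_⟩
  -- If the wedge product is nonpositive, both terms of the balance are nonpositive. If it is
  -- positive, the balance decreases along the move because `γ ≥ 0`.
  · rcases le_or_gt (cross (tangentBefore P ib sb) (edge P ic)) 0 with h1 | h1
    · have h2 := hc'.tangentBefore_nonneg ib sb
      rw [balance_eq, hq']
      have h3 := mul_nonneg hq.le h2
      nlinarith
    · rw [edgePt_add, balance_move_right]
      have := mul_nonneg h1.le (mul_nonneg hγ hr.le)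
      have := h.inward
      linarith
  · rwa [tangentBefore, if_neg (by linarith)]

theorem BalancedChord.cross_edges_pos (hP : IsConvexNGon P) (h : BalancedChord P A ib sb ic sc)
    (hF : balance (vert P A) (edgePt P ib sb) (edgePt P ic sc) (edge P ib) (edge P ic) = 0) :
    0 < cross (edge P ib) (edge P ic) := by
  have hp := h.left_pos hP hF.le
  have hq := h.right_pos hP
  have hS := h.area_pos
  rw [balance_eq] at hF
  have := mul_pos hq hp
  by_contra h1
  nlinarith

/-- On the curve of balance zero, positive `v ∧ d` and `d ∧ w` already give positive area. At a
vertex the backward tangent is the previous edge, and the turn identities give its balance the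
required sign. -/
theorem BalancedChord.move_both (hP : IsConvexNGon P) (h : BalancedChord P A ib sb ic sc)
    (hF : balance (vert P A) (edgePt P ib sb) (edgePt P ic sc) (edge P ib) (edge P ic) = 0)
    {t r : ℝ} (ht : 0 ≤ t) (hr : 0 ≤ r) (ht1 : sb + t ≤ 1) (hr1 : sc + r ≤ 1)
    (hF' : balance (vert P A) (edgePt P ib (sb + t)) (edgePt P ic (sc + r)) (edge P ib)
      (edge P ic) = 0)
    (hq' : 0 < cross (edgePt P ic (sc + r) - edgePt P ib (sb + t)) (edge P ic))
    (he : 0 ≤ cross (edge P A) (edgePt P ic (sc + r) - edgePt P ib (sb + t))) :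
    ClosedChord P A ib (sb + t) ic (sc + r) := by
  have hsb := h.sb_nonneg
  have hsc := h.sc_nonneg
  have hα := h.cross_edges_pos hP hF
  have hp := h.left_pos hP hF.le
  have hp' : 0 < cross (edge P ib) (edgePt P ic (sc + r) - edgePt P ib (sb + t)) := by
    rw [cross_edge_sub, edgePt_add, add_sub_right_comm, cross_add_right, cross_smul_right]
    rw [cross_edge_sub] at hp
    have := mul_nonneg hr hα.le
    linarith
  have hS' : 0 < cross (edgePt P ic (sc + r) - edgePt P ib (sb + t))
      (vert P A - edgePt P ib (sb + t)) := by
    have h1 := hF'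
    rw [balance_eq] at h1
    have h2 := mul_pos hq' hp'
    by_contra h3
    nlinarith
  refine ⟨h.le_ib, h.ib_lt_ic, h.ic_lt, by linarith, ht1, by linarith, hr1, hS', he,
    hp', hq', ?_, ?_⟩
  · rw [tangentBefore]
    split_ifs with h0
    · have h1 := balance_turn_left (vert P A) (edgePt P ib (sb + t)) (edgePt P ic (sc + r))
        (edge P (ib - 1)) (edge P ib) (edge P ic)
      rw [hF', cross_swap _ (edge P ib)] at h1
      have h2 := mul_pos (cross_edge_pred_pos hP ib) (mul_pos hq' hS')
      by_contra h3
      nlinarith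
    · exact hF'.le
  · rw [tangentBefore]
    split_ifs with h0
    · have h1 := balance_turn_right (vert P A) (edgePt P ib (sb + t)) (edgePt P ic (sc + r))
        (edge P ib) (edge P (ic - 1)) (edge P ic)
      rw [hF'] at h1
      have h2 := mul_pos (cross_edge_pred_pos hP ic) (mul_pos hp' hS')
      by_contra h3
      nlinarith
    · exact hF'.ge

end Polygon

/-! ### Values and costs of computations -/

namespace Timed

variable {α β : Type}

open Classical in
/-- The truth value of a proposition. -/
def test (p : Prop) : Bool := decide p

@[simp] theorem test_eq_true_iff {p : Prop} : test p = true ↔ p := by simp [test]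
@[simp] theorem test_true : test True = true := by simp [test]
@[simp] theorem test_false : test False = false := by simp [test]

@[simp] theorem val_pure (x : α) : (pure x : Timed α).val = x := rfl
@[simp] theorem ops_pure (x : α) : (pure x : Timed α).ops = 0 := rfl
@[simp] theorem val_bind (x : Timed α) (f : α → Timed β) : (x >>= f).val = (f x.val).val := rfl
@[simp] theorem ops_bind (x : Timed α) (f : α → Timed β) :
    (x >>= f).ops = x.ops + (f x.val).ops := rfl
@[simp] theorem val_reg (x : α) : (reg x).val = x := rfl
@[simp] theorem ops_reg (x : α) : (reg x).ops = 0 := rfl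
@[simp] theorem val_ofNat {k : ℕ} [OfNat α k] :
    (no_index (OfNat.ofNat k : Timed α)).val = OfNat.ofNat k := rfl
@[simp] theorem ops_ofNat {k : ℕ} [OfNat α k] :
    (no_index (OfNat.ofNat k : Timed α)).ops = 0 := rfl
@[simp] theorem val_add [Add α] (x y : Timed α) : (x + y).val = x.val + y.val := rfl
@[simp] theorem ops_add [Add α] (x y : Timed α) : (x + y).ops = x.ops + y.ops + 1 := rfl
@[simp] theorem val_sub [Sub α] (x y : Timed α) : (x - y).val = x.val - y.val := rfl
@[simp] theorem ops_sub [Sub α] (x y : Timed α) : (x - y).ops = x.ops + y.ops + 1 := rfl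
@[simp] theorem val_mul [Mul α] (x y : Timed α) : (x * y).val = x.val * y.val := rfl
@[simp] theorem ops_mul [Mul α] (x y : Timed α) : (x * y).ops = x.ops + y.ops + 1 := rfl
@[simp] theorem val_div [Div α] (x y : Timed α) : (x / y).val = x.val / y.val := rfl
@[simp] theorem ops_div [Div α] (x y : Timed α) : (x / y).ops = x.ops + y.ops + 1 := rfl
@[simp] theorem val_neg [Neg α] (x : Timed α) : (-x).val = -x.val := rfl
@[simp] theorem ops_neg [Neg α] (x : Timed α) : (-x).ops = x.ops + 1 := rfl
@[simp] theorem val_absolute (x : Timed ℝ) : (absolute x).val = |x.val| := rfl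
@[simp] theorem ops_absolute (x : Timed ℝ) : (absolute x).ops = x.ops + 1 := rfl
@[simp] theorem val_lt [LT α] (x y : Timed α) : (lt x y).val = test (x.val < y.val) := rfl
@[simp] theorem ops_lt [LT α] (x y : Timed α) : (lt x y).ops = x.ops + y.ops + 1 := rfl
@[simp] theorem val_le [LE α] (x y : Timed α) : (le x y).val = test (x.val ≤ y.val) := rfl
@[simp] theorem ops_le [LE α] (x y : Timed α) : (le x y).ops = x.ops + y.ops + 1 := rfl
@[simp] theorem val_eq (x y : Timed α) : (Timed.eq x y).val = test (x.val = y.val) := rfl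
@[simp] theorem ops_eq (x y : Timed α) : (Timed.eq x y).ops = x.ops + y.ops + 1 := rfl
@[simp] theorem val_ite (p : Prop) [Decidable p] (x y : Timed α) :
    (if p then x else y).val = if p then x.val else y.val := apply_ite _ _ _ _
@[simp] theorem ops_ite (p : Prop) [Decidable p] (x y : Timed α) :
    (if p then x else y).ops = if p then x.ops else y.ops := apply_ite _ _ _ _

/-- A quotient that is undefined when the denominator vanishes. -/
def quotient (x y : ℝ) : Option ℝ := if y = 0 then none else some (x / y)

/-- The computation `x` takes at most `1000 * k` operations. -/
def CostLE (x : Timed α) (k : ℕ) : Prop := x.ops ≤ 1000 * k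

/-- A long computation is bounded by counting its binds at 1000 operations each; 40 binds are ample
for either loop body. -/
theorem costLE_bind {x : Timed α} {f : α → Timed β} {k : ℕ} (hx : x.ops ≤ 1000)
    (hf : ∀ y, CostLE (f y) k) : CostLE (x >>= f) (k + 1) := by
  have := hf x.val
  rw [CostLE] at this ⊢
  rw [ops_bind]; omega

theorem costLE_pure (x : α) (k : ℕ) : CostLE (pure x : Timed α) k := Nat.zero_le _

theorem costLE_ite {p : Prop} [Decidable p] {x y : Timed α} {k : ℕ} (hx : CostLE x k)
    (hy : CostLE y k) : CostLE (if p then x else y) k := by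
  split_ifs <;> assumption

@[simp] theorem val_divide (x y : Timed ℝ) : (divide x y).val = quotient x.val y.val := by
  simp [divide, quotient]

theorem ops_divide_le (x y : Timed ℝ) : (divide x y).ops ≤ x.ops + y.ops + 2 := by
  simp only [divide, ops_bind, ops_ite, ops_eq, ops_reg, ops_ofNat, ops_div, ops_pure]
  split_ifs <;> omega

end Timed

@[simp] theorem val_x (p : Pt) : (Pt.x p).val = p.1 := rfl
@[simp] theorem ops_x (p : Pt) : (Pt.x p).ops = 0 := rfl
@[simp] theorem val_y (p : Pt) : (Pt.y p).val = p.2 := rfl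
@[simp] theorem ops_y (p : Pt) : (Pt.y p).ops = 0 := rfl

@[simp] theorem val_vec (p q : Pt) : (vec p q).val = q - p := rfl
@[simp] theorem ops_vec (p q : Pt) : (vec p q).ops = 2 := by simp [vec]

theorem val_between (p q : Pt) (s : ℝ) : (between p q s).val = p + s • (q - p) := by
  apply Prod.ext <;> simp [between] <;> ring
@[simp] theorem ops_between (p q : Pt) (s : ℝ) : (between p q s).ops = 8 := by simp [between]

@[simp] theorem val_wedge (v w : Pt) : (wedge v w).val = cross v w := rfl
@[simp] theorem ops_wedge (v w : Pt) : (wedge v w).ops = 3 := by simp [wedge]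

@[simp] theorem val_dot (w : Pt) : (dot (1, 0) w).val = w.1 := by simp [dot]
@[simp] theorem ops_dot (v w : Pt) : (dot v w).ops = 3 := by simp [dot]

@[simp] theorem val_area (a b c : Pt) : (area a b c).val = |cross (c - b) (a - b)| / 2 := by
  simp only [area, val_bind, val_div, val_absolute, val_wedge, val_vec, val_ofNat]
  congr 2
  simp only [cross, Prod.fst_sub, Prod.snd_sub]; ring
@[simp] theorem ops_area (a b c : Pt) : (area a b c).ops = 9 := by simp [area]

-- These evaluations replace the coordinate formulas by wedge products. The numerator `N` of the
-- algorithm is the balance itself, so its quotients are the zeros of the affine functions in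
-- `balance_move_left` and `balance_move_right`.
@[simp] theorem val_calculateQ (a b v c w : Pt) :
    (calculateQ a b v c w).val = -balance a b c v w := by
  simp [calculateQ, balance, cross]; ring
theorem ops_calculateQ (a b v c w : Pt) : (calculateQ a b v c w).ops ≤ 100 := by
  simp [calculateQ]

@[simp] theorem val_calculateTb4 (a b v c w : Pt) : (calculateTb4 a b v c w).val =
    quotient (balance a b c v w) (-(cross v w * coeffBeta a b v c)) := by
  simp only [calculateTb4, val_divide]
  congr 1 <;> simp [balance, coeffBeta, cross] <;> ring
theorem ops_calculateTb4 (a b v c w : Pt) : (calculateTb4 a b v c w).ops ≤ 100 :=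
  (ops_divide_le _ _).trans (by simp)

@[simp] theorem val_calculateTc4 (a b v c w : Pt) : (calculateTc4 a b v c w).val =
    quotient (-balance a b c v w) (-(cross v w * coeffGamma a b c w)) := by
  simp only [calculateTc4, val_divide]
  congr 1 <;> simp [balance, coeffGamma, cross] <;> ring
theorem ops_calculateTc4 (a b v c w : Pt) : (calculateTc4 a b v c w).ops ≤ 100 :=
  (ops_divide_le _ _).trans (by simp)

@[simp] theorem val_calculateAlpha (v w : Pt) : (calculateAlpha v w).val = 2 * cross v w := by
  simp [calculateAlpha, cross]; ring
theorem ops_calculateAlpha (v w : Pt) : (calculateAlpha v w).ops ≤ 100 := by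
  simp [calculateAlpha]

@[simp] theorem val_calculateBeta (a b v c : Pt) :
    (calculateBeta a b v c).val = coeffBeta a b v c := by
  simp [calculateBeta, coeffBeta, cross]; ring
theorem ops_calculateBeta (a b v c : Pt) : (calculateBeta a b v c).ops ≤ 100 := by
  simp [calculateBeta]

@[simp] theorem val_calculateGamma (a b c w : Pt) :
    (calculateGamma a b c w).val = coeffGamma a b c w := by
  simp [calculateGamma, coeffGamma, cross]; ring
theorem ops_calculateGamma (a b c w : Pt) : (calculateGamma a b c w).ops ≤ 100 := by
  simp [calculateGamma]

@[simp] theorem val_calculateTb3 (a e b v c w : Pt) : (calculateTb3 a e b v c w).val =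
    quotient (-(cross e (a - b) * cross v w + cross (c - b) w * cross e v))
      (-(2 * cross v w * cross e v)) := by
  simp only [calculateTb3, val_divide]
  congr 1 <;> simp [cross] <;> ring
theorem ops_calculateTb3 (a e b v c w : Pt) : (calculateTb3 a e b v c w).ops ≤ 100 :=
  (ops_divide_le _ _).trans (by simp)

@[simp] theorem val_calculateTc3 (a e b v c w : Pt) : (calculateTc3 a e b v c w).val =
    quotient (-(cross e (a - c) * cross v w - cross v (c - b) * cross e w))
      (-(2 * cross v w * cross e w)) := by
  simp only [calculateTc3, val_divide]
  congr 1 <;> simp [cross] <;> ring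
theorem ops_calculateTc3 (a e b v c w : Pt) : (calculateTc3 a e b v c w).ops ≤ 100 :=
  (ops_divide_le _ _).trans (by simp)

@[simp] theorem val_calculateTq (a b v c w : Pt) : (calculateTq a b v c w (1, 0)).val =
    ((b.2 - c.2) * v.1 * w.1 + (c.1 - a.1) * v.2 * w.1 + (a.1 - b.1) * v.1 * w.2)
      / (2 * cross v w) := by
  simp [calculateTq, cross]
theorem ops_calculateTq (a b v c w u : Pt) : (calculateTq a b v c w u).ops ≤ 100 := by
  simp [calculateTq]

/-! ### Selection of the next event -/

theorem ops_updatePositive (m t : Option ℝ) : (updatePositive m t).ops ≤ 2 := by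
  unfold updatePositive
  rcases t with _ | t
  · simp
  · rcases m with _ | m
    · simp
    · simp
      split_ifs <;> simp

theorem ops_smallestPositive (t₁ t₂ t₃ : Option ℝ) : (smallestPositive t₁ t₂ t₃).ops ≤ 6 := by
  have h1 := ops_updatePositive none t₁
  have h2 := ops_updatePositive (updatePositive none t₁).val t₂
  have h3 := ops_updatePositive (updatePositive (updatePositive none t₁).val t₂).val t₃
  simp only [smallestPositive, ops_bind]
  omega

theorem ops_updatePair (m : Option (ℝ × ℝ)) (t t' : Option ℝ) : (updatePair m t t').ops ≤ 3 := by
  unfold updatePair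
  rcases t with _ | t <;> rcases t' with _ | t' <;> try simp
  rcases m with _ | m <;> simp only [ops_bind, ops_reg, ops_pure, ops_lt, val_lt] <;> split_ifs <;> simp

theorem updatePositive_some {m : ℝ} (t : Option ℝ) :
    ∃ m', (updatePositive (some m) t).val = some m' ∧ m' ≤ m ∧ (∀ x ∈ t, 0 < x → m' ≤ x) ∧
      (m' = m ∨ (t = some m' ∧ 0 < m')) := by
  rcases t with _ | t
  · exact ⟨m, rfl, le_rfl, by simp, Or.inl rfl⟩
  · by_cases h : 0 < t
    · by_cases h' : t < m
      · exact ⟨t, by simp [updatePositive, h, h'], h'.le, by simp, Or.inr ⟨rfl, h⟩⟩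
      · exact ⟨m, by simp [updatePositive, h, h'], le_rfl, by simpa using fun _ => not_lt.1 h',
          Or.inl rfl⟩
    · exact ⟨m, by simp [updatePositive, h], le_rfl, by simpa using fun h1 => absurd h1 h,
        Or.inl rfl⟩

theorem smallestPositive_spec {t₁ : ℝ} (h : 0 < t₁) (t₂ t₃ : Option ℝ) :
    ∃ t, (smallestPositive (some t₁) t₂ t₃).val = some t ∧ 0 < t ∧ t ≤ t₁ ∧
      (∀ x ∈ t₂, 0 < x → t ≤ x) ∧ (∀ x ∈ t₃, 0 < x → t ≤ x) ∧
      (t = t₁ ∨ t₂ = some t ∨ t₃ = some t) := by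
  have h1 : (updatePositive none (some t₁)).val = some t₁ := by simp [updatePositive, h]
  obtain ⟨m, hm, hm1, hm2, hm3⟩ := updatePositive_some (m := t₁) t₂
  obtain ⟨m', hm', hm1', hm2', hm3'⟩ := updatePositive_some (m := m) t₃
  have hm0 : 0 < m := by
    rcases hm3 with rfl | ⟨-, h0⟩
    · exact h
    · exact h0
  refine ⟨m', by simp only [smallestPositive, val_bind, h1, hm, hm'], ?_, hm1'.trans hm1,
    fun x hx hx0 => hm1'.trans (hm2 x hx hx0), hm2', ?_⟩
  · rcases hm3' with rfl | ⟨-, h0⟩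
    · exact hm0
    · exact h0
  · rcases hm3' with rfl | ⟨h0, -⟩
    · rcases hm3 with rfl | ⟨h0, -⟩
      · exact Or.inl rfl
      · exact Or.inr (Or.inl h0)
    · exact Or.inr (Or.inr h0)

/-- A candidate pair with defined and nonnegative entries. -/
def ValidPair (t t' : Option ℝ) (p : ℝ × ℝ) : Prop :=
  t = some p.1 ∧ t' = some p.2 ∧ 0 ≤ p.1 ∧ 0 ≤ p.2

/-- `m` is a pair with the smallest first entry among those that satisfy `V`. -/
def IsFirst (V : ℝ × ℝ → Prop) (m : Option (ℝ × ℝ)) : Prop :=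
  (∀ p, V p → ∃ q, m = some q ∧ q.1 ≤ p.1) ∧ ∀ q, m = some q → V q

/-- Only minimality of the first entry is tracked; the choice among tied pairs plays no role in the
correctness proof. -/
theorem isFirst_updatePair {V : ℝ × ℝ → Prop} {m : Option (ℝ × ℝ)} (h : IsFirst V m)
    (t t' : Option ℝ) :
    IsFirst (fun p => V p ∨ ValidPair t t' p) (updatePair m t t').val := by
  by_cases hv : ∃ p, ValidPair t t' p
  · obtain ⟨p, hp⟩ := hv
    obtain ⟨rfl, rfl, h1, h2⟩ := id hp
    have hV : ∀ q, ValidPair (some p.1) (some p.2) q → q = p := fun q hq =>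
      Prod.ext (Option.some.inj hq.1).symm (Option.some.inj hq.2.1).symm
    rcases m with _ | m
    · refine ⟨fun q hq => ⟨p, by simp [updatePair, h1, h2], ?_⟩, fun q hq => Or.inr ?_⟩
      · rcases hq with hq | hq
        · obtain ⟨_, hq, _⟩ := h.1 q hq
          simp at hq
        · rw [hV q hq]
      · simp only [updatePair, val_bind, val_le, val_ofNat, val_reg, h1, h2, test_true,
          Bool.and_self, if_true, val_pure, Option.some.injEq] at hq
        rw [← hq]; exact hp
    · by_cases hm : p.1 < m.1
      · refine ⟨fun q hq => ⟨p, by simp [updatePair, h1, h2, hm], ?_⟩, fun q hq => Or.inr ?_⟩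
        · rcases hq with hq | hq
          · obtain ⟨m', hm', hq⟩ := h.1 q hq
            rw [← Option.some.inj hm'] at hq
            exact hm.le.trans hq
          · rw [hV q hq]
        · simp [updatePair, h1, h2, hm] at hq
          rw [← hq]; exact hp
      · refine ⟨fun q hq => ⟨m, by simp [updatePair, h1, h2, hm], ?_⟩,
          fun q hq => Or.inl (h.2 q ?_)⟩
        · rcases hq with hq | hq
          · obtain ⟨m', hm', hq⟩ := h.1 q hq
            rwa [← Option.some.inj hm'] at hq
          · rw [hV q hq]; exact not_lt.1 hm
        · simpa [updatePair, h1, h2, hm] using hq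
  · have h0 : (updatePair m t t').val = m := by
      rcases t with _ | t
      · rfl
      rcases t' with _ | t'
      · rfl
      have : ¬ (0 ≤ t ∧ 0 ≤ t') := fun h => hv ⟨(t, t'), rfl, rfl, h.1, h.2⟩
      simp [updatePair, this]
    rw [h0]
    refine ⟨fun p hp => h.1 p (hp.resolve_right fun hp => hv ⟨p, hp⟩), fun q hq => Or.inl (h.2 q hq)⟩

theorem isFirst_none : IsFirst (fun _ => False) none := ⟨by simp, by simp⟩

/-! ### Costs -/

theorem ops_advance (a ea b eb c ec : Pt) (s : Chord) : (advance a ea b eb c ec s).ops ≤ 1000 := by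
  have h0 := ops_calculateQ a b eb c ec
  have h1 := ops_calculateTb4 a b eb c ec
  have h2 := ops_calculateTc4 a b eb c ec
  have h3 := ops_calculateTb3 a ea b eb c ec
  have h4 := ops_calculateTc3 a ea b eb c ec
  have h5 := ops_calculateAlpha eb ec
  have h6 := ops_calculateBeta a b eb c
  have h7 := ops_calculateGamma a b c ec
  unfold advance
  simp only [ops_bind, ops_vec, ops_ite, ops_lt, ops_reg, ops_ofNat]
  split_ifs
  · have h8 := ops_divide_le (wedge ea (vec b c).val) (wedge ea eb)
    have h9 := ops_smallestPositive (some (1 - reg s.sb : Timed ℝ).val)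
      (divide (wedge ea (vec b c).val) (wedge ea eb)).val (calculateTb4 a b eb c ec).val
    simp only [ops_sub, ops_reg, ops_ofNat, ops_wedge] at h8 ⊢
    split <;> simp only [ops_bind, ops_add, ops_reg, ops_pure] <;> omega
  · have h8 := ops_divide_le (wedge ea (vec c b).val) (wedge ea ec)
    have h9 := ops_smallestPositive (some (1 - reg s.sc : Timed ℝ).val)
      (divide (wedge ea (vec c b).val) (wedge ea ec)).val (calculateTc4 a b eb c ec).val
    simp only [ops_sub, ops_reg, ops_ofNat, ops_wedge] at h8 ⊢
    split <;> simp only [ops_bind, ops_add, ops_reg, ops_pure] <;> omega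
  · have h10 := fun x y => ops_divide_le x y
    have h11 := fun x y z => ops_updatePair x y z
    -- The cost of the third branch is bounded bind by bind; `10` covers the final match with its
    -- two additions.
    refine (Nat.add_le_add_left (Nat.add_le_add_left (Nat.add_le_add_left (Nat.add_le_add_left
      (Nat.add_le_add_left (Nat.add_le_add h5 (Nat.add_le_add h6 (Nat.add_le_add h7
      (Nat.add_le_add_left (Nat.add_le_add (h10 _ _) (Nat.add_le_add_left (Nat.add_le_add (h10 _ _)
      (Nat.add_le_add h3 (Nat.add_le_add h4 (Nat.add_le_add (h11 _ _ _) (Nat.add_le_add (h11 _ _ _)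
      (Nat.add_le_add (h11 _ _ _) (?_ : _ ≤ 10))))))) _)) _)))) _) _) _) _) _).trans ?_
    · split <;> simp
    · simp
      omega

section Polygon

variable {n : ℕ} [NeZero n]

@[simp] theorem val_vertex (P : Fin n → Pt) (i : ℤ) : (vertex P i).val = vert P i := rfl
@[simp] theorem ops_vertex (P : Fin n → Pt) (i : ℤ) : (vertex P i).ops = 2 := rfl

theorem ops_anchoredStep (P : Fin n → Pt) (u : Pt) (ia : ℤ) (s : Chord) :
    (anchoredStep P u ia s).ops ≤ 1000 * 40 := by
  have h1 := fun a b v c w => ops_calculateTq a b v c w u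
  rw [← CostLE]
  unfold anchoredStep
  repeat' first
    | with_reducible exact costLE_pure _ _
    | with_reducible refine costLE_bind ?_ fun _ => ?_
    | with_reducible refine costLE_ite ?_ ?_
    | with_reducible exact (h1 _ _ _ _ _).trans (by norm_num)
    | (simp only [ops_bind, ops_ite, ops_eq, ops_reg, ops_ofNat, ops_pure, ops_sub, ops_add,
        ops_vertex, ops_between, ops_vec, ops_dot, ops_le, ops_lt, ops_wedge, ops_neg, ops_div,
        ops_mul]
       first | omega | (split_ifs <;> omega))

theorem ops_mainStep (P : Fin n → Pt) (ia₀ : ℤ) (s : State n) :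
    (mainStep P ia₀ s).ops ≤ 1000 * 40 := by
  rw [← CostLE]
  unfold mainStep
  repeat' first
    | with_reducible exact costLE_pure _ _
    | with_reducible refine costLE_bind ?_ fun _ => ?_
    | with_reducible refine costLE_ite ?_ ?_
    | with_reducible exact ops_advance _ _ _ _ _ _ _
    | (simp only [ops_bind, ops_ite, ops_eq, ops_reg, ops_ofNat, ops_pure, ops_add,
        ops_vertex, ops_between, ops_vec, ops_area, ops_le, ops_lt, ops_wedge]
       first | omega | (split_ifs <;> omega))

end Polygon

/-! ### The first event -/

theorem quotient_eq_some {x y z : ℝ} : quotient x y = some z ↔ y ≠ 0 ∧ z * y = x := by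
  unfold quotient
  split_ifs with h
  · simp [h]
  · simp only [Option.some.injEq, ne_eq, h, not_false_iff, true_and]
    rw [div_eq_iff h, eq_comm]

/-- The affine function `x - t y` starts positive, and `x / y` is its only zero. Up to the first
positive candidate it therefore keeps its sign; a zero that is undefined or nonpositive is no
obstacle. -/
theorem mul_le_of_le_quotient {x y t : ℝ} (hx : 0 < x) (ht : 0 < t)
    (h : ∀ z ∈ quotient x y, 0 < z → t ≤ z) : t * y ≤ x := by
  rcases le_or_gt y 0 with hy | hy
  · nlinarith
  · have h1 := h (x / y) (by simp [quotient, hy.ne']) (by positivity)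
    rwa [le_div_iff₀ hy] at h1

theorem le_mul_of_le_quotient {x y t : ℝ} (hx : x < 0) (ht : 0 < t)
    (h : ∀ z ∈ quotient x y, 0 < z → t ≤ z) : x ≤ t * y := by
  have := mul_le_of_le_quotient (x := -x) (y := -y) (neg_pos.2 hx) ht (fun z hz => h z (by
    rw [Option.mem_def, quotient_eq_some] at hz ⊢
    exact ⟨by simpa using hz.1, by linarith [hz.2]⟩))
  linarith

/-- The three candidates are where `b` reaches the end of its edge, the chord becomes parallel to
`e`, and the balance vanishes. All three quantities are affine in the displacement. The first
candidate is always positive, so something is selected. -/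
theorem advance_of_balance_neg {a e b v c w : Pt} {s : Chord} (hF : balance a b c v w < 0)
    (hsb : s.sb < 1) (he : 0 < cross e (c - b)) :
    ∃ t, (advance a e b v c w s).val = ⟨s.ib, s.sb + t, s.ic, s.sc⟩ ∧ 0 < t ∧ s.sb + t ≤ 1 ∧
      0 ≤ cross e (c - (b + t • v)) ∧ balance a (b + t • v) c v w ≤ 0 ∧
      (s.sb + t = 1 ∨ cross e (c - (b + t • v)) = 0 ∨ balance a (b + t • v) c v w = 0) := by
  obtain ⟨t, ht, h0, h1, h2, h3, h4⟩ := smallestPositive_spec (sub_pos.2 hsb)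
    (quotient (cross e (c - b)) (cross e v))
    (quotient (balance a b c v w) (-(cross v w * coeffBeta a b v c)))
  have h2' := mul_le_of_le_quotient he h0 h2
  have h3' := le_mul_of_le_quotient hF h0 h3
  have e1 : cross e (c - (b + t • v)) = cross e (c - b) - t * cross e v := by
    rw [← sub_sub, cross_sub_right, cross_smul_right]
  refine ⟨t, ?_, h0, by linarith, by linarith, ?_, ?_⟩
  · simp [advance, hF, ht]
  · rw [balance_move_left]; linarith
  · rw [balance_move_left, e1]
    rcases h4 with h4 | h4 | h4
    · left; linarith
    · right; left; linarith [(quotient_eq_some.1 h4).2]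
    · right; right; linarith [(quotient_eq_some.1 h4).2]

theorem advance_of_balance_pos {a e b v c w : Pt} {s : Chord} (hF : 0 < balance a b c v w)
    (hsc : s.sc < 1) (he : 0 < cross e (c - b)) :
    ∃ r, (advance a e b v c w s).val = ⟨s.ib, s.sb, s.ic, s.sc + r⟩ ∧ 0 < r ∧ s.sc + r ≤ 1 ∧
      0 ≤ cross e (c + r • w - b) ∧ 0 ≤ balance a b (c + r • w) v w ∧
      (s.sc + r = 1 ∨ cross e (c + r • w - b) = 0 ∨ balance a b (c + r • w) v w = 0) := by
  obtain ⟨r, hr, h0, h1, h2, h3, h4⟩ := smallestPositive_spec (sub_pos.2 hsc)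
    (quotient (cross e (b - c)) (cross e w))
    (quotient (-balance a b c v w) (-(cross v w * coeffGamma a b c w)))
  have e0 : cross e (b - c) = -cross e (c - b) := by
    rw [← cross_sub_swap, cross_swap]
  have h2' := le_mul_of_le_quotient (by linarith) h0 h2
  have h3' := le_mul_of_le_quotient (by linarith) h0 h3
  have e1 : cross e (c + r • w - b) = cross e (c - b) + r * cross e w := by
    rw [add_sub_right_comm, cross_add_right, cross_smul_right]
  refine ⟨r, ?_, h0, by linarith, by linarith, ?_, ?_⟩
  · simp [advance, hF, hF.not_gt, hr]
  · rw [balance_move_right]; linarith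
  · rw [balance_move_right, e1]
    rcases h4 with h4 | h4 | h4
    · left; linarith
    · right; left; linarith [(quotient_eq_some.1 h4).2]
    · right; right; linarith [(quotient_eq_some.1 h4).2]

/-- The candidates for the joint movement of both end points of a chord. -/
def Candidate (a e b v c w : Pt) (x y : ℝ) (p : ℝ × ℝ) : Prop :=
  (ValidPair (some x)
      (quotient (coeffBeta a b v c * x) (coeffGamma a b c w - 2 * cross v w * x)) p ∨
    ValidPair (quotient (coeffGamma a b c w * y) (coeffBeta a b v c + 2 * cross v w * y))
      (some y) p) ∨
  ValidPair (quotient (-(cross e (a - b) * cross v w + cross (c - b) w * cross e v))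
      (-(2 * cross v w * cross e v)))
    (quotient (-(cross e (a - c) * cross v w - cross v (c - b) * cross e w))
      (-(2 * cross v w * cross e w))) p

theorem advance_of_balance_eq_zero {a e b v c w : Pt} {s : Chord}
    (hF : balance a b c v w = 0) {z : ℝ × ℝ}
    (hz : Candidate a e b v c w (1 - s.sb) (1 - s.sc) z) :
    ∃ p : ℝ × ℝ, (advance a e b v c w s).val = ⟨s.ib, s.sb + p.1, s.ic, s.sc + p.2⟩ ∧
      Candidate a e b v c w (1 - s.sb) (1 - s.sc) p ∧
      ∀ q, Candidate a e b v c w (1 - s.sb) (1 - s.sc) q → p.1 ≤ q.1 := by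
  have h := isFirst_updatePair (isFirst_updatePair (isFirst_updatePair isFirst_none
    (some (1 - s.sb)) (quotient (coeffBeta a b v c * (1 - s.sb))
      (coeffGamma a b c w - 2 * cross v w * (1 - s.sb))))
    (quotient (coeffGamma a b c w * (1 - s.sc)) (coeffBeta a b v c + 2 * cross v w * (1 - s.sc)))
      (some (1 - s.sc)))
    (quotient (-(cross e (a - b) * cross v w + cross (c - b) w * cross e v))
      (-(2 * cross v w * cross e v)))
    (quotient (-(cross e (a - c) * cross v w - cross v (c - b) * cross e w))
      (-(2 * cross v w * cross e w)))
  simp only [false_or] at h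
  obtain ⟨p, hp, -⟩ := h.1 z hz
  refine ⟨p, ?_, h.2 p hp, fun q hq => ?_⟩
  · simp [advance, hF, hp, -neg_add_rev, -neg_sub]
  · obtain ⟨p', hp', hpq⟩ := h.1 q hq
    rw [hp] at hp'
    rwa [Option.some.inj hp']

/-- A joint movement `(t, r)` on the curve along which the balance vanishes. Here `p`, `q` and `A`
are wedge products of the chord and the tangents, and `l + m = 1`. -/
theorem first_event_of_pos {p q A l m ev ew x y : ℝ} (hp : 0 < p) (hq : 0 < q) (hA : 0 < A)
    (hm : 0 < m) (hl : 0 ≤ l) (hx : 0 < x) (hy : 0 < y) (hK : 0 < ew * p + ev * q)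
    (h0 : l = 0 → ev = 0) {V : ℝ × ℝ → Prop}
    (hV : ∀ z, V z ↔ 0 ≤ z.1 ∧ 0 ≤ z.2 ∧
      ((z.1 = x ∧ q * l - A * x ≠ 0 ∧ z.2 * (q * l - A * x) = p * m * x) ∨
       (z.2 = y ∧ p * m + A * y ≠ 0 ∧ z.1 * (p * m + A * y) = q * l * y) ∨
       (ev ≠ 0 ∧ z.1 * (A * ev) = l * (ew * p + ev * q) ∧
        ew ≠ 0 ∧ z.2 * (A * ew) = -(m * (ew * p + ev * q)))))
    {z : ℝ × ℝ} (hz : V z) (hmin : ∀ z', V z' → z.1 ≤ z'.1) :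
    0 ≤ z.1 ∧ 0 < z.2 ∧ z.1 ≤ x ∧ z.2 ≤ y ∧ z.1 * (p * m + A * z.2) = q * l * z.2 ∧
      0 ≤ m * (ew * p + ev * q) + A * z.2 * ew ∧
      (z.1 = x ∨ z.2 = y ∨ m * (ew * p + ev * q) + A * z.2 * ew = 0) := by
  obtain ⟨t, r⟩ := z
  obtain ⟨ht, hr, hcase⟩ := (hV _).1 hz
  set K := ew * p + ev * q with hKdef
  simp only at ht hr hcase hmin ⊢
  have hpm := mul_pos hp hm
  -- The third candidate also lies on the curve of balance zero; it is the point where the chord is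
  -- parallel to `e`.
  have hcurve₃ : ∀ t' r' : ℝ, ev ≠ 0 → t' * (A * ev) = l * K → ew ≠ 0 →
      r' * (A * ew) = -(m * K) → t' * (p * m + A * r') = q * l * r' := by
    intro t' r' h1 h2 h3 h4
    have h5 : (A * ev * ew) * (t' * (p * m + A * r') - q * l * r') = 0 := by
      have : (A * ev * ew) * (t' * (p * m + A * r') - q * l * r') =
        (t' * (A * ev)) * (ew * p * m) + (t' * (A * ev)) * (r' * (A * ew))
          - q * l * ev * (r' * (A * ew)) := by ring
      rw [this, h2, h4, hKdef]; ring
    have h6 : A * ev * ew ≠ 0 := by positivity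
    linarith [(mul_eq_zero.1 h5).resolve_left h6]
  have hcurve : t * (p * m + A * r) = q * l * r := by
    rcases hcase with ⟨rfl, -, h⟩ | ⟨rfl, -, h⟩ | ⟨h1, h2, h3, h4⟩
    · linarith
    · exact h
    · exact hcurve₃ t r h1 h2 h3 h4
  have hr0 : 0 < r := by
    rcases hcase with ⟨rfl, -, h⟩ | ⟨rfl, -, h⟩ | ⟨h1, h2, h3, h4⟩
    · refine lt_of_le_of_ne hr fun h' => ?_
      rw [← h', zero_mul] at h
      nlinarith
    · exact hy
    · refine lt_of_le_of_ne hr fun h' => ?_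
      rw [← h', zero_mul] at h4
      nlinarith
  -- along the curve, `t` increases strictly with `r`
  have hmono : 0 < l → ∀ t' r', 0 < r' → t' * (p * m + A * r') = q * l * r' → t ≤ t' → r ≤ r' := by
    intro hl' t' r' hr' h' htt
    by_contra hlt
    push Not at hlt
    have h1 : q * l * r * (p * m + A * r') ≤ q * l * r' * (p * m + A * r) := by
      rw [← h', ← hcurve]
      have : 0 ≤ (p * m + A * r) * (p * m + A * r') := by positivity
      nlinarith
    have h2 : q * l * (p * m) * (r - r') ≤ 0 := by nlinarith
    have h3 : 0 < q * l * (p * m) * (r - r') := by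
      have : 0 < r - r' := by linarith
      positivity
    linarith
  have hy2 : p * m + A * y > 0 := by positivity
  have hV2 : V (q * l * y / (p * m + A * y), y) := (hV _).2 ⟨by positivity, hy.le,
    Or.inr (Or.inl ⟨rfl, hy2.ne', by simp only; field_simp⟩)⟩
  -- For `l = 0` the curve is `t = 0` and first entries no longer compare the candidates. But the
  -- first pair then has a negative second entry and the third is undefined, so only the second pair
  -- remains.
  have hzero : l = 0 → r = y := by
    intro hl0
    rcases hcase with ⟨rfl, -, h⟩ | ⟨rfl, -, h⟩ | ⟨h1, h2, h3, h4⟩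
    · exfalso
      rw [hl0] at h
      have := mul_pos hpm hx
      have := mul_nonneg hr (mul_nonneg hA.le hx.le)
      nlinarith
    · rfl
    · exact absurd (h0 hl0) h1
  refine ⟨ht, hr0, ?_, ?_, hcurve, ?_, ?_⟩
  -- Were `t > x`, the pair with first entry `x` would be valid and smaller.
  · by_contra hlt
    push Not at hlt
    have h1 : r * (q * l - A * t) = t * (p * m) := by linarith
    have h2 : 0 < q * l - A * t := by
      have : 0 < t * (p * m) := by have := hx.trans hlt; positivity
      rw [← h1] at this
      exact (pos_iff_pos_of_mul_pos this).1 hr0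
    have h3 : 0 < q * l - A * x := by nlinarith
    have := hmin (x, p * m * x / (q * l - A * x)) ((hV _).2 ⟨hx.le, by positivity,
      Or.inl ⟨rfl, h3.ne', div_mul_cancel₀ _ h3.ne'⟩⟩)
    exact absurd this (not_le.2 hlt)
  · rcases eq_or_lt_of_le hl with hl0 | hl0
    · exact (hzero hl0.symm).le
    · exact hmono hl0 _ y hy (by field_simp) (hmin _ hV2)
  -- The sign can change only if `ew < 0`. Then `ev > 0`, the third candidate is valid, and
  -- monotonicity along the curve puts `r` before it.
  · rcases le_or_gt 0 ew with hew | hew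
    · positivity
    · have hev : 0 < ev := by
        by_contra h
        nlinarith
      have hl0 : 0 < l := lt_of_le_of_ne hl fun h => hev.ne' (h0 h.symm)
      have hr3 : 0 < m * K / (A * -ew) := by
        have : 0 < -ew := by linarith
        positivity
      have h5 : 0 < A * -ew := mul_pos hA (by linarith)
      have h6 : l * K / (A * ev) * (A * ev) = l * K := div_mul_cancel₀ _ (by positivity)
      have h7 : m * K / (A * -ew) * (A * ew) = -(m * K) := by
        linarith [div_mul_cancel₀ (m * K) h5.ne']
      have h3 := hmin (l * K / (A * ev), m * K / (A * -ew)) ((hV _).2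
        ⟨by positivity, hr3.le, Or.inr (Or.inr ⟨hev.ne', h6, hew.ne, h7⟩)⟩)
      have h4 := hmono hl0 _ _ hr3 (hcurve₃ _ _ hev.ne' h6 hew.ne h7) h3
      rw [le_div_iff₀ h5] at h4
      linarith
  · rcases hcase with ⟨rfl, -, h⟩ | ⟨rfl, -, h⟩ | ⟨h1, h2, h3, h4⟩
    · exact Or.inl rfl
    · exact Or.inr (Or.inl rfl)
    · exact Or.inr (Or.inr (by linarith))

/-- For `m = 0` the curve degenerates into the lines `r = 0` and `t = q / A`. The chord must follow
the first. Since `ew < 0`, the parallel event comes strictly before `t = q / A`, so the second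
candidate, which lies on the wrong line, is never selected. -/
theorem first_event_of_eq_zero {p q A ev ew x y : ℝ} (hp : 0 < p) (hq : 0 < q) (hA : 0 < A)
    (hx : 0 < x) (hy : 0 < y) (hK : 0 < ew * p + ev * q) (hew : ew < 0) {V : ℝ × ℝ → Prop}
    (hV : ∀ z, V z ↔ 0 ≤ z.1 ∧ 0 ≤ z.2 ∧
      ((z.1 = x ∧ q - A * x ≠ 0 ∧ z.2 * (q - A * x) = 0) ∨
       (z.2 = y ∧ A * y ≠ 0 ∧ z.1 * (A * y) = q * y) ∨
       (ev ≠ 0 ∧ z.1 * (A * ev) = ew * p + ev * q ∧ ew ≠ 0 ∧ z.2 * (A * ew) = 0)))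
    {z : ℝ × ℝ} (hz : V z) (hmin : ∀ z', V z' → z.1 ≤ z'.1) :
    0 < z.1 ∧ z.2 = 0 ∧ z.1 ≤ x ∧ 0 < q - A * z.1 ∧ 0 ≤ ew * p + ev * q - A * z.1 * ev ∧
      (z.1 = x ∨ ew * p + ev * q - A * z.1 * ev = 0) := by
  obtain ⟨t, r⟩ := z
  obtain ⟨ht, hr, hcase⟩ := (hV _).1 hz
  set K := ew * p + ev * q with hKdef
  simp only at ht hr hcase hmin ⊢
  have hev : 0 < ev := by
    by_contra h
    nlinarith
  have hAev := mul_pos hA hev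
  have h3 : t ≤ K / (A * ev) := hmin (K / (A * ev), 0) ((hV _).2
    ⟨by positivity, le_rfl, Or.inr (Or.inr ⟨hev.ne', by simp only; field_simp, hew.ne, by simp⟩)⟩)
  rw [le_div_iff₀ hAev] at h3
  have h4 : 0 < q - A * t := by
    have : 0 < ev * (q - A * t) := by nlinarith
    exact (pos_iff_pos_of_mul_pos this).1 hev
  have h2 : r = 0 ∧ 0 < t ∧ (t = x ∨ K - A * t * ev = 0) := by
    rcases hcase with ⟨rfl, h, h'⟩ | ⟨rfl, h, h'⟩ | ⟨h1, h2, h3, h4⟩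
    · exact ⟨(mul_eq_zero.1 h').resolve_right h, hx, Or.inl rfl⟩
    · exfalso
      have : r * (q - A * t) = 0 := by linarith
      have := mul_pos hy h4
      linarith
    · refine ⟨(mul_eq_zero.1 h4).resolve_right (by positivity), ?_, Or.inr (by linarith)⟩
      have : 0 < t * (A * ev) := by linarith
      exact (pos_iff_pos_of_mul_pos this).2 hAev
  refine ⟨h2.2.1, h2.1, ?_, h4, by linarith, h2.2.2⟩
  by_contra hlt
  push Not at hlt
  have h5 : 0 < q - A * x := by nlinarith
  exact absurd (hmin (x, 0) ((hV _).2 ⟨hx.le, le_rfl, Or.inl ⟨rfl, h5.ne', by simp⟩⟩))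
    (not_le.2 hlt)

theorem validPair_left_iff {x num den : ℝ} {z : ℝ × ℝ} :
    ValidPair (some x) (quotient num den) z ↔
      0 ≤ z.1 ∧ 0 ≤ z.2 ∧ z.1 = x ∧ den ≠ 0 ∧ z.2 * den = num := by
  simp only [ValidPair, quotient_eq_some, Option.some.injEq, eq_comm (a := x)]
  tauto

theorem validPair_right_iff {y num den : ℝ} {z : ℝ × ℝ} :
    ValidPair (quotient num den) (some y) z ↔
      0 ≤ z.1 ∧ 0 ≤ z.2 ∧ z.2 = y ∧ den ≠ 0 ∧ z.1 * den = num := by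
  simp only [ValidPair, quotient_eq_some, Option.some.injEq, eq_comm (a := y)]
  tauto

theorem validPair_both_iff {num den num' den' : ℝ} {z : ℝ × ℝ} :
    ValidPair (quotient num den) (quotient num' den') z ↔
      0 ≤ z.1 ∧ 0 ≤ z.2 ∧ den ≠ 0 ∧ z.1 * den = num ∧ den' ≠ 0 ∧ z.2 * den' = num' := by
  simp only [ValidPair, quotient_eq_some]
  tauto

/-- The numerators of `t_{b,3}` and `t_{c,3}` by means of `β` and `γ`. -/
theorem numerator_tb3 (a e b v c w : Pt) :
    cross e (a - b) * cross v w + cross (c - b) w * cross e v =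
      cross e w * (2 * cross v (c - b) - coeffBeta a b v c)
        + cross e v * coeffGamma a b c w := by
  simp only [coeffBeta, coeffGamma, cross, Prod.fst_sub, Prod.snd_sub]; ring

theorem numerator_tc3 (a e b v c w : Pt) :
    cross e (a - c) * cross v w - cross v (c - b) * cross e w =
      -(cross e w * coeffBeta a b v c)
        - cross e v * (2 * cross (c - b) w - coeffGamma a b c w) := by
  simp only [coeffBeta, coeffGamma, cross, Prod.fst_sub, Prod.snd_sub]; ring

theorem cross_edge_expand (e d v w : Pt) :
    cross v w * cross e d = cross e w * cross v d + cross e v * cross d w := by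
  simp only [cross]; ring

/-- Writing `β = 2 p m` and `γ = 2 q l` with `l + m = 1` cancels the factors 2 and gives the two
numerators of the third pair the common factor `ew p + ev q`. -/
theorem candidate_iff {a e b v c w : Pt} {x y l m : ℝ} (hlm : l + m = 1)
    (hA : cross v w ≠ 0) (hβ : coeffBeta a b v c = 2 * cross v (c - b) * m)
    (hγ : coeffGamma a b c w = 2 * cross (c - b) w * l) (z : ℝ × ℝ) :
    Candidate a e b v c w x y z ↔ 0 ≤ z.1 ∧ 0 ≤ z.2 ∧
      ((z.1 = x ∧ cross (c - b) w * l - cross v w * x ≠ 0 ∧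
          z.2 * (cross (c - b) w * l - cross v w * x) = cross v (c - b) * m * x) ∨
       (z.2 = y ∧ cross v (c - b) * m + cross v w * y ≠ 0 ∧
          z.1 * (cross v (c - b) * m + cross v w * y) = cross (c - b) w * l * y) ∨
       (cross e v ≠ 0 ∧ z.1 * (cross v w * cross e v) =
            l * (cross e w * cross v (c - b) + cross e v * cross (c - b) w) ∧
        cross e w ≠ 0 ∧ z.2 * (cross v w * cross e w) =
            -(m * (cross e w * cross v (c - b) + cross e v * cross (c - b) w)))) := by
  rw [Candidate, validPair_left_iff, validPair_right_iff, validPair_both_iff, numerator_tb3,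
    numerator_tc3, hβ, hγ]
  obtain rfl : m = 1 - l := by linarith
  generalize cross v (c - b) = p
  generalize cross (c - b) w = q
  generalize cross v w = A at hA ⊢
  generalize cross e v = ev
  generalize cross e w = ew
  have h1 : 2 * q * l - 2 * A * x = 2 * (q * l - A * x) := by ring
  have h2 : 2 * p * (1 - l) + 2 * A * y = 2 * (p * (1 - l) + A * y) := by ring
  rw [h1, h2]
  have h3 : ∀ r s : ℝ, r * (2 * s) = 2 * p * (1 - l) * x ↔ r * s = p * (1 - l) * x := by
    intro r s; constructor <;> intro h <;> linarith
  have h4 : ∀ r s : ℝ, r * (2 * s) = 2 * q * l * y ↔ r * s = q * l * y := by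
    intro r s; constructor <;> intro h <;> linarith
  have h5 : z.1 * -(2 * A * ev) = -(ew * (2 * p - 2 * p * (1 - l)) + ev * (2 * q * l)) ↔
      z.1 * (A * ev) = l * (ew * p + ev * q) := by
    constructor <;> intro h <;> linarith
  have h6 : z.2 * -(2 * A * ew) = -(-(ew * (2 * p * (1 - l))) - ev * (2 * q - 2 * q * l)) ↔
      z.2 * (A * ew) = -((1 - l) * (ew * p + ev * q)) := by
    constructor <;> intro h <;> linarith
  have h7 : ∀ s : ℝ, 2 * s ≠ 0 ↔ s ≠ 0 := by intro s; simp
  have h8 : ∀ s : ℝ, -(2 * A * s) ≠ 0 ↔ s ≠ 0 := by intro s; simp [hA]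
  rw [h3, h4, h5, h6, h7, h7, h8, h8, ← and_or_left, ← and_or_left]
  simp only [← and_or_left, or_assoc]

/-! ### The effect of one advance of the chord -/

section Polygon

variable {n : ℕ} [NeZero n] {P : Fin n → Pt} {A ib ic : ℤ} {sb sc : ℝ}

/-- Used for `β = 0`, when the line of the edge `ic` passes through the apex. The vertex `A + 1`
lies on the inner side of that line, and if the edge at the apex were parallel to it, `he` would
contradict the position of `b`. -/
theorem BalancedChord.cross_edge_right_neg (hP : IsConvexNGon P)
    (h : BalancedChord P A ib sb ic sc)
    (he : 0 < cross (edge P A) (edgePt P ic sc - edgePt P ib sb))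
    (hw : cross (edge P ic) (vert P A - edgePt P ic sc) = 0) :
    cross (edge P A) (edge P ic) < 0 := by
  have hq := h.right_pos hP
  have h1 := (inside_vert hP (A + 1)).edgePt_nonneg ic sc
  have h2 := inside_edgePt hP ib h.sb_nonneg h.sb_lt.le A
  have e1 : vert P (A + 1) - edgePt P ic sc = (vert P A - edgePt P ic sc) + edge P A := by
    simp only [edge]; abel
  rw [e1, cross_add_right, hw, zero_add] at h1
  rw [cross_swap]
  have h3 : 0 < cross (edge P ic) (edge P A) := by
    refine lt_of_le_of_ne h1 fun h0 => ?_
    have hd : edge P ic ≠ 0 := edge_ne_zero hP ic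
    obtain ⟨r, hr⟩ := exists_smul_of_cross_eq_zero (v := edge P A) hd
      (by rw [cross_swap, ← h0, neg_zero])
    rw [hr, cross_smul_left] at h2 he
    rw [cross_swap (edge P ic)] at he
    have e2 : cross (edge P ic) (edgePt P ib sb - vert P A) =
        cross (edgePt P ic sc - edgePt P ib sb) (edge P ic)
          - cross (edge P ic) (vert P A - edgePt P ic sc) := by
      simp only [cross, Prod.fst_sub, Prod.snd_sub]; ring
    rw [e2, hw, sub_zero] at h2
    nlinarith
  linarith

/-- Used for `γ = 0`, when the line of the edge `ib` passes through the apex. The support inequality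
at `A + 1` and the one for `b` at the edge `A` give opposite signs. -/
theorem BalancedChord.cross_edge_left_eq_zero (hP : IsConvexNGon P)
    (h : BalancedChord P A ib sb ic sc)
    (hp : 0 < cross (edge P ib) (edgePt P ic sc - edgePt P ib sb))
    (hv : cross (edge P ib) (vert P A - edgePt P ib sb) = 0) :
    cross (edge P A) (edge P ib) = 0 := by
  have h1 := (inside_vert hP (A + 1)).edgePt_nonneg ib sb
  have h2 := inside_edgePt hP ib h.sb_nonneg h.sb_lt.le A
  have e1 : vert P (A + 1) - edgePt P ib sb = (vert P A - edgePt P ib sb) + edge P A := by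
    simp only [edge]; abel
  rw [e1, cross_add_right, hv, zero_add, cross_swap] at h1
  obtain ⟨r, hr⟩ := exists_smul_of_cross_eq_zero (v := vert P A - edgePt P ib sb)
    (edge_ne_zero hP ib) (by rw [cross_swap, hv, neg_zero])
  have hS := h.area_pos
  rw [hr, cross_smul_right, cross_swap] at hS
  have e2 : edgePt P ib sb - vert P A = (-r) • edge P ib := by rw [neg_smul, ← hr]; abel
  rw [e2, cross_smul_right] at h2
  nlinarith

/-- The balance vanishes along the curve on which both end points of the chord move. -/
theorem BalancedChord.closed_of_curve (hP : IsConvexNGon P) (h : BalancedChord P A ib sb ic sc)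
    (hF : balance (vert P A) (edgePt P ib sb) (edgePt P ic sc) (edge P ib) (edge P ic) = 0)
    {t r : ℝ} (ht : 0 ≤ t) (hr : 0 ≤ r) (ht1 : sb + t ≤ 1) (hr1 : sc + r ≤ 1)
    (hcurve : coeffBeta (vert P A) (edgePt P ib sb) (edge P ib) (edgePt P ic sc) * t
      - coeffGamma (vert P A) (edgePt P ib sb) (edgePt P ic sc) (edge P ic) * r
      + 2 * cross (edge P ib) (edge P ic) * t * r = 0)
    (hq : 0 < cross (edgePt P ic sc - edgePt P ib sb) (edge P ic)
      - cross (edge P ib) (edge P ic) * t)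
    (he : 0 ≤ cross (edge P A) (edgePt P ic sc - edgePt P ib sb)
      + (r * cross (edge P A) (edge P ic) - t * cross (edge P A) (edge P ib))) :
    ClosedChord P A ib (sb + t) ic (sc + r) := by
  refine h.move_both hP hF ht hr ht1 hr1 ?_ ?_ ?_
  · rw [edgePt_add, edgePt_add, balance_move, hF, hcurve]; ring
  · rw [edgePt_add, edgePt_add]
    convert hq using 1
    simp only [cross, Prod.fst_sub, Prod.snd_sub, Prod.fst_add,
      Prod.snd_add, Prod.smul_fst, Prod.smul_snd, smul_eq_mul]
    ring
  · rw [edgePt_add, edgePt_add]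
    convert he using 1
    simp only [cross, Prod.fst_sub, Prod.snd_sub, Prod.fst_add,
      Prod.snd_add, Prod.smul_fst, Prod.smul_snd, smul_eq_mul]
    ring

/-- What one execution of `advance` does to a balanced chord: the result is again balanced, some
event happens, and the chord passes through balanced chords only. -/
def AdvanceSpec (P : Fin n → Pt) (A ib : ℤ) (sb : ℝ) (ic : ℤ) (sc sb' sc' : ℝ) : Prop :=
  ClosedChord P A ib sb' ic sc' ∧
  (sb' = 1 ∨ sc' = 1 ∨ cross (edge P A) (edgePt P ic sc' - edgePt P ib sb') = 0 ∨
    (balance (vert P A) (edgePt P ib sb) (edgePt P ic sc) (edge P ib) (edge P ic) ≠ 0 ∧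
      balance (vert P A) (edgePt P ib sb') (edgePt P ic sc') (edge P ib) (edge P ic) = 0)) ∧
  ∀ D : Pt, cross D (edgePt P ic sc - edgePt P ib sb) ≤ 0 →
    0 < cross D (edgePt P ic sc' - edgePt P ib sb') →
    ∃ sb'' sc'' : ℝ, cross D (edgePt P ic sc'' - edgePt P ib sb'') = 0 ∧
      ((sb'' = sb ∧ sc'' = sc) ∨ (ClosedChord P A ib sb'' ic sc'' ∧
        ((0 < sb'' ∧ sb'' < 1) ∨ (0 < sc'' ∧ sc'' < 1))))

/-- Both `e ∧ d` and the balance are affine in the displacement of `b`, so their signs at the two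
ends of the move hold throughout and every intermediate chord is closed. -/
theorem BalancedChord.advanceSpec_of_neg (hP : IsConvexNGon P)
    (h : BalancedChord P A ib sb ic sc)
    (he : 0 < cross (edge P A) (edgePt P ic sc - edgePt P ib sb))
    (hF : balance (vert P A) (edgePt P ib sb) (edgePt P ic sc) (edge P ib) (edge P ic) < 0) :
    ∃ sb' sc', (advance (vert P A) (edge P A) (edgePt P ib sb) (edge P ib) (edgePt P ic sc)
        (edge P ic) ⟨ib, sb, ic, sc⟩).val = ⟨ib, sb', ic, sc'⟩ ∧
      AdvanceSpec P A ib sb ic sc sb' sc' := by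
  obtain ⟨t, hval, ht, ht1, he', hF', hev⟩ :=
    advance_of_balance_neg (s := ⟨ib, sb, ic, sc⟩) hF h.sb_lt he
  simp only at hval ht1 hev
  have hdE : ∀ u, 0 ≤ u → u ≤ t →
      0 ≤ cross (edge P A) (edgePt P ic sc - (edgePt P ib sb + u • edge P ib)) := by
    intro u hu hut
    rw [← sub_sub, cross_sub_right, cross_smul_right] at he' ⊢
    rcases le_or_gt (cross (edge P A) (edge P ib)) 0 with h0 | h0 <;> nlinarith
  have hdF : ∀ u, 0 ≤ u → u ≤ t → balance (vert P A) (edgePt P ib sb + u • edge P ib)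
      (edgePt P ic sc) (edge P ib) (edge P ic) ≤ 0 := by
    intro u hu hut
    rw [balance_move_left] at hF' ⊢
    generalize cross (edge P ib) (edge P ic) = x at *
    generalize coeffBeta _ _ _ _ = y at *
    rcases le_or_gt (x * y) 0 with h0 | h0 <;> nlinarith
  have hcl : ∀ u, 0 < u → u ≤ t → ClosedChord P A ib (sb + u) ic sc := by
    intro u hu hut
    exact h.move_left hP hF hu (by linarith) (by rw [edgePt_add]; exact hdF u hu.le hut)
      (by rw [edgePt_add]; exact hdE u hu.le hut)
  refine ⟨sb + t, sc, hval, hcl t ht le_rfl, ?_, ?_⟩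
  · rw [edgePt_add]
    rcases hev with hev | hev | hev
    · exact Or.inl hev
    · exact Or.inr (Or.inr (Or.inl hev))
    · exact Or.inr (Or.inr (Or.inr ⟨hF.ne, hev⟩))
  · intro D hD hD'
    rw [edgePt_add, ← sub_sub, cross_sub_right, cross_smul_right] at hD'
    set x := cross D (edgePt P ic sc - edgePt P ib sb)
    set y := cross D (edge P ib)
    have hy : y < 0 := by
      by_contra hy
      push Not at hy
      nlinarith
    -- The displacement `x / y` is where the chord becomes parallel to `D`.
    have hu0 : 0 ≤ x / y := div_nonneg_of_nonpos hD hy.le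
    have huy : x / y * y = x := div_mul_cancel₀ _ hy.ne
    have hut : x / y < t := by
      by_contra hut
      push Not at hut
      nlinarith
    refine ⟨sb + x / y, sc, ?_, ?_⟩
    · rw [edgePt_add, ← sub_sub, cross_sub_right, cross_smul_right]
      linarith
    · rcases eq_or_lt_of_le hu0 with hu | hu
      · left; simp [← hu]
      · right
        exact ⟨hcl _ hu hut.le, Or.inl ⟨by linarith [h.sb_nonneg], by linarith⟩⟩

theorem BalancedChord.advanceSpec_of_pos (hP : IsConvexNGon P)
    (h : BalancedChord P A ib sb ic sc)
    (he : 0 < cross (edge P A) (edgePt P ic sc - edgePt P ib sb))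
    (hF : 0 < balance (vert P A) (edgePt P ib sb) (edgePt P ic sc) (edge P ib) (edge P ic)) :
    ∃ sb' sc', (advance (vert P A) (edge P A) (edgePt P ib sb) (edge P ib) (edgePt P ic sc)
        (edge P ic) ⟨ib, sb, ic, sc⟩).val = ⟨ib, sb', ic, sc'⟩ ∧
      AdvanceSpec P A ib sb ic sc sb' sc' := by
  obtain ⟨t, hval, ht, ht1, he', hF', hev⟩ :=
    advance_of_balance_pos (s := ⟨ib, sb, ic, sc⟩) hF h.sc_lt he
  simp only at hval ht1 hev
  have hdE : ∀ u, 0 ≤ u → u ≤ t →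
      0 ≤ cross (edge P A) (edgePt P ic sc + u • edge P ic - edgePt P ib sb) := by
    intro u hu hut
    rw [add_sub_right_comm, cross_add_right, cross_smul_right] at he' ⊢
    rcases le_or_gt (cross (edge P A) (edge P ic)) 0 with h0 | h0 <;> nlinarith
  have hdF : ∀ u, 0 ≤ u → u ≤ t → 0 ≤ balance (vert P A) (edgePt P ib sb)
      (edgePt P ic sc + u • edge P ic) (edge P ib) (edge P ic) := by
    intro u hu hut
    rw [balance_move_right] at hF' ⊢
    generalize cross (edge P ib) (edge P ic) = x at *
    generalize coeffGamma _ _ _ _ = y at *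
    rcases le_or_gt (x * y) 0 with h0 | h0 <;> nlinarith
  have hcl : ∀ u, 0 < u → u ≤ t → ClosedChord P A ib sb ic (sc + u) := by
    intro u hu hut
    exact h.move_right hP hF hu (by linarith) (by rw [edgePt_add]; exact hdF u hu.le hut)
      (by rw [edgePt_add]; exact hdE u hu.le hut)
  refine ⟨sb, sc + t, hval, hcl t ht le_rfl, ?_, ?_⟩
  · rw [edgePt_add]
    rcases hev with hev | hev | hev
    · exact Or.inr (Or.inl hev)
    · exact Or.inr (Or.inr (Or.inl hev))
    · exact Or.inr (Or.inr (Or.inr ⟨hF.ne', hev⟩))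
  · intro D hD hD'
    rw [edgePt_add, add_sub_right_comm, cross_add_right, cross_smul_right] at hD'
    set x := cross D (edgePt P ic sc - edgePt P ib sb)
    set y := cross D (edge P ic)
    have hy : 0 < y := by
      by_contra hy
      push Not at hy
      nlinarith
    have hu0 : 0 ≤ -x / y := div_nonneg (by linarith) hy.le
    have huy : -x / y * y = -x := div_mul_cancel₀ _ hy.ne'
    have hut : -x / y < t := by
      by_contra hut
      push Not at hut
      nlinarith
    refine ⟨sb, sc + -x / y, ?_, ?_⟩
    · rw [edgePt_add, add_sub_right_comm, cross_add_right, cross_smul_right]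
      linarith
    · rcases eq_or_lt_of_le hu0 with hu | hu
      · left; simp [← hu]
      · right
        exact ⟨hcl _ hu hut.le, Or.inr ⟨by linarith [h.sc_nonneg], by linarith⟩⟩

end Polygon

/-- Along the curve, `e ∧ d` times a positive factor equals a positive factor times a function
affine in `u`. So the chord is parallel to `e` exactly where that affine function vanishes. -/
theorem curve_identity {p q A l m ev ew ed u s : ℝ} (hlm : l + m = 1)
    (hexp : A * ed = ew * p + ev * q) (hs : s * (p * m + A * u) = q * l * u) :
    A * (p * m + A * u) * (ed + (u * ew - s * ev)) =
      (p + A * u) * (m * (ew * p + ev * q) + A * u * ew) := by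
  have e1 : A * (p * m + A * u) * (ed + (u * ew - s * ev)) =
    (p * m + A * u) * (A * ed) + A * u * ew * (p * m + A * u)
      - A * ev * (s * (p * m + A * u)) := by ring
  rw [e1, hs, hexp]
  obtain rfl : l = 1 - m := by linarith
  ring

/-- What holds at the end of the movement holds at every earlier point of the curve: `s` is monotone
in `u`, and a function affine in `u` that is positive at zero and nonnegative at `r` is nonnegative
in between. -/
theorem curve_facts {p q A l m ev ew ed t r u s : ℝ} (hp : 0 < p) (hq : 0 < q) (hA : 0 < A)
    (hm : 0 < m) (hl : 0 ≤ l) (hlm : l + m = 1) (hexp : A * ed = ew * p + ev * q)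
    (hK : 0 < ew * p + ev * q) (hu : 0 < u) (hur : u ≤ r)
    (hcurve : t * (p * m + A * r) = q * l * r) (hs : s * (p * m + A * u) = q * l * u)
    (hre : 0 ≤ m * (ew * p + ev * q) + A * r * ew) :
    0 ≤ s ∧ s ≤ t ∧ 0 < q - A * s ∧ 0 ≤ ed + (u * ew - s * ev) := by
  have hr : 0 < r := hu.trans_le hur
  have hpm := mul_pos hp hm
  have hden : 0 < p * m + A * u := by positivity
  have hden' : 0 < p * m + A * r := by positivity
  refine ⟨?_, ?_, ?_, ?_⟩
  · have : 0 ≤ s * (p * m + A * u) := by rw [hs]; positivity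
    exact nonneg_of_mul_nonneg_left this hden
  · by_contra hlt
    push Not at hlt
    have h1 : t * (p * m + A * r) * (p * m + A * u)
        < s * (p * m + A * u) * (p * m + A * r) := by
      have h2 := mul_lt_mul_of_pos_right hlt (mul_pos hden hden')
      linarith
    rw [hs, hcurve] at h1
    have : 0 ≤ q * l * (p * m) * (r - u) := by
      have : 0 ≤ r - u := by linarith
      positivity
    linarith
  · have h1 : (q - A * s) * (p * m + A * u) = q * (p * m) + A * q * u * (1 - l) := by
      linear_combination (-A) * hs
    have h2 : 0 < (q - A * s) * (p * m + A * u) := by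
      rw [h1]
      have : 0 ≤ 1 - l := by linarith
      positivity
    exact (pos_iff_pos_of_mul_pos h2).2 hden
  · have h1 : 0 ≤ m * (ew * p + ev * q) + A * u * ew := by
      rcases le_or_gt 0 ew with h0 | h0
      · positivity
      · have : A * -ew * u ≤ A * -ew * r :=
          mul_le_mul_of_nonneg_left hur (mul_pos hA (neg_pos.2 h0)).le
        linarith
    have h2 : 0 ≤ A * (p * m + A * u) * (ed + (u * ew - s * ev)) := by
      rw [curve_identity hlm hexp hs]
      have : 0 < p + A * u := by positivity
      positivity
    exact nonneg_of_mul_nonneg_right h2 (by positivity)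

section Polygon

variable {n : ℕ} [NeZero n] {P : Fin n → Pt} {A ib ic : ℤ} {sb sc : ℝ}

/-- With `β = 2 p m` and `γ = 2 q l` the movement follows `t (p m + α r) = q l r`. For `m > 0` this
is the graph of `t` over `r`, which remains valid when `l = 0` and only `c` moves; for `m = 0` only
`b` moves. -/
theorem BalancedChord.advanceSpec_of_eq_zero (hP : IsConvexNGon P)
    (h : BalancedChord P A ib sb ic sc)
    (he : 0 < cross (edge P A) (edgePt P ic sc - edgePt P ib sb))
    (hF : balance (vert P A) (edgePt P ib sb) (edgePt P ic sc) (edge P ib) (edge P ic) = 0) :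
    ∃ sb' sc', (advance (vert P A) (edge P A) (edgePt P ib sb) (edge P ib) (edgePt P ic sc)
        (edge P ic) ⟨ib, sb, ic, sc⟩).val = ⟨ib, sb', ic, sc'⟩ ∧
      AdvanceSpec P A ib sb ic sc sb' sc' := by
  have hp := h.left_pos hP hF.le
  have hq := h.right_pos hP
  have hA := h.cross_edges_pos hP hF
  have hβ := h.coeffBeta_nonneg hP hF.le
  have hγ := h.coeffGamma_nonneg hP
  have hβW := coeffBeta_mul (vert P A) (edgePt P ib sb) (edgePt P ic sc) (edge P ib) (edge P ic)
  have hγV := coeffGamma_mul (vert P A) (edgePt P ib sb) (edgePt P ic sc) (edge P ib) (edge P ic)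
  have hβV : coeffBeta (vert P A) (edgePt P ib sb) (edge P ib) (edgePt P ic sc)
      = 2 * cross (edge P ib) (edgePt P ic sc - edgePt P ib sb)
        - cross (edge P ib) (vert P A - edgePt P ib sb) := by
    simp only [coeffBeta, cross_sub_right]; ring
  have hwneg := h.cross_edge_right_neg hP he
  have hvzero := h.cross_edge_left_eq_zero hP hp
  have hexp := cross_edge_expand (edge P A) (edgePt P ic sc - edgePt P ib sb) (edge P ib)
    (edge P ic)
  have hcand := fun x y l m hlm hm hl => candidate_iff (a := vert P A) (e := edge P A)
    (b := edgePt P ib sb) (v := edge P ib) (c := edgePt P ic sc) (w := edge P ic)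
    (x := x) (y := y) (l := l) (m := m) hlm hA.ne' hm hl
  have hadv := fun z => advance_of_balance_eq_zero (e := edge P A) (s := ⟨ib, sb, ic, sc⟩)
    (z := z) hF
  have hclosed := fun t r => h.closed_of_curve hP hF (t := t) (r := r)
  have hD : ∀ (D : Pt) (t r : ℝ), cross D (edgePt P ic (sc + r) - edgePt P ib (sb + t)) =
      cross D (edgePt P ic sc - edgePt P ib sb)
        + (r * cross D (edge P ic) - t * cross D (edge P ib)) := by
    intro D t r
    simp only [edgePt_add, cross_sub_right, cross_add_right, cross_smul_right]; ring
  rw [hF, sub_zero] at hβW hγV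
  simp only [AdvanceSpec]
  have hx : 0 < 1 - sb := sub_pos.2 h.sb_lt
  have hy : 0 < 1 - sc := sub_pos.2 h.sc_lt
  have hsb := h.sb_nonneg
  have hsc := h.sc_nonneg
  simp only at hadv
  set p := cross (edge P ib) (edgePt P ic sc - edgePt P ib sb)
  set q := cross (edgePt P ic sc - edgePt P ib sb) (edge P ic)
  set α := cross (edge P ib) (edge P ic)
  set β := coeffBeta (vert P A) (edgePt P ib sb) (edge P ib) (edgePt P ic sc)
  set γ := coeffGamma (vert P A) (edgePt P ib sb) (edgePt P ic sc) (edge P ic)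
  set ev := cross (edge P A) (edge P ib)
  set ew := cross (edge P A) (edge P ic)
  set ed := cross (edge P A) (edgePt P ic sc - edgePt P ib sb)
  obtain ⟨m, hm⟩ : ∃ m, β = 2 * p * m := ⟨β / (2 * p), by field_simp⟩
  obtain ⟨l, hl⟩ : ∃ l, γ = 2 * q * l := ⟨γ / (2 * q), by field_simp⟩
  have hm0 : 0 ≤ m := by
    rw [hm] at hβ
    exact nonneg_of_mul_nonneg_right hβ (by positivity)
  have hl0 : 0 ≤ l := by
    rw [hl] at hγ
    exact nonneg_of_mul_nonneg_right hγ (by positivity)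
  -- When the balance is zero, the product formulas for `β` and `γ` add up to `γ p + β q = 2 p q`.
  have hlm : l + m = 1 := by
    have h1 : (2 * p * q) * (l + m - 1) = 0 := by
      have : γ * p + β * q = 2 * p * q := by rw [hγV, hβV]; ring
      rw [hl, hm] at this
      linarith
    have h2 := (mul_eq_zero.1 h1).resolve_left (by positivity)
    linarith
  have hK : 0 < ew * p + ev * q := by rw [← hexp]; exact mul_pos hA he
  have hC := hcand (1 - sb) (1 - sc) l m hlm hm hl
  have hden : 0 < p * m + α * (1 - sc) := by
    have := mul_pos hA hy
    positivity
  -- The pair that takes `c` to the end of its edge is always valid, so the selection is never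
  -- empty.
  obtain ⟨z, hval, hz, hmin⟩ := hadv (q * l * (1 - sc) / (p * m + α * (1 - sc)), 1 - sc)
    ((hC _).2 ⟨by positivity, hy.le, Or.inr (Or.inl ⟨rfl, hden.ne', div_mul_cancel₀ _ hden.ne'⟩)⟩)
  refine ⟨_, _, hval, ?_⟩
  rcases eq_or_lt_of_le hm0 with hm1 | hm1
  · -- the end point `c` does not move
    have hl1 : l = 1 := by linarith
    have hβ0 : β = 0 := by rw [hm, ← hm1, mul_zero]
    have hew : ew < 0 := by
      refine hwneg ?_
      have : p * cross (edge P ic) (vert P A - edgePt P ic sc) = 0 := by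
        rw [← hβW, hβ0, zero_mul]
      exact (mul_eq_zero.1 this).resolve_left hp.ne'
    rw [← hm1, hl1] at hC
    simp only [mul_one, mul_zero, zero_mul, zero_add, one_mul, neg_zero] at hC
    obtain ⟨t0, r0, tx, tq, te, hev⟩ := first_event_of_eq_zero hp hq hA hx hy hK hew hC hz hmin
    obtain ⟨t, r⟩ := z
    simp only at t0 r0 tx tq te hev ⊢
    subst r0
    have hK' : ew * p + ev * q - α * t * ev = α * (ed + (0 * ew - t * ev)) := by
      rw [← hexp]; ring
    have hcl : ∀ u, 0 < u → u ≤ t → ClosedChord P A ib (sb + u) ic (sc + 0) := by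
      intro u hu hut
      refine hclosed u 0 hu.le le_rfl (by linarith) (by linarith) ?_ ?_ ?_
      · rw [hβ0]; ring
      · nlinarith
      · have h1 : 0 ≤ ed + (0 * ew - t * ev) := by
          rw [hK'] at te
          exact nonneg_of_mul_nonneg_right te hA
        rcases le_or_gt ev 0 with h0 | h0 <;> nlinarith
    refine ⟨hcl t t0 le_rfl, ?_, ?_⟩
    · rcases hev with hev | hev
      · left; linarith
      · right; right; left
        rw [hK'] at hev
        rw [hD]
        exact (mul_eq_zero.1 hev).resolve_left hA.ne'
    · intro D hD0 hD1
      rw [hD] at hD1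
      set X := cross D (edgePt P ic sc - edgePt P ib sb)
      have hY : cross D (edge P ib) < 0 := by
        by_contra hY
        push Not at hY
        nlinarith
      have hu0 : 0 ≤ X / cross D (edge P ib) := div_nonneg_of_nonpos hD0 hY.le
      have huy : X / cross D (edge P ib) * cross D (edge P ib) = X := div_mul_cancel₀ _ hY.ne
      have hut : X / cross D (edge P ib) < t := by
        by_contra hut
        push Not at hut
        nlinarith
      refine ⟨sb + X / cross D (edge P ib), sc + 0, ?_, ?_⟩
      · rw [hD]; linarith
      · rcases eq_or_lt_of_le hu0 with hu | hu
        · left; simp [← hu]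
        · right
          exact ⟨hcl _ hu hut.le, Or.inl ⟨by linarith, by linarith⟩⟩
  · -- both end points move, or only `c` does
    have hl00 : l = 0 → ev = 0 := by
      intro hl0
      refine hvzero ?_
      have : q * cross (edge P ib) (vert P A - edgePt P ib sb) = 0 := by
        rw [← hγV, hl, hl0]; ring
      exact (mul_eq_zero.1 this).resolve_left hq.ne'
    obtain ⟨t0, r0, tx, ry, hcurve, hre, hev⟩ :=
      first_event_of_pos hp hq hA hm1 hl0 hx hy hK hl00 hC hz hmin
    obtain ⟨t, r⟩ := z
    simp only at t0 r0 tx ry hcurve hre hev ⊢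
    have hpm := mul_pos hp hm1
    have hcl : ∀ u s, 0 < u → u ≤ r → s * (p * m + α * u) = q * l * u →
        ClosedChord P A ib (sb + s) ic (sc + u) := by
      intro u s hu hur hs
      obtain ⟨hs0, hst, hqs, hes⟩ :=
        curve_facts hp hq hA hm1 hl0 hlm hexp hK hu hur hcurve hs hre
      exact hclosed s u hs0 hu.le (by linarith) (by linarith) (by rw [hm, hl]; linarith) hqs hes
    refine ⟨hcl r t r0 le_rfl hcurve, ?_, ?_⟩
    · rcases hev with hev | hev | hev
      · left; linarith
      · right; left; linarith
      · right; right; left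
        rw [hD]
        have h1 := curve_identity hlm hexp hcurve
        rw [hev, mul_zero] at h1
        exact (mul_eq_zero.1 h1).resolve_left (by positivity)
    · intro D hD0 hD1
      have hden : ∀ u ∈ Set.Icc 0 r, p * m + α * u ≠ 0 := by
        intro u hu
        have := mul_nonneg hA.le hu.1
        positivity
      -- `f u` is the wedge product of `D` with the chord at the parameter `u` of the curve; the
      -- intermediate value theorem supplies the parallel chord.
      let f : ℝ → ℝ := fun u => cross D (edgePt P ic sc - edgePt P ib sb)
        + (u * cross D (edge P ic) - q * l * u / (p * m + α * u) * cross D (edge P ib))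
      have hf : ContinuousOn f (Set.Icc 0 r) := by
        refine ContinuousOn.add continuousOn_const (ContinuousOn.sub (by fun_prop)
          (ContinuousOn.mul (ContinuousOn.div (by fun_prop) (by fun_prop) hden) (by fun_prop)))
      have ht : t = q * l * r / (p * m + α * r) := by
        rw [eq_div_iff (hden r ⟨r0.le, le_rfl⟩), hcurve]
      rw [hD, ht] at hD1
      obtain ⟨u, hu, hfu⟩ := intermediate_value_Icc r0.le hf
        (show (0 : ℝ) ∈ Set.Icc (f 0) (f r) from ⟨by simpa [f] using hD0, hD1.le⟩)
      refine ⟨sb + q * l * u / (p * m + α * u), sc + u, ?_, ?_⟩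
      · rw [hD]; exact hfu
      · rcases eq_or_lt_of_le hu.1 with hu0 | hu0
        · left; simp [← hu0]
        · right
          refine ⟨hcl u _ hu0 hu.2 (div_mul_cancel₀ _ (hden u hu)), Or.inr ⟨by linarith, ?_⟩⟩
          have : u < r := by
            refine lt_of_le_of_ne hu.2 fun hur => ?_
            rw [hur] at hfu
            exact hD1.ne' hfu
          linarith

theorem BalancedChord.advanceSpec (hP : IsConvexNGon P) (h : BalancedChord P A ib sb ic sc)
    (he : 0 < cross (edge P A) (edgePt P ic sc - edgePt P ib sb)) :
    ∃ sb' sc', (advance (vert P A) (edge P A) (edgePt P ib sb) (edge P ib) (edgePt P ic sc)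
        (edge P ic) ⟨ib, sb, ic, sc⟩).val = ⟨ib, sb', ic, sc'⟩ ∧
      AdvanceSpec P A ib sb ic sc sb' sc' := by
  rcases lt_trichotomy (balance (vert P A) (edgePt P ib sb) (edgePt P ic sc) (edge P ib)
    (edge P ic)) 0 with hF | hF | hF
  · exact h.advanceSpec_of_neg hP he hF
  · exact h.advanceSpec_of_eq_zero hP he hF
  · exact h.advanceSpec_of_pos hP he hF

end Polygon

section Polygon

variable {n : ℕ} [NeZero n] {P : Fin n → Pt}

/-! ### The iterations of the main loop -/

/-- The first end point of the chord of the state. -/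
def State.b (P : Fin n → Pt) (s : State n) : Pt := edgePt P s.chord.ib s.chord.sb

/-- The second end point of the chord of the state. -/
def State.c (P : Fin n → Pt) (s : State n) : Pt := edgePt P s.chord.ic s.chord.sc

/-- The area of the triangle of the state. -/
def State.area (P : Fin n → Pt) (s : State n) : ℝ :=
  |cross (s.c P - s.b P) (vert P s.ia - s.b P)| / 2

/-- The triangle of the state is recorded. -/
def State.Recorded (P : Fin n → Pt) (s : State n) : Prop :=
  s.areaMax < s.area P ∧ normParam s.chord.sb = 0 ∧ normParam s.chord.sc = 0

open Classical in
/-- The apex after it has possibly advanced. -/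
def State.nextIa (P : Fin n → Pt) (s : State n) : ℤ :=
  if cross (edge P s.ia) (s.c P - s.b P) = 0 then s.ia + 1 else s.ia

open Classical in
/-- The next state of the main loop. -/
def State.next (P : Fin n → Pt) (s : State n) : State n where
  ia := s.nextIa P
  chord := (advance (vert P (s.nextIa P)) (edge P (s.nextIa P)) (s.b P)
    (edge P (normEdge s.chord.ib s.chord.sb)) (s.c P) (edge P (normEdge s.chord.ic s.chord.sc))
    ⟨normEdge s.chord.ib s.chord.sb, normParam s.chord.sb, normEdge s.chord.ic s.chord.sc,
      normParam s.chord.sc⟩).val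
  areaMax := if s.Recorded P then s.area P else s.areaMax
  best := if s.Recorded P then some (index n s.ia, index n (normEdge s.chord.ib s.chord.sb),
    index n (normEdge s.chord.ic s.chord.sc)) else s.best

theorem val_between_vertex (P : Fin n → Pt) (i : ℤ) (s : ℝ) :
    (between (vert P i) (vert P (i + 1)) s).val = edgePt P i s := val_between _ _ _

theorem val_normalize (i : ℤ) (s : ℝ) :
    (do
      if (← Timed.eq (reg s) 1) then do let j ← reg i + 1; pure (j, 0)
      else pure (i, s) : Timed (ℤ × ℝ)).val = (normEdge i s, normParam s) := by
  simp only [val_bind, val_eq, val_reg, val_ofNat, test_eq_true_iff, val_ite, val_pure, val_add,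
    normEdge, normParam]
  split_ifs <;> rfl

theorem mainStep_val_of_le {ia₀ : ℤ} {s : State n} (h : s.ia ≤ ia₀ + n) :
    (mainStep P ia₀ s).val = Sum.inl (s.next P) := by
  have e1 := val_normalize s.chord.ib s.chord.sb
  have e2 := val_normalize s.chord.ic s.chord.sc
  unfold mainStep
  rw [val_bind]
  simp only [val_le, val_reg, val_add, h, test_true, if_true]
  rw [val_bind, e1, val_bind, e2]
  simp only [val_bind, val_reg, val_add, val_ofNat, val_vertex, val_between_vertex, val_vec,
    val_area, val_lt, val_eq, val_ite, val_pure, val_wedge, edgePt_norm, Bool.and_eq_true,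
    test_eq_true_iff]
  by_cases h1 : cross (vert P (s.ia + 1) - vert P s.ia)
    (edgePt P s.chord.ic s.chord.sc - edgePt P s.chord.ib s.chord.sb) = 0 <;>
  by_cases h2 : (s.areaMax < |cross (edgePt P s.chord.ic s.chord.sc -
    edgePt P s.chord.ib s.chord.sb) (vert P s.ia - edgePt P s.chord.ib s.chord.sb)| / 2 ∧
    normParam s.chord.sb = 0) ∧ normParam s.chord.sc = 0 <;>
  simp [h1, h2, State.next, State.nextIa, State.Recorded, State.area, State.b, State.c, edge,
    ← and_assoc]

theorem mainStep_val_of_gt {ia₀ : ℤ} {s : State n} (h : ia₀ + n < s.ia) :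
    (mainStep P ia₀ s).val = Sum.inr s.best := by
  unfold mainStep
  simp [h]

/-- The apex advances when the next edge is parallel to the chord. -/
theorem exists_neg_smul_of_parallel {a b c e : Pt} (he0 : e ≠ 0) (hS : 0 < cross (c - b) (a - b))
    (he : cross e (c - b) = 0) (hb : 0 ≤ cross e (b - a)) :
    ∃ r : ℝ, r < 0 ∧ e = r • (c - b) := by
  have h1 : 0 ≤ cross (-e) (a - b) := by
    have : cross (-e) (a - b) = cross e (b - a) := by
      simp only [cross, Prod.fst_sub, Prod.snd_sub, Prod.fst_neg, Prod.snd_neg]; ring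
    rwa [this]
  obtain ⟨r, hr, h2⟩ := exists_pos_smul_of_cross_eq_zero (v := -e) (neg_ne_zero.2 he0)
    (by rw [← neg_one_smul ℝ, cross_smul_left, he, mul_zero]) h1 hS
  exact ⟨-r, by linarith, by rw [neg_smul, ← h2, neg_neg]⟩

theorem BalancedChord.exists_neg_smul {A ib ic : ℤ} {sb sc : ℝ} (hP : IsConvexNGon P)
    (h : BalancedChord P A ib sb ic sc)
    (he : cross (edge P A) (edgePt P ic sc - edgePt P ib sb) = 0) :
    ∃ r : ℝ, r < 0 ∧ edge P A = r • (edgePt P ic sc - edgePt P ib sb) :=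
  exists_neg_smul_of_parallel (edge_ne_zero hP A) h.area_pos he
    (inside_edgePt hP ib h.sb_nonneg h.sb_lt.le A)

theorem BalancedChord.area_next_apex {A ib ic : ℤ} {sb sc : ℝ}
    (he : cross (edge P A) (edgePt P ic sc - edgePt P ib sb) = 0) :
    cross (edgePt P ic sc - edgePt P ib sb) (vert P A - edgePt P ib sb) =
      cross (edgePt P ic sc - edgePt P ib sb) (vert P (A + 1) - edgePt P ib sb) := by
  have e1 : vert P (A + 1) - edgePt P ib sb = (vert P A - edgePt P ib sb) + edge P A := by
    simp only [edge]; abel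
  rw [e1, cross_add_right, cross_swap _ (edge P A), he, neg_zero, add_zero]

/-- The apex slides parallel to the chord, so the area, and with it every balance, is unchanged. The
following edge turns strictly, so two apex steps never occur in succession for one chord. If `ib =
A`, the chord would be parallel to its own edge through the apex and the area would be zero. -/
theorem BalancedChord.next_apex {A ib ic : ℤ} {sb sc : ℝ} (hP : IsConvexNGon P)
    (h : BalancedChord P A ib sb ic sc)
    (he : cross (edge P A) (edgePt P ic sc - edgePt P ib sb) = 0) :
    BalancedChord P (A + 1) ib sb ic sc ∧
      0 < cross (edge P (A + 1)) (edgePt P ic sc - edgePt P ib sb) := by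
  obtain ⟨r, hr, hre⟩ := h.exists_neg_smul hP he
  have hS := BalancedChord.area_next_apex he
  have hpos : 0 < cross (edge P (A + 1)) (edgePt P ic sc - edgePt P ib sb) := by
    have h1 := cross_edge_edge_pos hP A
    rw [hre, cross_smul_left, cross_swap] at h1
    nlinarith
  refine ⟨⟨?_, h.ib_lt_ic, by have := h.ic_lt; omega, h.sb_nonneg, h.sb_lt, h.sc_nonneg, h.sc_lt,
    hS ▸ h.area_pos, hpos.le, ?_, ?_⟩, hpos⟩
  · rcases eq_or_lt_of_le h.le_ib with h0 | h0
    · exfalso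
      have h1 := h.area_pos
      have e1 : vert P A - edgePt P ib sb = (-sb) • edge P A := by
        rw [← h0, edgePt, neg_smul]; abel
      rw [e1, cross_smul_right, cross_swap, he] at h1
      simp at h1
    · exact h0
  · rw [← balance_congr_apex hS]; exact h.inward
  · rw [← balance_congr_apex hS]; exact h.outward

/-! ### Triangles of maximal area -/

/-- The vertices `m, i, j` form a triangle of maximal area, in counter-clockwise order. -/
structure IsMaximal (P : Fin n → Pt) (m i j : ℤ) : Prop where
  pos : 0 < orient (vert P m) (vert P i) (vert P j)
  le : ∀ x ∈ convexHull ℝ (Set.range P), ∀ y ∈ convexHull ℝ (Set.range P),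
    ∀ z ∈ convexHull ℝ (Set.range P), orient x y z ≤ orient (vert P m) (vert P i) (vert P j)

theorem vert_mem_hull (P : Fin n → Pt) (i : ℤ) : vert P i ∈ convexHull ℝ (Set.range P) :=
  subset_convexHull ℝ _ ⟨_, rfl⟩

theorem edgePt_mem_hull (P : Fin n → Pt) (i : ℤ) {s : ℝ} (h0 : 0 ≤ s) (h1 : s ≤ 1) :
    edgePt P i s ∈ convexHull ℝ (Set.range P) := by
  rw [edgePt_eq]
  exact convex_convexHull ℝ _ (vert_mem_hull P i) (vert_mem_hull P (i + 1)) (by linarith) h0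
    (by ring)

/-- Replacing the apex by the next vertex gains nothing. Together with the same statement for the
previous vertex, this confines the direction of the side opposite to `m` between the edges at `m`.
-/
theorem IsMaximal.cross_edge_nonpos {m i j : ℤ} (h : IsMaximal P m i j) :
    cross (vert P j - vert P i) (edge P m) ≤ 0 := by
  have h1 := h.le _ (vert_mem_hull P (m + 1)) _ (vert_mem_hull P i) _ (vert_mem_hull P j)
  rw [orient_eq_cross_base, orient_eq_cross_base] at h1
  have e1 : edge P m = (vert P (m + 1) - vert P i) - (vert P m - vert P i) := by
    simp only [edge]; abel
  rw [e1, cross_sub_right]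
  linarith

theorem IsMaximal.cross_edge_pred_nonneg {m i j : ℤ} (h : IsMaximal P m i j) :
    0 ≤ cross (vert P j - vert P i) (edge P (m - 1)) := by
  have h1 := h.le _ (vert_mem_hull P (m - 1)) _ (vert_mem_hull P i) _ (vert_mem_hull P j)
  rw [orient_eq_cross_base, orient_eq_cross_base] at h1
  have e1 : edge P (m - 1) = (vert P m - vert P i) - (vert P (m - 1) - vert P i) := by
    simp only [edge, sub_add_cancel]; abel
  rw [e1, cross_sub_right]
  linarith

/-- A balanced chord that is parallel to a side of a triangle of maximal area is that side. -/
theorem IsMaximal.eq_of_parallel (hP : IsConvexNGon P) {m i j : ℤ} (hM : IsMaximal P m i j)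
    {ib ic : ℤ} {sb sc : ℝ} (h : BalancedChord P m ib sb ic sc)
    (hD : cross (vert P j - vert P i) (edgePt P ic sc - edgePt P ib sb) = 0) :
    vert P i = edgePt P ib sb ∧ vert P j = edgePt P ic sc := by
  have hpos := hM.pos
  rw [orient_eq_cross_base] at hpos
  have hd : edgePt P ic sc - edgePt P ib sb ≠ 0 := ne_zero_of_cross_ne_zero_left h.area_pos.ne'
  have hD0 : vert P j - vert P i ≠ 0 := ne_zero_of_cross_ne_zero_left hpos.ne'
  obtain ⟨k, hk⟩ := exists_smul_of_cross_eq_zero hd hD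
  have hk0 : k ≠ 0 := by
    rintro rfl
    exact hD0 (by rw [hk, zero_smul])
  -- The side and the chord point the same way because both face the apex `m`: their wedge products
  -- with the edge at `m` have compatible signs, or both are negative multiples related to that edge
  -- when it is parallel to them.
  have hkpos : 0 < k := by
    rcases eq_or_lt_of_le h.edge_nonneg with he | he
    · obtain ⟨r, hr, hre⟩ := h.exists_neg_smul hP he.symm
      have he' : cross (edge P m) (vert P j - vert P i) = 0 := by
        rw [hk, cross_smul_right, ← he, mul_zero]
      obtain ⟨r', hr', hre'⟩ := exists_neg_smul_of_parallel (edge_ne_zero hP m) hpos he'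
        (inside_vert hP i m)
      rw [hre, hk, smul_smul] at hre'
      have h1 : r = r' * k := smul_left_injective ℝ hd hre'
      by_contra hneg
      push Not at hneg
      nlinarith
    · have h1 := hM.cross_edge_nonpos
      rw [hk, cross_smul_left, cross_swap] at h1
      refine lt_of_le_of_ne ?_ hk0.symm
      by_contra hneg
      push Not at hneg
      nlinarith
  refine h.eq_of_le hP (inside_vert hP i) (inside_vert hP j) hkpos hk ?_
  have := hM.le _ (vert_mem_hull P m) _ (edgePt_mem_hull P ib h.sb_nonneg h.sb_lt.le)
    _ (edgePt_mem_hull P ic h.sc_nonneg h.sc_lt.le)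
  rwa [orient_eq_cross_base, orient_eq_cross_base] at this

theorem eq_zero_of_edgePt_eq_vert (hP : IsConvexNGon P) {i j : ℤ} {s : ℝ} (h0 : 0 ≤ s)
    (h1 : s < 1) (h : vert P j = edgePt P i s) : s = 0 := by
  rcases eq_or_lt_of_le h0 with h2 | h2
  · exact h2.symm
  · exact absurd h.symm (edgePt_ne_vert hP i j h2 h1)

/-- If the chord turns past the direction of a side of a triangle of maximal area, then it started
from this side. -/
theorem IsMaximal.eq_of_advance (hP : IsConvexNGon P) {m i j : ℤ} (hM : IsMaximal P m i j)
    {ib ic : ℤ} {sb sc sb' sc' : ℝ} (h : BalancedChord P m ib sb ic sc)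
    (hadv : AdvanceSpec P m ib sb ic sc sb' sc')
    (h0 : cross (vert P j - vert P i) (edgePt P ic sc - edgePt P ib sb) ≤ 0)
    (h1 : 0 < cross (vert P j - vert P i) (edgePt P ic sc' - edgePt P ib sb')) :
    vert P i = edgePt P ib sb ∧ vert P j = edgePt P ic sc := by
  obtain ⟨sb'', sc'', hD, ⟨rfl, rfl⟩ | ⟨hcl, hint⟩⟩ := hadv.2.2 _ h0 h1
  · exact hM.eq_of_parallel hP h hD
  · exfalso
    have h2 := hM.eq_of_parallel hP (hcl.balanced hP) (by rwa [edgePt_norm, edgePt_norm])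
    rw [edgePt_norm, edgePt_norm] at h2
    -- An intermediate chord has an end strictly inside an edge, whereas both ends of the side are
    -- vertices.
    rcases hint with ⟨h3, h4⟩ | ⟨h3, h4⟩
    · exact edgePt_ne_vert hP _ _ h3 h4 h2.1.symm
    · exact edgePt_ne_vert hP _ _ h3 h4 h2.2.symm

end Polygon

/-! ### Invariant and potential of the main loop -/

section Polygon

variable {n : ℕ} [NeZero n] {P : Fin n → Pt}

theorem vert_sub_mul (P : Fin n → Pt) (i k : ℤ) : vert P (i - k * n) = vert P i := by
  rw [← vert_add_mul P (i - k * n) k, sub_add_cancel]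

theorem edge_sub_mul (P : Fin n → Pt) (i k : ℤ) : edge P (i - k * n) = edge P i := by
  rw [← edge_add_mul P (i - k * n) k, sub_add_cancel]

theorem IsMaximal.sub_mul {m i j : ℤ} (h : IsMaximal P m i j) (k : ℤ) :
    IsMaximal P (m - k * n) i j := by
  refine ⟨?_, ?_⟩ <;> rw [vert_sub_mul]
  · exact h.pos
  · exact h.le

/-- The invariant of the main loop. The apex `s.ia` is `k` turns ahead of the chord. Once the
direction of the side of a given triangle of maximal area has been passed, a triangle at least as
large has been recorded. -/
structure MainInv (P : Fin n → Pt) (k m i j ia₀ : ℤ) (s : State n) : Prop where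
  chord : BalancedChord P (s.ia - k * n) (normEdge s.chord.ib s.chord.sb)
    (normParam s.chord.sb) (normEdge s.chord.ic s.chord.sc) (normParam s.chord.sc)
  lo : ia₀ ≤ s.ia
  hi : s.ia ≤ ia₀ + n + 1
  record : (s.best = none ∧ s.areaMax = 0) ∨
    ∃ p q r, s.best = some (p, q, r) ∧ s.areaMax = triArea (P p) (P q) (P r)
  passed : m < s.ia → orient (vert P m) (vert P i) (vert P j) / 2 ≤ s.areaMax
  turned : s.ia = m → 0 < cross (vert P j - vert P i) (s.c P - s.b P) →
    orient (vert P m) (vert P i) (vert P j) / 2 ≤ s.areaMax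

open Classical in
/-- A quantity that grows in every iteration of the main loop. -/
def State.potential (P : Fin n → Pt) (s : State n) : ℤ :=
  2 * (s.nextIa P + normEdge s.chord.ib s.chord.sb + normEdge s.chord.ic s.chord.sc) +
    if balance (vert P s.ia) (s.b P) (s.c P) (edge P (normEdge s.chord.ib s.chord.sb))
      (edge P (normEdge s.chord.ic s.chord.sc)) = 0 then 1 else 0

theorem State.areaMax_le_next (s : State n) : s.areaMax ≤ (s.next P).areaMax := by
  simp only [State.next]
  split_ifs with h
  · exact h.1.le
  · exact le_rfl

theorem State.le_areaMax_next {s : State n} {x : ℝ} (hb : normParam s.chord.sb = 0)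
    (hc : normParam s.chord.sc = 0) (hx : x = cross (s.c P - s.b P) (vert P s.ia - s.b P)) :
    x / 2 ≤ (s.next P).areaMax := by
  have h1 : x / 2 ≤ s.area P := by
    rw [hx, State.area]
    have := le_abs_self (cross (s.c P - s.b P) (vert P s.ia - s.b P))
    linarith
  simp only [State.next]
  split_ifs with h
  · exact h1
  · simp only [State.Recorded, hb, hc, and_true, not_lt] at h
    exact h1.trans h

theorem State.record_next {s : State n}
    (h : (s.best = none ∧ s.areaMax = 0) ∨
      ∃ p q r, s.best = some (p, q, r) ∧ s.areaMax = triArea (P p) (P q) (P r)) :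
    ((s.next P).best = none ∧ (s.next P).areaMax = 0) ∨
      ∃ p q r, (s.next P).best = some (p, q, r) ∧
        (s.next P).areaMax = triArea (P p) (P q) (P r) := by
  simp only [State.next]
  split_ifs with hr
  · refine Or.inr ⟨_, _, _, rfl, ?_⟩
    have hb : s.b P = vert P (normEdge s.chord.ib s.chord.sb) := by
      rw [State.b, ← edgePt_norm, hr.2.1, edgePt_zero]
    have hc : s.c P = vert P (normEdge s.chord.ic s.chord.sc) := by
      rw [State.c, ← edgePt_norm, hr.2.2, edgePt_zero]
    rw [State.area, hb, hc, ← orient_eq_cross_base]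
    rfl
  · exact h

/-- While the apex is `m`, the wedge of the side `i j` with the chord starts nonpositive and is
nonnegative when the apex leaves. Wherever it vanishes the chord is the side, and the iteration
starting there records it. -/
theorem MainInv.next (hP : IsConvexNGon P) {k m i j ia₀ : ℤ} {s : State n}
    (hM : IsMaximal P m i j) (h : MainInv P k m i j ia₀ s) (hia : s.ia ≤ ia₀ + n) :
    MainInv P k m i j ia₀ (s.next P) ∧ s.potential P < (s.next P).potential P := by
  classical
  have hB := h.chord
  have hbn : edgePt P (normEdge s.chord.ib s.chord.sb) (normParam s.chord.sb) = s.b P :=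
    edgePt_norm _ _ _
  have hcn : edgePt P (normEdge s.chord.ic s.chord.sc) (normParam s.chord.sc) = s.c P :=
    edgePt_norm _ _ _
  have hlo := h.lo
  have hmono := s.areaMax_le_next (P := P)
  have hnext : BalancedChord P (s.nextIa P - k * n) (normEdge s.chord.ib s.chord.sb)
      (normParam s.chord.sb) (normEdge s.chord.ic s.chord.sc) (normParam s.chord.sc) ∧
      0 < cross (edge P (s.nextIa P - k * n)) (s.c P - s.b P) ∧
      cross (s.c P - s.b P) (vert P (s.nextIa P) - s.b P) =
        cross (s.c P - s.b P) (vert P s.ia - s.b P) := by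
    unfold State.nextIa
    split_ifs with he
    · have he' : cross (edge P (s.ia - k * n)) (edgePt P (normEdge s.chord.ic s.chord.sc)
          (normParam s.chord.sc) - edgePt P (normEdge s.chord.ib s.chord.sb)
          (normParam s.chord.sb)) = 0 := by rw [edge_sub_mul, hbn, hcn]; exact he
      have h1 := hB.next_apex hP he'
      have h2 := BalancedChord.area_next_apex he'
      rw [hbn, hcn] at h1 h2
      rw [show s.ia - k * n + 1 = s.ia + 1 - k * n by ring] at h1 h2
      rw [vert_sub_mul, vert_sub_mul] at h2
      exact ⟨h1.1, h1.2, h2.symm⟩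
    · refine ⟨hB, lt_of_le_of_ne ?_ ?_, rfl⟩
      · rw [← hbn, ← hcn]; exact hB.edge_nonneg
      · rw [edge_sub_mul]; exact fun h0 => he h0.symm
  obtain ⟨hB', hpos, harea⟩ := hnext
  obtain ⟨sb', sc', hval, hspec⟩ := hB'.advanceSpec hP (by rw [hbn, hcn]; exact hpos)
  rw [hbn, hcn, vert_sub_mul, edge_sub_mul] at hval
  have hnia : (s.next P).ia = s.nextIa P := rfl
  have hnchord : (s.next P).chord = ⟨normEdge s.chord.ib s.chord.sb, sb',
    normEdge s.chord.ic s.chord.sc, sc'⟩ := hval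
  have hnb : (s.next P).b P = edgePt P (normEdge s.chord.ib s.chord.sb) sb' := by
    rw [State.b, hnchord]
  have hnc : (s.next P).c P = edgePt P (normEdge s.chord.ic s.chord.sc) sc' := by
    rw [State.c, hnchord]
  have hle : s.ia ≤ s.nextIa P ∧ s.nextIa P ≤ s.ia + 1 := by
    unfold State.nextIa; split_ifs <;> omega
  -- A chord equal to the side has both parameters zero, so it passes the recording test. Recording
  -- precedes the step of the apex; `a'` covers both apices, which give equal areas.
  have hhit : ∀ a', cross (s.c P - s.b P) (vert P a' - s.b P) =
        cross (s.c P - s.b P) (vert P s.ia - s.b P) → vert P m = vert P a' →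
      vert P i = s.b P → vert P j = s.c P →
      orient (vert P m) (vert P i) (vert P j) / 2 ≤ (s.next P).areaMax := by
    intro a' ha hm hi hj
    refine State.le_areaMax_next
      (eq_zero_of_edgePt_eq_vert hP hB.sb_nonneg hB.sb_lt (by rw [hbn]; exact hi))
      (eq_zero_of_edgePt_eq_vert hP hB.sc_nonneg hB.sc_lt (by rw [hcn]; exact hj)) ?_
    rw [orient_eq_cross_base, hm, hi, hj, ha]
  refine ⟨⟨?_, by rw [hnia]; omega, by rw [hnia]; omega, State.record_next h.record, ?_, ?_⟩, ?_⟩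
  · rw [hnia, hnchord]; exact hspec.1.balanced hP
  · rw [hnia]
    intro hlt
    rcases lt_or_ge m s.ia with h1 | h1
    · exact (h.passed h1).trans hmono
    -- The apex is just leaving `m`. The edge at `m` is a negative multiple of the chord, so
    -- maximality makes the wedge nonnegative: the direction has been passed or is attained now.
    · have hm : s.ia = m := by omega
      have he : cross (edge P s.ia) (s.c P - s.b P) = 0 := by
        by_contra he
        simp only [State.nextIa, if_neg he] at hlt
        omega
      rcases le_or_gt (cross (vert P j - vert P i) (s.c P - s.b P)) 0 with h2 | h2
      · obtain ⟨r, hr, hre⟩ := hB.exists_neg_smul hP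
          (by rw [edge_sub_mul, hbn, hcn]; exact he)
        rw [hbn, hcn, edge_sub_mul, hm] at hre
        have h3 := hM.cross_edge_nonpos
        rw [hre, cross_smul_right] at h3
        have h4 : cross (vert P j - vert P i) (s.c P - s.b P) = 0 := by nlinarith
        rw [hm] at hB
        have h5 := (hM.sub_mul k).eq_of_parallel hP hB (by rw [hbn, hcn]; exact h4)
        rw [hbn, hcn] at h5
        exact hhit s.ia rfl (by rw [hm]) h5.1 h5.2
      · exact (h.turned hm h2).trans hmono
  · rw [hnia, hnb, hnc]
    intro hm h1
    have hcase : cross (vert P j - vert P i) (s.c P - s.b P) ≤ 0 →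
        orient (vert P m) (vert P i) (vert P j) / 2 ≤ (s.next P).areaMax := by
      intro h2
      rw [hm] at hB' hspec
      have h5 := (hM.sub_mul k).eq_of_advance hP hB' hspec (by rw [hbn, hcn]; exact h2) h1
      rw [hbn, hcn] at h5
      exact hhit _ harea (by rw [hm]) h5.1 h5.2
    rcases le_or_gt (cross (vert P j - vert P i) (s.c P - s.b P)) 0 with h2 | h2
    · exact hcase h2
    · rcases eq_or_lt_of_le hle.1 with h3 | h3
      · exact (h.turned (h3.trans hm) h2).trans hmono
      -- The apex is just arriving at `m`. The edge `m - 1` is a negative multiple of the chord, and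
      -- maximality then makes the wedge nonpositive.
      · exfalso
        have hm' : s.ia = m - 1 := by omega
        have he : cross (edge P s.ia) (s.c P - s.b P) = 0 := by
          by_contra he
          simp only [State.nextIa, if_neg he] at h3
          omega
        obtain ⟨r, hr, hre⟩ := hB.exists_neg_smul hP
          (by rw [edge_sub_mul, hbn, hcn]; exact he)
        rw [hbn, hcn, edge_sub_mul, hm'] at hre
        have h3 := hM.cross_edge_pred_nonneg
        rw [hre, cross_smul_right] at h3
        nlinarith
  -- An index event adds 2 and can cost the balance bonus of 1; otherwise the balance newly vanishes
  -- and the bonus is gained. Using `nextIa` counts a parallel event as soon as it occurs.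
  · have hle' : s.nextIa P ≤ (s.next P).nextIa P := by
      rw [← hnia]
      generalize s.next P = s'
      unfold State.nextIa
      split_ifs <;> omega
    have hbal : ∀ v w, balance (vert P (s.nextIa P)) (s.b P) (s.c P) v w =
        balance (vert P s.ia) (s.b P) (s.c P) v w := fun v w => balance_congr_apex harea v w
    have hlb := le_normEdge (normEdge s.chord.ib s.chord.sb) sb'
    have hlc := le_normEdge (normEdge s.chord.ic s.chord.sc) sc'
    obtain ⟨-, hev, -⟩ := hspec
    rw [vert_sub_mul, edge_sub_mul, hbn, hcn, hbal, ← hnb, ← hnc] at hev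
    simp only [State.potential, hnia, hnchord]
    by_cases hb1 : sb' = 1
    · have : normEdge (normEdge s.chord.ib s.chord.sb) sb' =
        normEdge s.chord.ib s.chord.sb + 1 := by simp [normEdge, hb1]
      split_ifs <;> omega
    by_cases hc1 : sc' = 1
    · have : normEdge (normEdge s.chord.ic s.chord.sc) sc' =
        normEdge s.chord.ic s.chord.sc + 1 := by simp [normEdge, hc1]
      split_ifs <;> omega
    rcases hev with hev | hev | hev | ⟨hev1, hev2⟩
    · exact absurd hev hb1
    · exact absurd hev hc1
    · have : (s.next P).nextIa P = s.nextIa P + 1 := by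
        rw [State.nextIa, if_pos (by rw [hnia]; exact hev), hnia]
      split_ifs <;> omega
    · have h1 : ∀ x, normEdge x sb' = x := fun x => by simp [normEdge, hb1]
      have h2 : ∀ x, normEdge x sc' = x := fun x => by simp [normEdge, hc1]
      rw [h1, h2, if_neg hev1, if_pos hev2]
      omega

theorem MainInv.potential_bounds {k m i j ia₀ : ℤ} {s : State n}
    (h : MainInv P k m i j ia₀ s) (hk0 : 0 ≤ k) (hk1 : k ≤ 1) (h0 : 0 ≤ ia₀) (h1 : ia₀ < n) :
    -4 * (n : ℤ) ≤ s.potential P ∧ s.potential P < 16 * n + 4 := by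
  have hB := h.chord
  have h2 := hB.le_ib
  have h3 := hB.ib_lt_ic
  have h4 := hB.ic_lt
  have h5 := h.lo
  have h6 := h.hi
  have hle : s.ia ≤ s.nextIa P ∧ s.nextIa P ≤ s.ia + 1 := by
    unfold State.nextIa; split_ifs <;> omega
  have h7 : 0 ≤ k * (n : ℤ) := by positivity
  have h8 : k * (n : ℤ) ≤ n := by nlinarith
  unfold State.potential
  split_ifs <;> constructor <;> omega

end Polygon

/-! ### Termination of the main loop -/

/-- A loop with an invariant and a decreasing measure is left after a bounded number of
operations. -/
theorem Loop.exists_of_measure {σ τ : Type} {body : σ → Timed (σ ⊕ τ)} (I : σ → Prop)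
    (R : τ → Prop) (μ : σ → ℕ) (K : ℕ) (hK : ∀ s, (body s).ops ≤ K)
    (hstep : ∀ s, I s → (∃ r, (body s).val = Sum.inr r ∧ R r) ∨
      ∃ s', (body s).val = Sum.inl s' ∧ I s' ∧ μ s' < μ s) :
    ∀ s, I s → ∃ r k t, Loop body s r k t ∧ R r ∧ k ≤ μ s + 1 ∧ t ≤ (K + 1) * (μ s + 1) := by
  have key : ∀ N s, μ s ≤ N → I s → ∃ r k t, Loop body s r k t ∧ R r ∧ k ≤ μ s + 1 ∧
      t ≤ (K + 1) * (μ s + 1) := by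
    intro N
    induction N with
    | zero =>
      intro s hN hs
      rcases hstep s hs with ⟨r, hr, hR⟩ | ⟨s', -, -, hlt⟩
      · have := hK s
        exact ⟨r, 1, _, Loop.leave s r hr, hR, by omega, by nlinarith⟩
      · omega
    | succ N ih =>
      intro s hN hs
      have hKs := hK s
      rcases hstep s hs with ⟨r, hr, hR⟩ | ⟨s', hs', hI, hlt⟩
      · exact ⟨r, 1, _, Loop.leave s r hr, hR, by omega, by nlinarith⟩
      · obtain ⟨r, k, t, hL, hR, hk, ht⟩ := ih s' (by omega) hI
        refine ⟨r, k + 1, _, Loop.again s s' r k t hs' hL, hR, by omega, ?_⟩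
        have : (K + 1) * (μ s' + 1) ≤ (K + 1) * μ s := Nat.mul_le_mul_left _ hlt
        rw [Nat.mul_add (K + 1) (μ s) 1]
        omega
  exact fun s hs => key (μ s) s le_rfl hs

section Polygon

variable {n : ℕ} [NeZero n] {P : Fin n → Pt}

/-- On exit the apex index exceeds `ia₀ + n ≥ m`, so `passed` applies. Something has been recorded,
since `areaMax = 0` is less than the maximal area. -/
theorem exists_mainLoop (hP : IsConvexNGon P) {k m i j ia₀ : ℤ} {s : State n}
    (hM : IsMaximal P m i j) (hm : m ≤ ia₀ + n) (hk0 : 0 ≤ k) (hk1 : k ≤ 1) (h0 : 0 ≤ ia₀)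
    (h1 : ia₀ < n) (hs : MainInv P k m i j ia₀ s) :
    ∃ p q r N t, Loop (mainStep P ia₀) s (some (p, q, r)) N t ∧
      orient (vert P m) (vert P i) (vert P j) / 2 ≤ triArea (P p) (P q) (P r) ∧
      N ≤ 100 * n ∧ t ≤ 1000 * 41 * 100 * n := by
  have hn := hP.1
  obtain ⟨o, N, t, hL, ⟨p, q, r, rfl, hR⟩, hN, ht⟩ := Loop.exists_of_measure
    (body := mainStep P ia₀) (MainInv P k m i j ia₀)
    (fun o => ∃ p q r, o = some (p, q, r) ∧
      orient (vert P m) (vert P i) (vert P j) / 2 ≤ triArea (P p) (P q) (P r))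
    (fun s => (16 * (n : ℤ) + 4 - s.potential P).toNat) (1000 * 40) (ops_mainStep P ia₀) (by
      intro s hs
      rcases le_or_gt s.ia (ia₀ + n) with h | h
      · right
        have h2 := hs.next hP hM h
        have h3 := hs.potential_bounds hk0 hk1 h0 h1
        exact ⟨_, mainStep_val_of_le h, h2.1, by omega⟩
      · left
        refine ⟨_, mainStep_val_of_gt h, ?_⟩
        have h2 := hs.passed (by omega)
        rcases hs.record with ⟨-, h3⟩ | ⟨p, q, r, h3, h4⟩
        · have := hM.pos
          linarith
        · exact ⟨p, q, r, h3, h4 ▸ h2⟩) s hs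
  have h3 := hs.potential_bounds hk0 hk1 h0 h1
  -- The lower bound `-4 n` of the potential gives `20 n + 5`, and `n ≥ 3` absorbs the constant.
  have h4 : (16 * (n : ℤ) + 4 - s.potential P).toNat + 1 ≤ 23 * n := by omega
  refine ⟨p, q, r, N, t, hL, hR, by omega, ?_⟩
  have := Nat.mul_le_mul_left (1000 * 40 + 1) h4
  omega

end Polygon

/-! ### The procedure for anchored triangles -/

open Classical in
/-- The result of an iteration of the procedure for anchored triangles, for the tangents `v` and
`w` at the end points of the chord `s`. -/
def anchoredNext (v w : Pt) (tq : ℝ) (s : Chord) : Chord ⊕ Chord :=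
  if v.1 = 0 then Sum.inl ⟨s.ib - 1, 1, s.ic, s.sc⟩
  else if w.1 = 0 then Sum.inl ⟨s.ib, s.sb, s.ic + 1, 0⟩
  else if cross v w ≤ 0 then Sum.inr s
  else if -tq / v.1 ≤ 0 ∨ tq / w.1 ≤ 0 then Sum.inr s
  else if -tq / v.1 < s.sb ∧ tq / w.1 < 1 - s.sc then
    Sum.inr ⟨s.ib, s.sb - -tq / v.1, s.ic, s.sc + tq / w.1⟩
  else if (1 - s.sc) * (-tq / v.1) < s.sb * (tq / w.1) then
    Sum.inl ⟨s.ib, s.sb - (1 - s.sc) * (-tq / v.1) / (tq / w.1), s.ic + 1, 0⟩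
  else Sum.inl ⟨s.ib - 1, 1, s.ic, s.sc + s.sb * (tq / w.1) / (-tq / v.1)⟩

section Polygon

variable {n : ℕ} [NeZero n] {P : Fin n → Pt}

/-- The adjustment for `s_b = 0` never fires: the loop represents `b` at a vertex with parameter 1
on the preceding edge, and the invariant keeps the parameter positive. -/
theorem anchoredStep_val (P : Fin n → Pt) (ia : ℤ) {s : Chord} (hsb : s.sb ≠ 0) :
    (anchoredStep P (1, 0) ia s).val =
      anchoredNext (edge P s.ib) (edge P (normEdge s.ic s.sc))
        (calculateTq (vert P ia) (edgePt P s.ib s.sb) (edge P s.ib) (edgePt P s.ic s.sc)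
          (edge P (normEdge s.ic s.sc)) (1, 0)).val
        ⟨s.ib, s.sb, normEdge s.ic s.sc, normParam s.sc⟩ := by
  classical
  have e1 : (do
      if (← Timed.eq (reg s.sb) 0) then do let i ← reg s.ib - 1; pure (i, 1)
      else pure (s.ib, s.sb) : Timed (ℤ × ℝ)).val = (s.ib, s.sb) := by simp [hsb]
  have e2 := val_normalize s.ic s.sc
  unfold anchoredStep
  rw [val_bind, e1, val_bind, e2]
  simp only [val_bind, val_reg, val_add, val_sub, val_ofNat, val_vertex, val_between_vertex,
    val_vec, val_lt, val_le, val_eq, val_ite, val_pure, val_wedge, val_dot, val_div, val_mul,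
    val_neg, edgePt_norm, Bool.and_eq_true, Bool.or_eq_true, test_eq_true_iff]
  rfl

/-- The invariant of the procedure for anchored triangles: the chord is vertical, and it is either
the rightmost vertex in its initial representation, or the triangle with apex `A` grows when the
chord moves to the left. -/
structure AnchoredInv (P : Fin n → Pt) (A ib : ℤ) (sb : ℝ) (ic : ℤ) (sc : ℝ) : Prop where
  le_ib : A ≤ ib
  ib_lt_ic : ib < ic
  ic_lt : ic < A + n
  sb_pos : 0 < sb
  sb_le : sb ≤ 1
  sc_nonneg : 0 ≤ sc
  sc_le : sc ≤ 1
  level : (edgePt P ib sb).1 = (edgePt P ic sc).1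
  lt_level : (vert P A).1 < (edgePt P ib sb).1
  apart : ((edgePt P ib sb).2 < (edgePt P ic sc).2 ∧
      0 ≤ balance (vert P A) (edgePt P ib sb) (edgePt P ic sc) (edge P (normEdge ib sb))
        (tangentBefore P ic sc)) ∨
    (ib + 1 = ic ∧ sb = 1 ∧ sc = 0 ∧ 0 ≤ (edge P ib).1 ∧ (edge P ic).1 ≤ 0)

variable {A ib ic : ℤ} {sb sc : ℝ}

theorem ne_of_vert_lt {x : Pt} (h : (vert P A).1 < x.1) (hi : x = vert P ib) : ib ≠ A := by
  rintro rfl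
  rw [hi] at h
  exact lt_irrefl _ h

theorem AnchoredInv.norm (h : AnchoredInv P A ib sb ic sc) :
    AnchoredInv P A ib sb (normEdge ic sc) (normParam sc) where
  le_ib := h.le_ib
  ib_lt_ic := h.ib_lt_ic.trans_le (le_normEdge _ _)
  ic_lt := by
    have h1 := h.ic_lt
    unfold normEdge
    split_ifs with hc
    · refine lt_of_le_of_ne (by omega) fun h2 => ?_
      have h3 := h.lt_level
      rw [h.level, hc, edgePt_one, h2, vert_add_period] at h3
      exact lt_irrefl _ h3
    · exact h1
  sb_pos := h.sb_pos
  sb_le := h.sb_le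
  sc_nonneg := normParam_nonneg h.sc_nonneg
  sc_le := (normParam_lt h.sc_le).le
  level := by rw [edgePt_norm]; exact h.level
  lt_level := h.lt_level
  apart := by
    rw [edgePt_norm, tangentBefore_norm]
    rcases h.apart with h1 | h1
    · exact Or.inl h1
    · obtain ⟨h1, h2, rfl, h4⟩ := h1
      exact Or.inr ⟨by simpa [normEdge] using h1, h2, by simp [normParam],
        by simpa [normEdge] using h4⟩

theorem cross_of_fst_eq {b c : Pt} (h : b.1 = c.1) (x : Pt) :
    cross x (c - b) = x.1 * (c.2 - b.2) := by
  simp only [cross, Prod.fst_sub, Prod.snd_sub, h]; ring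

/-- The balance of a vertical chord. -/
theorem balance_of_fst_eq {a b c : Pt} (h : b.1 = c.1) (v w : Pt) :
    balance a b c v w = (c.2 - b.2) *
      ((c.2 - b.2) * v.1 * w.1 + cross v w * (b.1 - a.1)) := by
  simp only [balance, cross, Prod.fst_sub, Prod.snd_sub, h]; ring

theorem AnchoredInv.left_nonneg (hP : IsConvexNGon P) (h : AnchoredInv P A ib sb ic sc) :
    0 ≤ (edge P ib).1 := by
  rcases h.apart with ⟨h1, -⟩ | h1
  · have h2 := (inside_edgePt hP ic h.sc_nonneg h.sc_le).edgePt_nonneg ib sb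
    rw [cross_of_fst_eq h.level] at h2
    by_contra h3
    nlinarith
  · exact h1.2.2.2.1

theorem AnchoredInv.right_nonpos (hP : IsConvexNGon P) (h : AnchoredInv P A ib sb ic sc) :
    (edge P ic).1 ≤ 0 := by
  rcases h.apart with ⟨h1, -⟩ | h1
  · have h2 := (inside_edgePt hP ib h.sb_pos.le h.sb_le).edgePt_nonneg ic sc
    rw [cross_of_fst_eq h.level.symm] at h2
    by_contra h3
    nlinarith
  · exact h1.2.2.2.2

theorem AnchoredInv.snd_le (h : AnchoredInv P A ib sb ic sc) :
    (edgePt P ib sb).2 ≤ (edgePt P ic sc).2 := by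
  rcases h.apart with ⟨h1, -⟩ | h1
  · exact h1.le
  · obtain ⟨h1, rfl, rfl, -⟩ := h1
    rw [edgePt_one, edgePt_zero, h1]

/-- A vertical edge at `b` points upwards because the apex is to its left, so replacing `b` by the
start of the edge lengthens the vertical chord at the same level. -/
theorem AnchoredInv.next_of_left_eq_zero (hP : IsConvexNGon P) (h : AnchoredInv P A ib sb ic sc)
    (h0 : (edge P ib).1 = 0) : AnchoredInv P A (ib - 1) 1 ic sc := by
  have hb : edgePt P (ib - 1) 1 = vert P ib := by rw [edgePt_one, sub_add_cancel]
  have hb1 : (edgePt P ib sb).1 = (vert P ib).1 := by simp [edgePt, h0]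
  have hb2 : (edgePt P ib sb).2 = (vert P ib).2 + sb * (edge P ib).2 := by simp [edgePt]
  have hlt := h.lt_level
  have hle := h.le_ib
  have hsb := h.sb_pos
  rw [hb1] at hlt
  have hne := ne_of_vert_lt hlt rfl
  have hv : 0 < (edge P ib).2 := by
    have h1 := inside_vert hP A ib
    have h2 : (edge P ib).2 ≠ 0 := fun h2 => edge_ne_zero hP ib (Prod.ext h0 h2)
    simp only [cross, h0, zero_mul, zero_sub, Prod.fst_sub] at h1
    by_contra h3
    have : (edge P ib).2 < 0 := lt_of_le_of_ne (not_lt.1 h3) h2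
    nlinarith
  have hlt2 : (vert P ib).2 < (edgePt P ic sc).2 := by
    have h1 := h.snd_le
    rw [hb2] at h1
    nlinarith
  have hlev : (vert P ib).1 = (edgePt P ic sc).1 := by rw [← hb1]; exact h.level
  have hiblt := h.ib_lt_ic
  refine ⟨by omega, by omega, h.ic_lt, one_pos, le_rfl, h.sc_nonneg, h.sc_le, ?_, ?_, Or.inl ⟨?_, ?_⟩⟩
  · rw [hb]; exact hlev
  · rw [hb]; exact hlt
  · rw [hb]; exact hlt2
  -- The forward edge is still the vertical one, so the balance reduces to a product of nonnegative
  -- factors, the tangent before `c` pointing to the left or vertically.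
  · rw [hb, balance_of_fst_eq hlev, normEdge, if_pos rfl, sub_add_cancel, h0]
    have h1 := (inside_vert hP ib).tangentBefore_nonneg ic sc
    rw [cross_of_fst_eq hlev.symm] at h1
    have h2 : (tangentBefore P ic sc).1 ≤ 0 := by
      by_contra h3
      nlinarith
    simp only [cross, h0]
    have h3 := mul_nonneg hv.le (neg_nonneg.2 h2)
    have h4 := mul_nonneg h3 (sub_nonneg.2 hlt.le)
    have h5 := mul_nonneg (sub_nonneg.2 hlt2.le) h4
    linarith

theorem AnchoredInv.next_of_right_eq_zero (hP : IsConvexNGon P) (h : AnchoredInv P A ib sb ic sc)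
    (hsc : sc < 1) (h0 : (edge P ic).1 = 0) : AnchoredInv P A ib sb (ic + 1) 0 := by
  have hc : edgePt P (ic + 1) 0 = edgePt P ic 1 := by rw [edgePt_one, edgePt_zero]
  have hc1 : (edgePt P ic 1).1 = (edgePt P ic sc).1 := by simp [edgePt, h0]
  have hc2 : (edgePt P ic 1).2 = (edgePt P ic sc).2 + (1 - sc) * (edge P ic).2 := by
    simp [edgePt]; ring
  have hlt := h.lt_level
  have hle := h.ic_lt
  have hlev : (edgePt P ib sb).1 = (edgePt P ic 1).1 := by rw [hc1]; exact h.level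
  have hne : ic + 1 ≠ A + n := by
    intro h1
    rw [hlev, edgePt_one, h1, vert_add_period] at hlt
    exact lt_irrefl _ hlt
  have hw : 0 < (edge P ic).2 := by
    have h1 := (inside_vert hP A).edgePt_nonneg ic sc
    have h2 : (edge P ic).2 ≠ 0 := fun h2 => edge_ne_zero hP ic (Prod.ext h0 h2)
    simp only [cross, h0, zero_mul, zero_sub, Prod.fst_sub, ← h.level] at h1
    by_contra h3
    have : (edge P ic).2 < 0 := lt_of_le_of_ne (not_lt.1 h3) h2
    nlinarith
  have hlt2 : (edgePt P ib sb).2 < (edgePt P ic 1).2 := by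
    have h1 := h.snd_le
    rw [hc2]
    nlinarith [mul_pos (sub_pos.2 hsc) hw]
  have hiblt := h.ib_lt_ic
  refine ⟨h.le_ib, by omega, by omega, h.sb_pos, h.sb_le, le_rfl, zero_le_one, ?_, hlt,
    Or.inl ⟨?_, ?_⟩⟩
  · rw [hc]; exact hlev
  · rw [hc]; exact hlt2
  · rw [hc, balance_of_fst_eq hlev, tangentBefore, if_pos rfl, add_sub_cancel_right, h0]
    have h1 := cross_edge_norm_edgePt_nonneg hP ib ic sb zero_le_one le_rfl
    rw [cross_of_fst_eq hlev] at h1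
    have h2 : 0 ≤ (edge P (normEdge ib sb)).1 := by
      by_contra h3
      nlinarith
    simp only [cross, h0]
    have h3 := mul_nonneg h2 hw.le
    have h4 := mul_nonneg h3 (sub_nonneg.2 hlt.le)
    have h5 := mul_nonneg (sub_nonneg.2 hlt2.le) h4
    linarith

/-- The triangle found by the procedure has a balanced chord. -/
theorem AnchoredInv.balanced (hA : ∀ i, (vert P A).1 ≤ (vert P i).1)
    (h : AnchoredInv P A ib sb ic sc) (hsc : sc < 1) (hw : (edge P ic).1 < 0)
    (hlt : (edgePt P ib sb).2 < (edgePt P ic sc).2)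
    (hF : (((edgePt P ic sc).2 - (edgePt P ib sb).2) * (edge P ib).1 * (edge P ic).1 +
      cross (edge P ib) (edge P ic) * ((edgePt P ib sb).1 - (vert P A).1)) ≤ 0) :
    BalancedChord P A (normEdge ib sb) (normParam sb) ic sc where
  le_ib := h.le_ib.trans (le_normEdge _ _)
  ib_lt_ic := by
    have h1 := h.ib_lt_ic
    unfold normEdge
    split_ifs with hb
    · refine lt_of_le_of_ne (by omega) fun h2 => ?_
      have h3 := h.level
      rw [hb, edgePt_one, h2] at h3 hlt
      have h4 : sc ≠ 0 := by
        rintro rfl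
        rw [edgePt_zero] at hlt
        exact lt_irrefl _ hlt
      simp only [edgePt, Prod.fst_add, Prod.smul_fst, smul_eq_mul, left_eq_add, mul_eq_zero] at h3
      rcases h3 with h3 | h3
      · exact h4 h3
      · exact hw.ne h3
    · exact h1
  ic_lt := h.ic_lt
  sb_nonneg := normParam_nonneg h.sb_pos.le
  sb_lt := normParam_lt h.sb_le
  sc_nonneg := h.sc_nonneg
  sc_lt := hsc
  area_pos := by
    rw [edgePt_norm, cross_swap, cross_of_fst_eq h.level, Prod.fst_sub]
    have h1 := h.lt_level
    nlinarith
  edge_nonneg := by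
    rw [edgePt_norm, cross_of_fst_eq h.level]
    have h1 := hA (A + 1)
    refine mul_nonneg ?_ (sub_nonneg.2 hlt.le)
    rw [edge, Prod.fst_sub]
    linarith
  inward := by
    rw [edgePt_norm, tangentBefore_norm, tangentBefore, if_neg h.sb_pos.ne',
      balance_of_fst_eq h.level]
    exact mul_nonpos_of_nonneg_of_nonpos (sub_nonneg.2 hlt.le) hF
  outward := by
    rw [edgePt_norm]
    rcases h.apart with h1 | ⟨h1, rfl, rfl, -⟩
    · exact h1.2
    · rw [edgePt_one, edgePt_zero, h1] at hlt
      exact absurd hlt (lt_irrefl _)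

end Polygon

/-! ### One iteration of the vertical sweep and its termination -/

/-- The end points of a vertical chord move along the tangents `v` and `w` by the same amount `x`
in the horizontal direction. -/
theorem vertical_move {a b c v w : Pt} {t r x : ℝ} (h : b.1 = c.1) (hv : 0 < v.1) (hw : w.1 < 0)
    (hvw : 0 < cross v w) (hle : b.2 ≤ c.2) (hx : 0 < x) (ht : t * v.1 = x) (hr : r * w.1 = -x)
    (hG : 2 * cross v w * x ≤ (c.2 - b.2) * v.1 * w.1 + cross v w * (b.1 - a.1)) :
    (b + (-t) • v).1 = (c + r • w).1 ∧ a.1 < (b + (-t) • v).1 ∧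
      (b + (-t) • v).2 < (c + r • w).2 ∧
      ((c + r • w).2 - (b + (-t) • v).2) * v.1 * w.1 + cross v w * ((b + (-t) • v).1 - a.1) =
        (c.2 - b.2) * v.1 * w.1 + cross v w * (b.1 - a.1) - 2 * cross v w * x := by
  simp only [Prod.fst_add, Prod.snd_add, Prod.smul_fst, Prod.smul_snd, smul_eq_mul]
  refine ⟨by linarith, ?_, ?_, ?_⟩
  · have h1 : (c.2 - b.2) * v.1 * w.1 ≤ 0 :=
      mul_nonpos_of_nonneg_of_nonpos (mul_nonneg (sub_nonneg.2 hle) hv.le) hw.le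
    have h2 : 2 * x ≤ b.1 - a.1 := by
      refine le_of_mul_le_mul_left ?_ hvw
      linarith
    linarith
  · have h1 : (r * w.2 + t * v.2) * (v.1 * -w.1) = x * cross v w := by
      rw [cross]
      linear_combination (-(w.2 * v.1)) * hr + (-(v.2 * w.1)) * ht
    have h2 : 0 < r * w.2 + t * v.2 := by
      have h3 := mul_pos hv (neg_pos.2 hw)
      have h4 := mul_pos hx hvw
      rw [← h1] at h4
      exact pos_of_mul_pos_left h4 h3.le
    linarith
  · simp only [cross]
    linear_combination (w.2 * v.1) * hr + (2 * v.2 * w.1 - v.1 * w.2) * ht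

section Polygon

variable {n : ℕ} [NeZero n] {P : Fin n → Pt} {A ib ic : ℤ} {sb sc : ℝ}

/-- The outcome of an iteration of the procedure for anchored triangles. -/
def AnchoredSpec (P : Fin n → Pt) (A ib ic : ℤ) : Chord ⊕ Chord → Prop
  | Sum.inl s => AnchoredInv P A s.ib s.sb s.ic s.sc ∧ ic - ib < s.ic - s.ib
  | Sum.inr s => BalancedChord P A (normEdge s.ib s.sb) (normParam s.sb) (normEdge s.ic s.sc)
      (normParam s.sc)

theorem normEdge_of_lt (i : ℤ) {s : ℝ} (h : s < 1) : normEdge i s = i := if_neg h.ne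

theorem normParam_of_lt {s : ℝ} (h : s < 1) : normParam s = s := if_neg h.ne

/-- The state after the end points have moved by the same amount `x` in the horizontal
direction. -/
theorem AnchoredInv.move (h : AnchoredInv P A ib sb ic sc) {t r x : ℝ}
    (hv : 0 < (edge P ib).1) (hw : (edge P ic).1 < 0) (hvw : 0 < cross (edge P ib) (edge P ic))
    (hx : 0 < x) (ht : t * (edge P ib).1 = x) (hr : r * (edge P ic).1 = -x)
    (hG : 2 * cross (edge P ib) (edge P ic) * x ≤
      ((edgePt P ic sc).2 - (edgePt P ib sb).2) * (edge P ib).1 * (edge P ic).1 +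
        cross (edge P ib) (edge P ic) * ((edgePt P ib sb).1 - (vert P A).1))
    (hrc : r ≤ 1 - sc) :
    (t < sb → AnchoredInv P A ib (sb - t) ic (sc + r)) ∧
    (t = sb → AnchoredInv P A (ib - 1) 1 ic (sc + r)) := by
  obtain ⟨h1, h2, h3, h4⟩ := vertical_move h.level hv hw hvw h.snd_le hx ht hr hG
  simp only [← edgePt_add, ← sub_eq_add_neg] at h1 h2 h3 h4
  have ht0 : 0 < t := by
    by_contra h0
    nlinarith
  have hr0 : 0 < r := by
    by_contra h0
    nlinarith
  have hsb := h.sb_le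
  have hsc := h.sc_nonneg
  have hF : 0 ≤ balance (vert P A) (edgePt P ib (sb - t)) (edgePt P ic (sc + r)) (edge P ib)
      (edge P ic) := by
    rw [balance_of_fst_eq h1, h4]
    exact mul_nonneg (sub_nonneg.2 h3.le) (by linarith)
  constructor
  · intro hlt
    refine ⟨h.le_ib, h.ib_lt_ic, h.ic_lt, by linarith, by linarith, by linarith, by linarith, h1,
      h2, Or.inl ⟨h3, ?_⟩⟩
    rw [normEdge_of_lt _ (by linarith), tangentBefore, if_neg (by linarith)]
    exact hF
  -- The end `b` arrives at the vertex `ib`, now written as parameter 1 on the edge `ib - 1`. Its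
  -- normalized forward edge is still `ib`, so the same balance is inherited.
  · intro heq
    have hb : edgePt P ib (sb - t) = edgePt P (ib - 1) 1 := by
      rw [heq, sub_self, edgePt_zero, edgePt_one, sub_add_cancel]
    rw [hb] at h1 h2 h3 hF
    have hne : ib ≠ A := ne_of_vert_lt h2 (by rw [edgePt_one, sub_add_cancel])
    have := h.le_ib
    have := h.ib_lt_ic
    refine ⟨by omega, by omega, h.ic_lt, one_pos, le_rfl, by linarith, by linarith, h1,
      h2, Or.inl ⟨h3, ?_⟩⟩
    rw [normEdge, if_pos rfl, sub_add_cancel, tangentBefore, if_neg (by linarith)]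
    exact hF

/-- A state at the end of an edge, in the form used by the procedure. -/
theorem AnchoredInv.next_edge (h : AnchoredInv P A ib sb ic 1) :
    AnchoredInv P A ib sb (ic + 1) 0 := by
  have := h.norm
  simpa [normEdge, normParam] using this

/-- The balance of a vertical chord is its length times `G`. For `v ∧ w > 0` the sweep goes left
until `G` vanishes or an end reaches a vertex. On leaving, `G ≤ 0` supplies `inward`, and the gain
so far supplies `outward`. -/
theorem AnchoredInv.spec (hP : IsConvexNGon P) (hA : ∀ i, (vert P A).1 ≤ (vert P i).1)
    (h : AnchoredInv P A ib sb ic sc) (hsc : sc < 1) :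
    AnchoredSpec P A ib ic (anchoredNext (edge P ib) (edge P ic)
      (calculateTq (vert P A) (edgePt P ib sb) (edge P ib) (edgePt P ic sc) (edge P ic) (1, 0)).val
      ⟨ib, sb, ic, sc⟩) := by
  have hb0 := h.sb_pos
  unfold anchoredNext
  by_cases hv : (edge P ib).1 = 0
  · rw [if_pos hv]
    exact ⟨h.next_of_left_eq_zero hP hv, by simp only; omega⟩
  rw [if_neg hv]
  by_cases hw : (edge P ic).1 = 0
  · rw [if_pos hw]
    exact ⟨h.next_of_right_eq_zero hP hsc hw, by simp only; omega⟩
  rw [if_neg hw]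
  replace hv : 0 < (edge P ib).1 := lt_of_le_of_ne (h.left_nonneg hP) (Ne.symm hv)
  replace hw : (edge P ic).1 < 0 := lt_of_le_of_ne (h.right_nonpos hP) hw
  have hexit : (edgePt P ib sb).2 < (edgePt P ic sc).2 →
      (((edgePt P ic sc).2 - (edgePt P ib sb).2) * (edge P ib).1 * (edge P ic).1 +
      cross (edge P ib) (edge P ic) * ((edgePt P ib sb).1 - (vert P A).1)) ≤ 0 →
      AnchoredSpec P A ib ic (Sum.inr ⟨ib, sb, ic, sc⟩) := by
    intro h1 h2
    rw [AnchoredSpec, normEdge_of_lt _ hsc, normParam_of_lt hsc]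
    exact h.balanced hA hsc hw h1 h2
  -- In the degenerate initial state the two edges are consecutive and their wedge product is
  -- positive.
  have hapart : cross (edge P ib) (edge P ic) ≤ 0 → (edgePt P ib sb).2 < (edgePt P ic sc).2 := by
    intro h1
    rcases h.apart with h2 | h2
    · exact h2.1
    · rw [← h2.1] at h1
      exact absurd h1 (not_le.2 (cross_edge_edge_pos hP ib))
  have hlt := h.lt_level
  have hvw1 : ((edgePt P ic sc).2 - (edgePt P ib sb).2) * (edge P ib).1 * (edge P ic).1 ≤ 0 :=
    mul_nonpos_of_nonneg_of_nonpos (mul_nonneg (sub_nonneg.2 h.snd_le) hv.le) hw.le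
  by_cases hvw : cross (edge P ib) (edge P ic) ≤ 0
  · rw [if_pos hvw]
    exact hexit (hapart hvw) (by nlinarith)
  rw [if_neg hvw]
  rw [not_le] at hvw
  obtain ⟨G, hG⟩ : ∃ G, G = ((edgePt P ic sc).2 - (edgePt P ib sb).2) * (edge P ib).1 *
    (edge P ic).1 + cross (edge P ib) (edge P ic) * ((edgePt P ib sb).1 - (vert P A).1) := ⟨_, rfl⟩
  -- A horizontal displacement `y` lowers `G` by `2 (v ∧ w) y`, so `x` is where `G` vanishes; `t`
  -- and `r` are the corresponding parameters.
  obtain ⟨x, hx⟩ : ∃ x, x = G / (2 * cross (edge P ib) (edge P ic)) := ⟨_, rfl⟩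
  have htq : (calculateTq (vert P A) (edgePt P ib sb) (edge P ib) (edgePt P ic sc) (edge P ic)
      (1, 0)).val = -x := by
    rw [val_calculateTq, hx, hG, ← neg_div]
    congr 1
    rw [← h.level, cross]
    ring
  rw [htq, neg_neg, neg_div, ← div_neg]
  have hGx : G = 2 * cross (edge P ib) (edge P ic) * x := by rw [hx]; field_simp
  obtain ⟨t, ht⟩ : ∃ t, t = x / (edge P ib).1 := ⟨_, rfl⟩
  obtain ⟨r, hr⟩ : ∃ r, r = x / -(edge P ic).1 := ⟨_, rfl⟩
  rw [← ht, ← hr]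
  have htx : t * (edge P ib).1 = x := by rw [ht]; field_simp
  have hrx : r * (edge P ic).1 = -x := by rw [hr, div_neg, neg_mul, div_mul_cancel₀ _ hw.ne]
  by_cases hneg : t ≤ 0 ∨ r ≤ 0
  · rw [if_pos hneg]
    have hx0 : x ≤ 0 := by
      rcases hneg with h0 | h0 <;> nlinarith
    have hG0 : G ≤ 0 := by nlinarith
    refine hexit ?_ (hG ▸ hG0)
    refine lt_of_le_of_ne h.snd_le fun h0 => ?_
    rw [hG, h0, sub_self, zero_mul, zero_mul, zero_add] at hG0
    nlinarith [mul_pos hvw (sub_pos.2 hlt)]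
  rw [if_neg hneg]
  simp only [not_or, not_le] at hneg
  obtain ⟨ht0, hr0⟩ := hneg
  have hmove := fun y (hy0 : 0 < y) (hy : y ≤ x) t' r' h1 h2 =>
    h.move (t := t') (r := r') hv hw hvw hy0 h1 h2 (by rw [← hG, hGx]; gcongr)
  have hx0 : 0 < x := htx ▸ mul_pos ht0 hv
  by_cases hin : t < sb ∧ r < 1 - sc
  · rw [if_pos hin, AnchoredSpec]
    have h1 := (hmove x hx0 le_rfl t r htx hrx hin.2.le).1 hin.1
    obtain ⟨-, -, h3, h4⟩ := vertical_move h.level hv hw hvw h.snd_le hx0 htx hrx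
      (by rw [← hG, hGx])
    simp only [← edgePt_add, ← sub_eq_add_neg] at h3 h4
    have hlt1 : sc + r < 1 := by linarith [hin.2]
    rw [normEdge_of_lt _ hlt1, normParam_of_lt hlt1]
    exact h1.balanced hA hlt1 hw h3 (by rw [h4, ← hG, hGx, sub_self])
  rw [if_neg hin]
  by_cases hcmp : (1 - sc) * t < sb * r
  · rw [if_pos hcmp]
    -- The end `c` reaches its vertex first, and no later than `G` vanishes, so the displacement
    -- stays within `x`.
    have hle : 1 - sc ≤ r := by
      by_contra h0
      rw [not_le] at h0
      have h1 : sb ≤ t := by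
        by_contra h1
        exact hin ⟨not_le.1 h1, h0⟩
      nlinarith
    have h1 : (1 - sc) * t / r < sb := by rw [div_lt_iff₀ hr0]; exact hcmp
    have h2 := (hmove ((1 - sc) * -(edge P ic).1) (mul_pos (by linarith) (by linarith))
      (by nlinarith) ((1 - sc) * t / r) (1 - sc) (by
        rw [div_mul_eq_mul_div, div_eq_iff hr0.ne']
        linear_combination (1 - sc) * (htx + hrx)) (by ring) le_rfl).1 h1
    rw [add_sub_cancel] at h2
    exact ⟨h2.next_edge, by simp only; omega⟩
  · rw [if_neg hcmp]
    rw [not_lt] at hcmp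
    have hle : sb ≤ t := by
      by_contra h0
      rw [not_le] at h0
      have h1 : 1 - sc ≤ r := by
        by_contra h1
        exact hin ⟨h0, not_le.1 h1⟩
      nlinarith
    have h1 : sb * r / t ≤ 1 - sc := by rw [div_le_iff₀ ht0]; exact hcmp
    have h2 := (hmove (sb * (edge P ib).1) (mul_pos hb0 hv) (by nlinarith) sb (sb * r / t) rfl (by
        rw [div_mul_eq_mul_div, div_eq_iff ht0.ne']
        linear_combination sb * (htx + hrx)) h1).2 rfl
    exact ⟨h2, by simp only; omega⟩

/-- Each continued iteration increases `ic - ib`, which stays below `n` because both indices lie in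
one period after the apex. -/
theorem exists_anchoredLoop (hP : IsConvexNGon P) {k ia : ℤ} {s : Chord}
    (hA : ∀ i, (vert P ia).1 ≤ (vert P i).1)
    (hs : AnchoredInv P (ia - k * n) s.ib s.sb s.ic s.sc) :
    ∃ r N t, Loop (anchoredStep P (1, 0) ia) s r N t ∧
      BalancedChord P (ia - k * n) (normEdge r.ib r.sb) (normParam r.sb) (normEdge r.ic r.sc)
        (normParam r.sc) ∧ N ≤ 2 * n ∧ t ≤ 1000 * 41 * 2 * n := by
  have hn := hP.1
  have hbound : ∀ s : Chord, AnchoredInv P (ia - k * n) s.ib s.sb s.ic s.sc →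
      normEdge s.ic s.sc - s.ib < n ∧ 0 < normEdge s.ic s.sc - s.ib := by
    intro s hs
    have h1 := hs.le_ib
    have h2 := hs.norm.ic_lt
    have h3 := hs.norm.ib_lt_ic
    omega
  obtain ⟨r, N, t, hL, hR, hN, ht⟩ := Loop.exists_of_measure
    (body := anchoredStep P (1, 0) ia)
    (fun s => AnchoredInv P (ia - k * n) s.ib s.sb s.ic s.sc)
    (fun r => BalancedChord P (ia - k * n) (normEdge r.ib r.sb) (normParam r.sb)
      (normEdge r.ic r.sc) (normParam r.sc))
    (fun s => (n - (normEdge s.ic s.sc - s.ib)).toNat) (1000 * 40) (ops_anchoredStep P (1, 0) ia)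
    (by
      intro s hs
      have h1 := hs.norm.spec hP (by rw [vert_sub_mul]; exact hA) (normParam_lt hs.sc_le)
      rw [edgePt_norm, vert_sub_mul] at h1
      have h2 := anchoredStep_val P ia hs.sb_pos.ne'
      rw [← h2] at h1
      rcases h3 : (anchoredStep P (1, 0) ia s).val with s' | s'
      · right
        rw [h3] at h1
        refine ⟨s', rfl, h1.1, ?_⟩
        have h4 := h1.2
        have h5 := hbound s hs
        have h6 := hbound s' h1.1
        have h7 := le_normEdge s'.ic s'.sc
        omega
      · left
        rw [h3] at h1
        exact ⟨s', rfl, h1⟩) s hs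
  have h5 := hbound s hs
  have h4 : (n - (normEdge s.ic s.sc - s.ib)).toNat + 1 ≤ 2 * n := by omega
  refine ⟨r, N, t, hL, hR, by omega, ?_⟩
  have := Nat.mul_le_mul_left (1000 * 40 + 1) h4
  omega

end Polygon

/-! ### Linear scans for extreme vertices -/

section Scan

variable {n : ℕ} [NeZero n] {f : Fin n → Timed ℝ} {K : ℕ}

theorem argmin_spec (hf : ∀ i, (f i).ops ≤ K) :
    (∀ i, (f (argmin f).val).val ≤ (f i).val) ∧ (argmin f).ops ≤ (2 * K + 2) * n := by
  have key : ∀ (l : List (Fin n)) (j : Fin n),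
      let r := l.foldlM (fun best i => do
        let _ ← (⟨(), 1⟩ : Timed Unit)
        if (← lt (f i) (f best)) then pure i else pure best) j
      (f r.val).val ≤ (f j).val ∧ (∀ i ∈ l, (f r.val).val ≤ (f i).val) ∧
        r.ops ≤ (2 * K + 2) * l.length := by
    intro l
    induction l with
    | nil => intro j; simp
    | cons i l ih =>
      intro j
      have h1 := hf i
      have h2 := hf j
      simp only [List.foldlM_cons, val_bind, ops_bind, val_lt, ops_lt, val_ite, ops_ite,
        val_pure, ops_pure, test_eq_true_iff, List.mem_cons, forall_eq_or_imp, List.length_cons]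
      split_ifs with h
      · obtain ⟨h3, h4, h5⟩ := ih i
        refine ⟨h3.trans h.le, ⟨h3, h4⟩, ?_⟩
        rw [Nat.mul_add (2 * K + 2)]
        omega
      · obtain ⟨h3, h4, h5⟩ := ih j
        refine ⟨h3, ⟨h3.trans (not_lt.1 h), h4⟩, ?_⟩
        rw [Nat.mul_add (2 * K + 2)]
        omega
  obtain ⟨-, h1, h2⟩ := key (List.finRange n) 0
  rw [List.length_finRange] at h2
  exact ⟨fun i => h1 i (List.mem_finRange i), h2⟩

theorem argmax_spec (hf : ∀ i, (f i).ops ≤ K) :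
    (∀ i, (f i).val ≤ (f (argmax f).val).val) ∧ (argmax f).ops ≤ (2 * K + 2) * n := by
  have key : ∀ (l : List (Fin n)) (j : Fin n),
      let r := l.foldlM (fun best i => do
        let _ ← (⟨(), 1⟩ : Timed Unit)
        if (← lt (f best) (f i)) then pure i else pure best) j
      (f j).val ≤ (f r.val).val ∧ (∀ i ∈ l, (f i).val ≤ (f r.val).val) ∧
        r.ops ≤ (2 * K + 2) * l.length := by
    intro l
    induction l with
    | nil => intro j; simp
    | cons i l ih =>
      intro j
      have h1 := hf i
      have h2 := hf j
      simp only [List.foldlM_cons, val_bind, ops_bind, val_lt, ops_lt, val_ite, ops_ite,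
        val_pure, ops_pure, test_eq_true_iff, List.mem_cons, forall_eq_or_imp, List.length_cons]
      split_ifs with h
      · obtain ⟨h3, h4, h5⟩ := ih i
        refine ⟨h.le.trans h3, ⟨h3, h4⟩, ?_⟩
        rw [Nat.mul_add (2 * K + 2)]
        omega
      · obtain ⟨h3, h4, h5⟩ := ih j
        refine ⟨h3, ⟨(not_lt.1 h).trans h3, h4⟩, ?_⟩
        rw [Nat.mul_add (2 * K + 2)]
        omega
  obtain ⟨-, h1, h2⟩ := key (List.finRange n) 0
  rw [List.length_finRange] at h2
  exact ⟨fun i => h1 i (List.mem_finRange i), h2⟩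

end Scan

/-! ### The initial chord and the existence of a maximal triangle -/

section Polygon

variable {n : ℕ} [NeZero n] {P : Fin n → Pt}

theorem anchoredInit_spec (P : Fin n → Pt) : ∃ ia ic : ℤ,
    (anchoredInit P (1, 0)).val = (ia, ⟨ic - 1, 1, ic, 0⟩) ∧
    (anchoredInit P (1, 0)).ops ≤ 25 * n ∧ 0 ≤ ia ∧ ia < n ∧ 0 ≤ ic ∧ ic < n ∧
    (∀ i, (vert P ia).1 ≤ (vert P i).1) ∧ ∀ i, (vert P i).1 ≤ (vert P ic).1 := by
  have hops : ∀ i : Fin n, (do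
      let p ← vertex P (i.val : ℤ)
      dot (1, 0) p : Timed ℝ).ops ≤ 5 := by simp
  have hn := NeZero.pos n
  obtain ⟨h1, h2⟩ := argmin_spec hops
  obtain ⟨h3, h4⟩ := argmax_spec hops
  simp only [val_bind, val_vertex, val_dot, vert_natCast] at h1 h3
  refine ⟨((argmin _).val.val : ℤ), ((argmax _).val.val : ℤ), rfl, ?_, by positivity, by exact_mod_cast Fin.isLt _, by positivity,
    by exact_mod_cast Fin.isLt _, fun i => ?_, fun i => ?_⟩
  · simp only [anchoredInit, ops_bind, ops_sub, ops_reg, ops_pure, ops_ofNat]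
    omega
  · rw [vert_natCast]; exact h1 _
  · rw [vert_natCast]; exact h3 _

theorem exists_vert_lt (hP : IsConvexNGon P) {ia ic : ℤ}
    (h1 : ∀ i, (vert P ia).1 ≤ (vert P i).1) (h2 : ∀ i, (vert P i).1 ≤ (vert P ic).1) :
    (vert P ia).1 < (vert P ic).1 := by
  by_contra h
  have h3 : ∀ i, (vert P i).1 = (vert P ia).1 := fun i =>
    le_antisymm ((h2 i).trans (not_lt.1 h)) (h1 i)
  have h4 := cross_edge_edge_pos hP 0
  simp [cross, edge, h3] at h4

theorem anchoredInv_init (hP : IsConvexNGon P) {ia ic : ℤ} (hia0 : 0 ≤ ia) (hia : ia < n)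
    (hic0 : 0 ≤ ic) (hic : ic < n) (h1 : ∀ i, (vert P ia).1 ≤ (vert P i).1)
    (h2 : ∀ i, (vert P i).1 ≤ (vert P ic).1) :
    ∃ k : ℤ, 0 ≤ k ∧ k ≤ 1 ∧ AnchoredInv P (ia - k * n) (ic - 1) 1 ic 0 := by
  have hlt := exists_vert_lt hP h1 h2
  have hne : ic ≠ ia := ne_of_vert_lt hlt rfl
  -- Both scanned indices lie in `[0, n)`, but the apex must precede the chord; shifting it back by
  -- one period, if needed, achieves this.
  obtain ⟨k, hk0, hk1, hk2, hk3⟩ : ∃ k : ℤ, 0 ≤ k ∧ k ≤ 1 ∧ ia - k * n ≤ ic - 1 ∧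
      ic < ia - k * n + n := by
    rcases lt_or_gt_of_ne hne with h | h
    · exact ⟨1, by omega, by omega, by omega, by omega⟩
    · exact ⟨0, by omega, by omega, by omega, by omega⟩
  have hb : edgePt P (ic - 1) 1 = vert P ic := by rw [edgePt_one, sub_add_cancel]
  refine ⟨k, hk0, hk1, hk2, by omega, hk3, one_pos, le_rfl, le_rfl, zero_le_one, ?_, ?_,
    Or.inr ⟨by omega, rfl, rfl, ?_, ?_⟩⟩
  · rw [hb, edgePt_zero]
  · rw [hb, vert_sub_mul]; exact hlt
  · rw [edge, sub_add_cancel, Prod.fst_sub]; linarith [h2 (ic - 1)]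
  · rw [edge, Prod.fst_sub]; linarith [h2 (ic + 1)]

theorem orient_le_of_mem_convexHull {S : Set Pt} {x y z : Pt} {M : ℝ}
    (h : ∀ x ∈ S, orient x y z ≤ M) (hx : x ∈ convexHull ℝ S) : orient x y z ≤ M := by
  refine convexHull_min (t := {x | orient x y z ≤ M}) h ?_ hx
  intro p hp q hq s t hs ht hst
  have e : orient (s • p + t • q) y z = s * orient p y z + t * orient q y z := by
    obtain rfl : s = 1 - t := by linarith
    simp only [orient, Prod.fst_add, Prod.snd_add, Prod.smul_fst, Prod.smul_snd, smul_eq_mul]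
    ring
  change orient p y z ≤ M at hp
  change orient q y z ≤ M at hq
  change orient (s • p + t • q) y z ≤ M
  rw [e]
  calc s * orient p y z + t * orient q y z ≤ s * M + t * M := by gcongr
    _ = M := by rw [← add_mul, hst, one_mul]

/-- The signed area is affine in each corner, so its maximum over the hull is attained at vertices.
The representative of the apex is chosen in the one period through which the main loop is sure to
pass. -/
theorem exists_isMaximal (hP : IsConvexNGon P) (i₀ : ℤ) :
    ∃ m i j : ℤ, i₀ < m ∧ m ≤ i₀ + n ∧ IsMaximal P m i j := by
  obtain ⟨⟨p, q, r⟩, hmax⟩ := Finite.exists_max fun t : Fin n × Fin n × Fin n =>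
    orient (P t.1) (P t.2.1) (P t.2.2)
  obtain ⟨m, hm1, hm2, hm3⟩ := exists_mem_period hP (i₀ + 1) p.val
  have hn := hP.1
  refine ⟨m, q.val, r.val, by omega, by omega, ?_⟩
  have hpos := hP.2 ⟨0, by omega⟩ ⟨1, by omega⟩ ⟨2, by omega⟩
    (Fin.mk_lt_mk.2 (by omega)) (Fin.mk_lt_mk.2 (by omega))
  constructor <;> rw [← hm3] <;> simp only [vert_natCast]
  · exact hpos.trans_le (hmax (_, _, _))
  · intro x hx y hy z hz
    refine orient_le_of_mem_convexHull ?_ hx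
    rintro _ ⟨i, rfl⟩
    rw [← orient_rotate]
    refine orient_le_of_mem_convexHull ?_ hy
    rintro _ ⟨j, rfl⟩
    rw [← orient_rotate]
    refine orient_le_of_mem_convexHull ?_ hz
    rintro _ ⟨k, rfl⟩
    rw [← orient_rotate]
    exact hmax (_, _, _)

theorem IsMaximal.triArea_le {m i j : ℤ} (h : IsMaximal P m i j) {x y z : Pt}
    (hx : x ∈ convexHull ℝ (Set.range P)) (hy : y ∈ convexHull ℝ (Set.range P))
    (hz : z ∈ convexHull ℝ (Set.range P)) :
    triArea x y z ≤ orient (vert P m) (vert P i) (vert P j) / 2 := by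
  have h1 := h.le x hx y hy z hz
  have h2 := h.le x hx z hz y hy
  rw [orient_swap] at h2
  unfold triArea
  have := abs_le.2 ⟨by linarith, h1⟩
  linarith

end Polygon

end MaxTriangle

end

/-! ### Assembly -/

theorem mainTheorem1 :
    ∃ C : ℕ, ∀ (n : ℕ) [NeZero n] (P : Fin n → ℝ × ℝ), MaxTriangle.IsConvexNGon P →
      ∃ (i j k : Fin n) (iters time : ℕ),
        MaxTriangle.LargestInscribedTriangle P (some (i, j, k)) iters time ∧
        MaxTriangle.IsLargestInscribed P i j k ∧
        iters ≤ C * n ∧ time ≤ C * n := by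
  open MaxTriangle in
  -- The scans cost `25 n`, the sweep `82000 n` and the main loop `4100000 n` operations.
  refine ⟨5000000, fun n _ P hP => ?_⟩
  obtain ⟨ia, ic, hval, hops, hia0, hia, hic0, hic, hmin, hmax⟩ := anchoredInit_spec P
  obtain ⟨k, hk0, hk1, hinv⟩ := anchoredInv_init hP hia0 hia hic0 hic hmin hmax
  obtain ⟨chord, N₁, t₁, hL₁, hB, hN₁, ht₁⟩ :=
    exists_anchoredLoop hP (s := ⟨ic - 1, 1, ic, 0⟩) hmin hinv
  obtain ⟨m, i, j, hm1, hm2, hM⟩ := exists_isMaximal hP ia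
  obtain ⟨p, q, r, N₂, t₂, hL₂, hle, hN₂, ht₂⟩ := exists_mainLoop hP hM hm2 hk0 hk1 hia0 hia
    (s := ⟨ia, chord, 0, none⟩)
    -- Because `m` exceeds the initial apex index, the conditions `passed` and `turned` hold
    -- vacuously at the start.
    ⟨hB, le_rfl, by simp only; omega, Or.inl ⟨rfl, rfl⟩, fun h => absurd h (not_lt.2 hm1.le),
      fun h => absurd h hm1.ne⟩
  refine ⟨p, q, r, N₁ + N₂, (anchoredInit P (1, 0)).ops + t₁ + t₂,
    ⟨chord, N₁, t₁, N₂, t₂, ?_, ?_, rfl, rfl⟩, fun x hx y hy z hz =>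
      (hM.triArea_le hx hy hz).trans hle, by omega, by omega⟩
  · rw [hval]; exact hL₁
  · rw [hval]; exact hL₂
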